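/- Lemma 4. For an array $A[1..n]$, a number $\tau\in(0,1/2]$ and $1\le i\le j\le n$, a $\tau$-majority of $A[i..j]$ is an element that occurs at least $\tau(j-i+1)$ times in $A[i..j]$. A range $\tau$-majority position query $[i,j]$ asks for a list of positions in $[i,j]$ that contains exactly one (arbitrary) position of each $\tau$-majority of $A[i..j]$ and no other positions. There are absolute constants $C,\kappa>0$ such that for every $\tau\in(0,1/2]$ and every $n$, each array $A$ of $n$ elements from an arbitrary alphabet has an encoding of at most $C\,n\lg(1/\tau)$ bits from which, without access to $A$, the answers to all range $\tau$-majority position queries on $A$ can be recovered. Moreover, on a word RAM with word size $w\ge\kappa\lg(n+1)$, a single program, the same for all $A$, $n$, $\tau$ and $w$, answers each such query from $n$, $i$, $j$ and the encoding alone in time at most $C\,\lg^2(n+1)/\tau$ (that is, $\mathcal{O}(\lg^2 n/\tau)$ for $n\ge 2$). Here $\lg=\log_2$. -/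

import Mathlib

universe u

/-! ### Range majority position queries -/

namespace RangeMajority

/-- The number of occurrences of the element `a` in the subarray `A[i..j]`
(array positions are numbered from `0` to `n - 1`). -/
def freq {n : ℕ} {α : Type u} [DecidableEq α] (A : Fin n → α) (i j : Fin n) (a : α) : ℕ :=
  ((Finset.Icc i j).filter (fun l => A l = a)).card

/-- `a` is a `τ`-majority of `A[i..j]`: its frequency there is at least `τ (j - i + 1)`. -/
def IsMajority {n : ℕ} {α : Type u} [DecidableEq α] (τ : ℝ) (A : Fin n → α) (i j : Fin n)
    (a : α) : Prop :=
  τ * (((j : ℕ) : ℝ) - ((i : ℕ) : ℝ) + 1) ≤ (freq A i j a : ℝ)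

/-- `L` is a correct answer to the range `τ`-majority position query `[i, j]` on `A`: it is a list
of positions inside `[i, j]` which contains exactly one position of each `τ`-majority of `A[i..j]`,
and nothing else. Which occurrence of a majority is listed, and the order, are arbitrary. -/
def IsAnswer {n : ℕ} {α : Type u} [DecidableEq α] (τ : ℝ) (A : Fin n → α) (i j : Fin n)
    (L : List (Fin n)) : Prop :=
  (∀ l ∈ L, i ≤ l ∧ l ≤ j) ∧ (L.map A).Nodup ∧ ∀ a : α, a ∈ L.map A ↔ IsMajority τ A i j a

end RangeMajority

/-! ### The word RAM

A machine with words of `w` bits (natural numbers below `2 ^ w`), registers, a random access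
working memory, a read-only bit string (the encoding that is queried), and an output list.
A program is a finite text that does not depend on `w` or on the input; every elementary
instruction and every test of a conditional or of a loop takes one unit of time. -/

namespace WordRAM

/-- The binary word operations. -/
inductive BinOp
  | add | sub | mul | div | mod | shl | shr | and | or | xor | lt | eq

/-- The result of a word operation on `w`-bit words, reduced modulo `2 ^ w`. Subtraction wraps
around, comparisons return `1` or `0`, `x / 0` is `0` and `x mod 0` is `x`. -/
def BinOp.eval (w : ℕ) (o : BinOp) (x y : ℕ) : ℕ :=
  (match o with
    | .add => x + y
    | .sub => x + (2 ^ w - y)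
    | .mul => x * y
    | .div => x / y
    | .mod => x % y
    | .shl => x * 2 ^ y
    | .shr => x / 2 ^ y
    | .and => Nat.land x y
    | .or => Nat.lor x y
    | .xor => Nat.xor x y
    | .lt => if x < y then 1 else 0
    | .eq => if x = y then 1 else 0) % 2 ^ w

/-- Programs; the arguments `d a b r` are numbers of registers. -/
inductive Cmd
  /-- do nothing -/
  | skip
  /-- put the constant `c` into register `d` -/
  | const (d c : ℕ)
  /-- apply `o` to registers `a` and `b`, result in register `d` -/
  | op (o : BinOp) (d a b : ℕ)
  /-- put the word at the working memory address in register `a` into register `d` -/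
  | load (d a : ℕ)
  /-- write register `b` to the working memory address in register `a` -/
  | store (a b : ℕ)
  /-- read bits of the encoding into register `d`: the position of the first bit is in register
  `a`, the number of bits in register `b` -/
  | fetch (d a b : ℕ)
  /-- append register `a` to the output -/
  | emit (a : ℕ)
  /-- sequential composition -/
  | seq (p q : Cmd)
  /-- run `p` if register `r` is nonzero, and `q` otherwise -/
  | ite (r : ℕ) (p q : Cmd)
  /-- run `p` as long as register `r` is nonzero -/
  | loop (r : ℕ) (p : Cmd)

/-- A configuration of the machine. -/
structure State where
  /-- the registers -/
  reg : ℕ → ℕ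
  /-- the working memory -/
  mem : ℕ → ℕ
  /-- the output so far -/
  out : List ℕ

/-- Write `v` into register `d`. -/
def State.setReg (s : State) (d v : ℕ) : State :=
  { s with reg := Function.update s.reg d v }

/-- The number whose binary digits are the at most `min k w` bits of the string `e` from position
`p` on, least significant bit first. (If `e` is stored in consecutive `w`-bit words, these bits lie
in at most two neighbouring words, so that this is a constant number of word operations.) -/
def readBits (w : ℕ) (e : List Bool) (p k : ℕ) : ℕ :=
  Nat.ofDigits 2 (((e.drop p).take (min k w)).map Bool.toNat)

/-- `Exec w e c s t s'`: with word size `w` and encoding `e`, the program `c` started in the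
configuration `s` halts after exactly `t` units of time in the configuration `s'`. -/
inductive Exec (w : ℕ) (e : List Bool) : Cmd → State → ℕ → State → Prop
  | skip (s : State) : Exec w e .skip s 1 s
  | const (d c : ℕ) (s : State) : Exec w e (.const d c) s 1 (s.setReg d (c % 2 ^ w))
  | op (o : BinOp) (d a b : ℕ) (s : State) :
      Exec w e (.op o d a b) s 1 (s.setReg d (o.eval w (s.reg a) (s.reg b)))
  | load (d a : ℕ) (s : State) : Exec w e (.load d a) s 1 (s.setReg d (s.mem (s.reg a)))
  | store (a b : ℕ) (s : State) :
      Exec w e (.store a b) s 1 { s with mem := Function.update s.mem (s.reg a) (s.reg b) }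
  | fetch (d a b : ℕ) (s : State) :
      Exec w e (.fetch d a b) s 1 (s.setReg d (readBits w e (s.reg a) (s.reg b)))
  | emit (a : ℕ) (s : State) : Exec w e (.emit a) s 1 { s with out := s.out ++ [s.reg a] }
  | seq {p q : Cmd} {s s' s'' : State} {t t' : ℕ} :
      Exec w e p s t s' → Exec w e q s' t' s'' → Exec w e (.seq p q) s (t + t') s''
  | iteTrue {r : ℕ} {p q : Cmd} {s s' : State} {t : ℕ} :
      s.reg r ≠ 0 → Exec w e p s t s' → Exec w e (.ite r p q) s (1 + t) s'
  | iteFalse {r : ℕ} {p q : Cmd} {s s' : State} {t : ℕ} :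
      s.reg r = 0 → Exec w e q s t s' → Exec w e (.ite r p q) s (1 + t) s'
  | loopDone {r : ℕ} {p : Cmd} {s : State} :
      s.reg r = 0 → Exec w e (.loop r p) s 1 s
  | loopStep {r : ℕ} {p : Cmd} {s s' s'' : State} {t t' : ℕ} :
      s.reg r ≠ 0 → Exec w e p s t s' → Exec w e (.loop r p) s' t' s'' →
      Exec w e (.loop r p) s (1 + t + t') s''

/-- The initial configuration for the query `[i, j]` on an array of length `n`: the numbers
`n, i, j` are in registers `0, 1, 2`, all other registers and the working memory are zero, and
the output is empty. -/
def initState (n i j : ℕ) : State where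
  reg := fun r => if r = 0 then n else if r = 1 then i else if r = 2 then j else 0
  mem := fun _ => 0
  out := []

end WordRAM

/-! Parameters. The threshold is replaced by the least fraction `p / d ≥ τ` with `p ≤ d ≤ n`: a
ratio `c / m` with `m ≤ n` cannot separate the two, and unlike `τ` the integers `p`, `d` fit in a
header. Choose `q` with `6 d ≤ 2 ^ q p < 12 d`, so that `2 ^ q = O(1 / τ)`, and an even `K` with `12
n ≤ 2 ^ K ≤ 48 n`.

Structure. An element is heavy in a dyadic block of size `2 ^ s` if it occurs there at least `2 ^ (s
- q)` times. Every position is attached to the largest block around it in which its element is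
heavy; the pairs (block, element) that arise are represented by leaders, and each leader gets a bit
vector over its block that marks the occurrences. Each position is attached to one leader only, and
a leader of level `s` owns at least `2 ^ (s - q)` positions. Hence a block has at most `2 ^ q`
leaders (`leaders_le`), all bit vectors together have length at most `2 ^ q * 2 ^ (K + 1)`
(`cells_le`), and each position contributes a single one. Preceded by a unary count of the leaders
of every block, they form one set `Keys` of at most `4 n` numbers below `2 ^ (K + 3 + q)`.

Space. A tree of counts over intervals of length `2 ^ q`, together with the `q` low bits of each
element, stores this set in `O(n q) = O(n lg (1 / τ))` bits (`length_encode`) and supports rank and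
select in `O(K)` steps (`runs_rank`, `runs_select`). No pointers are needed: all bit vectors of one
level have equal length, so ranks determine where each starts (`base_eq`).

Queries. For a range of length `m` let `s0 ≥ q` be least with `2 ^ s0 ≥ 3 m`. The array is stored
twice, the second copy displaced by about one or two thirds of a block modulo every block size, so
in one of the copies the range lies inside a block of size `2 ^ s0` (`shift_block`). Either `s0 =
q`, where a single occurrence is heavy, or the block is shorter than `6 m`; so each majority is
heavy in it (`Freq.heavy`), and the maximal block of an occurrence in the range contains the range
(`exists_around`). For a given element there is only one such block (`around_unique`). It thus
suffices to inspect, on each level from `K` down to `s0`, the at most `2 ^ q` leaders of the one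
block around the range, counting by two ranks and locating by a select. The total is `O(2 ^ q K ^
2)`. -/

/-! ### A structured programming layer over the word RAM -/

namespace WordRAM

/-- Expressions over the registers. -/
inductive Expr
  | var (x : ℕ)
  | lit (c : ℕ)
  | bin (o : BinOp) (a b : Expr)
  | rd (a b : Expr)

namespace Expr

/-- All variables of the expression are registers below `32`. -/
def wf : Expr → Bool
  | var x => decide (x < 32)
  | lit _ => true
  | bin _ a b => wf a && wf b
  | rd a b => wf a && wf b

/-- Code that leaves the value of an expression in register `d`, using registers from `d` on. -/
def compile : Expr → ℕ → Cmd
  | var x, d => .op .or d x x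
  | lit c, d => .const d c
  | bin o a b, d => .seq (compile a d) (.seq (compile b (d + 1)) (.op o d d (d + 1)))
  | rd a b, d => .seq (compile a d) (.seq (compile b (d + 1)) (.fetch d d (d + 1)))

/-- The running time of the compiled expression. -/
def cost : Expr → ℕ
  | var _ => 1
  | lit _ => 1
  | bin _ a b => cost a + (cost b + 1)
  | rd a b => cost a + (cost b + 1)

/-- The value computed by the compiled expression. -/
def ev (w : ℕ) (e : List Bool) (σ : ℕ → ℕ) : Expr → ℕ
  | var x => BinOp.or.eval w (σ x) (σ x)
  | lit c => c % 2 ^ w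
  | bin o a b => o.eval w (ev w e σ a) (ev w e σ b)
  | rd a b => readBits w e (ev w e σ a) (ev w e σ b)

end Expr

/-- The truth value of `x < y`. -/
def ltNat (x y : ℕ) : ℕ := if x < y then 1 else 0

/-- The truth value of `x = y`. -/
def eqNat (x y : ℕ) : ℕ := if x = y then 1 else 0

theorem ltNat_eq_zero {x y : ℕ} : ltNat x y = 0 ↔ ¬ x < y := by
  unfold ltNat; split_ifs <;> simp [*]

theorem eqNat_eq_zero {x y : ℕ} : eqNat x y = 0 ↔ ¬ x = y := by
  unfold eqNat; split_ifs <;> simp [*]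

/-- The operations on natural numbers without a word size. -/
def BinOp.nat (o : BinOp) (x y : ℕ) : ℕ :=
  match o with
  | .add => x + y
  | .sub => x - y
  | .mul => x * y
  | .div => x / y
  | .mod => x % y
  | .shl => x * 2 ^ y
  | .shr => x / 2 ^ y
  | .and => Nat.land x y
  | .or => Nat.lor x y
  | .xor => Nat.xor x y
  | .lt => ltNat x y
  | .eq => eqNat x y

/-- A condition under which the word operation agrees with the operation on natural numbers. -/
def BinOp.safe (w : ℕ) (o : BinOp) (x y : ℕ) : Prop :=
  match o with
  | .add => x + y < 2 ^ w
  | .sub => y ≤ x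
  | .mul => x * y < 2 ^ w
  | .div => True
  | .mod => True
  | .shl => x * 2 ^ y < 2 ^ w
  | .shr => True
  | .and => True
  | .or => True
  | .xor => True
  | .lt => 0 < w
  | .eq => 0 < w

/-- Excludes wraparound once and for all, so that programs can be verified in `ℕ`. The size bound on
the result is what lets this be iterated through nested expressions. -/
theorem BinOp.eval_eq_nat {w : ℕ} {o : BinOp} {x y : ℕ} (hx : x < 2 ^ w) (hy : y < 2 ^ w)
    (h : o.safe w x y) : o.eval w x y = o.nat x y ∧ o.nat x y < 2 ^ w := by
  have one_lt : 0 < w → 1 < 2 ^ w := fun h => Nat.one_lt_two_pow (by omega)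
  have hp : 0 < 2 ^ w := by positivity
  suffices H : o.nat x y < 2 ^ w ∧ o.eval w x y = o.nat x y from ⟨H.2, H.1⟩
  cases o <;> simp only [BinOp.safe, BinOp.eval, BinOp.nat, ltNat, eqNat] at *
  case add => exact ⟨h, Nat.mod_eq_of_lt h⟩
  case sub =>
    refine ⟨by omega, ?_⟩
    have : x + (2 ^ w - y) = (x - y) + 2 ^ w := by omega
    rw [this, Nat.add_mod_right, Nat.mod_eq_of_lt (by omega)]
  case mul => exact ⟨h, Nat.mod_eq_of_lt h⟩
  case div =>
    have := lt_of_le_of_lt (Nat.div_le_self x y) hx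
    exact ⟨this, Nat.mod_eq_of_lt this⟩
  case mod =>
    have := lt_of_le_of_lt (Nat.mod_le x y) hx
    exact ⟨this, Nat.mod_eq_of_lt this⟩
  case shl => exact ⟨h, Nat.mod_eq_of_lt h⟩
  case shr =>
    have := lt_of_le_of_lt (Nat.div_le_self x (2 ^ y)) hx
    exact ⟨this, Nat.mod_eq_of_lt this⟩
  case and =>
    have : x.land y < 2 ^ w := Nat.and_lt_two_pow x hy
    exact ⟨this, Nat.mod_eq_of_lt this⟩
  case or =>
    have : x.lor y < 2 ^ w := Nat.or_lt_two_pow hx hy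
    exact ⟨this, Nat.mod_eq_of_lt this⟩
  case xor =>
    have : x.xor y < 2 ^ w := Nat.xor_lt_two_pow hx hy
    exact ⟨this, Nat.mod_eq_of_lt this⟩
  case lt =>
    have := one_lt h
    split_ifs <;> exact ⟨by omega, Nat.mod_eq_of_lt (by omega)⟩
  case eq =>
    have := one_lt h
    split_ifs <;> exact ⟨by omega, Nat.mod_eq_of_lt (by omega)⟩

theorem readBits_lt (w : ℕ) (e : List Bool) (p k : ℕ) : readBits w e p k < 2 ^ w := by
  unfold readBits
  set l := ((e.drop p).take (min k w)).map Bool.toNat with hl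
  have h1 : Nat.ofDigits 2 l < 2 ^ l.length := by
    apply Nat.ofDigits_lt_base_pow_length (by norm_num)
    intro x hx
    rw [hl, List.mem_map] at hx
    obtain ⟨b, -, rfl⟩ := hx
    cases b <;> simp
  refine lt_of_lt_of_le h1 (Nat.pow_le_pow_right (by norm_num) ?_)
  simp [hl]

namespace Expr

/-- The value of an expression over the natural numbers. -/
def val (w : ℕ) (e : List Bool) (σ : ℕ → ℕ) : Expr → ℕ
  | var x => σ x
  | lit c => c
  | bin o a b => o.nat (val w e σ a) (val w e σ b)
  | rd a b => readBits w e (val w e σ a) (val w e σ b)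

/-- No overflow occurs in the evaluation of an expression. -/
def ok (w : ℕ) (e : List Bool) (σ : ℕ → ℕ) : Expr → Prop
  | var x => σ x < 2 ^ w
  | lit c => c < 2 ^ w
  | bin o a b => ok w e σ a ∧ ok w e σ b ∧ o.safe w (val w e σ a) (val w e σ b)
  | rd a b => ok w e σ a ∧ ok w e σ b

theorem ev_eq_val {w : ℕ} {e : List Bool} {σ : ℕ → ℕ} {a : Expr} (h : a.ok w e σ) :
    a.ev w e σ = a.val w e σ ∧ a.val w e σ < 2 ^ w := by
  induction a with
  | var x =>
    simp only [ok] at h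
    -- There is no move instruction: a register is copied by combining it with itself under `or`.
    have h2 : (σ x).lor (σ x) = σ x := Nat.or_self (σ x)
    simp only [ev, val, BinOp.eval, h2]
    exact ⟨Nat.mod_eq_of_lt h, h⟩
  | lit c => exact ⟨Nat.mod_eq_of_lt h, h⟩
  | bin o a b iha ihb =>
    obtain ⟨h1, h2, h3⟩ := h
    obtain ⟨ha, ha'⟩ := iha h1
    obtain ⟨hb, hb'⟩ := ihb h2
    simp only [ev, val, ha, hb]
    exact BinOp.eval_eq_nat ha' hb' h3
  | rd a b iha ihb =>
    obtain ⟨h1, h2⟩ := h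
    simp only [ev, val, (iha h1).1, (ihb h2).1]
    exact ⟨trivial, readBits_lt _ _ _ _⟩

/-- Registers from `32` on serve as an evaluation stack: the second operand is computed one register
higher, so the first one survives. The variables, being below `32`, are never touched. -/
theorem exec_compile (w : ℕ) (e : List Bool) (σ : ℕ → ℕ) (a : Expr) (hwf : a.wf = true) :
    ∀ (d : ℕ) (s : State), 32 ≤ d → (∀ x < 32, s.reg x = σ x) →
      ∃ s', Exec w e (a.compile d) s a.cost s' ∧ s'.reg d = a.ev w e σ ∧
        (∀ x < d, s'.reg x = s.reg x) ∧ s'.out = s.out := by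
  induction a with
  | var x =>
    intro d s hd hs
    simp only [wf, decide_eq_true_eq] at hwf
    refine ⟨_, Exec.op .or d x x s, ?_, ?_, rfl⟩
    · simp [State.setReg, ev, hs x hwf]
    · intro y hy
      simp [State.setReg, Function.update_of_ne (ne_of_lt hy)]
  | lit c =>
    intro d s hd hs
    refine ⟨_, Exec.const d c s, ?_, ?_, rfl⟩
    · simp [State.setReg, ev]
    · intro y hy
      simp [State.setReg, Function.update_of_ne (ne_of_lt hy)]
  | bin o a b iha ihb =>
    intro d s hd hs
    simp only [wf, Bool.and_eq_true] at hwf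
    obtain ⟨s1, e1, r1, f1, o1⟩ := iha hwf.1 d s hd hs
    obtain ⟨s2, e2, r2, f2, o2⟩ := ihb hwf.2 (d + 1) s1 (by omega)
      (fun x hx => by rw [f1 x (by omega), hs x hx])
    refine ⟨_, Exec.seq e1 (Exec.seq e2 (Exec.op o d d (d + 1) s2)), ?_, ?_, ?_⟩
    · simp [State.setReg, ev, r2, f2 d (by omega), r1]
    · intro y hy
      simp [State.setReg, Function.update_of_ne (ne_of_lt hy), f2 y (by omega), f1 y hy]
    · simp [State.setReg, o1, o2]
  | rd a b iha ihb =>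
    intro d s hd hs
    simp only [wf, Bool.and_eq_true] at hwf
    obtain ⟨s1, e1, r1, f1, o1⟩ := iha hwf.1 d s hd hs
    obtain ⟨s2, e2, r2, f2, o2⟩ := ihb hwf.2 (d + 1) s1 (by omega)
      (fun x hx => by rw [f1 x (by omega), hs x hx])
    refine ⟨_, Exec.seq e1 (Exec.seq e2 (Exec.fetch d d (d + 1) s2)), ?_, ?_, ?_⟩
    · simp [State.setReg, ev, r2, f2 d (by omega), r1]
    · intro y hy
      simp [State.setReg, Function.update_of_ne (ne_of_lt hy), f2 y (by omega), f1 y hy]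
    · simp [State.setReg, o1, o2]

end Expr

namespace Cmd

/-- Assign the value of an expression to a register. -/
def assign (x : ℕ) (a : Expr) : Cmd := .seq (a.compile 32) (.op .or x 32 32)

/-- Append the value of an expression to the output. -/
def put (a : Expr) : Cmd := .seq (a.compile 32) (.emit 32)

/-- A conditional on an expression. -/
def ifExpr (a : Expr) (p q : Cmd) : Cmd := .seq (a.compile 32) (.ite 32 p q)

/-- A loop controlled by an expression. -/
def whileExpr (a : Expr) (p : Cmd) : Cmd :=
  .seq (a.compile 32) (.loop 32 (.seq p (a.compile 32)))

/-- Sequential composition of a list of programs. -/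
def block : List Cmd → Cmd
  | [] => .skip
  | c :: l => .seq c (block l)

end Cmd

/-- Started at time `T` in any configuration with the variables `σ` (the registers below `32`) and
the output `o`, the program `c` halts with variables, output and time that satisfy `Q`. -/
def Runs (w : ℕ) (e : List Bool) (c : Cmd) (σ : ℕ → ℕ) (o : List ℕ) (T : ℕ)
    (Q : (ℕ → ℕ) → List ℕ → ℕ → Prop) : Prop :=
  ∀ s : State, (∀ x < 32, s.reg x = σ x) → s.out = o →
    ∃ t s' σ', Exec w e c s t s' ∧ (∀ x < 32, s'.reg x = σ' x) ∧ Q σ' s'.out (T + t)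

/-! ### Rules of a program logic that counts time -/

namespace Runs

variable {w : ℕ} {e : List Bool} {σ : ℕ → ℕ} {o : List ℕ} {T : ℕ}
  {Q R : (ℕ → ℕ) → List ℕ → ℕ → Prop}

theorem mono {c : Cmd} (h : Runs w e c σ o T Q) (hQ : ∀ σ' o' T', Q σ' o' T' → R σ' o' T') :
    Runs w e c σ o T R := by
  intro s hs ho
  obtain ⟨t, s', σ', h1, h2, h3⟩ := h s hs ho
  exact ⟨t, s', σ', h1, h2, hQ _ _ _ h3⟩

/-- The postcondition of the first part is the claim about the rest, carrying the absolute time, so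
a proof can follow the program text forward. -/
theorem seq {c d : Cmd} (h : Runs w e c σ o T (fun σ' o' T' => Runs w e d σ' o' T' Q)) :
    Runs w e (.seq c d) σ o T Q := by
  intro s hs ho
  obtain ⟨t, s', σ', h1, h2, h3⟩ := h s hs ho
  obtain ⟨t', s'', σ'', h1', h2', h3'⟩ := h3 s' h2 rfl
  exact ⟨t + t', s'', σ'', h1.seq h1', h2', by rwa [← add_assoc]⟩

theorem skip (h : Q σ o (T + 1)) : Runs w e .skip σ o T Q := by
  intro s hs ho
  exact ⟨1, s, σ, Exec.skip s, hs, by rwa [ho]⟩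

theorem block_nil (h : Q σ o (T + 1)) : Runs w e (Cmd.block []) σ o T Q := skip h

theorem block_cons {c : Cmd} {l : List Cmd}
    (h : Runs w e c σ o T (fun σ' o' T' => Runs w e (Cmd.block l) σ' o' T' Q)) :
    Runs w e (Cmd.block (c :: l)) σ o T Q := seq h

theorem assign {x : ℕ} {a : Expr} (hwf : a.wf = true) (hok : a.ok w e σ)
    (h : Q (Function.update σ x (a.val w e σ)) o (T + (a.cost + 1))) :
    Runs w e (Cmd.assign x a) σ o T Q := by
  intro s hs ho
  obtain ⟨s1, e1, r1, f1, o1⟩ := a.exec_compile w e σ hwf 32 s le_rfl hs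
  obtain ⟨hv, hlt⟩ := Expr.ev_eq_val hok
  refine ⟨_, _, Function.update σ x (a.val w e σ), e1.seq (Exec.op .or x 32 32 s1), ?_, ?_⟩
  · intro y hy
    by_cases hyx : y = x
    · subst hyx
      simp [State.setReg, r1, hv, BinOp.eval, Nat.mod_eq_of_lt hlt]
    · simp [State.setReg, Function.update_of_ne hyx, f1 y (by omega), hs y hy]
  · simpa [State.setReg, o1, ho] using h

theorem put {a : Expr} (hwf : a.wf = true) (hok : a.ok w e σ)
    (h : Q σ (o ++ [a.val w e σ]) (T + (a.cost + 1))) : Runs w e (Cmd.put a) σ o T Q := by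
  intro s hs ho
  obtain ⟨s1, e1, r1, f1, o1⟩ := a.exec_compile w e σ hwf 32 s le_rfl hs
  obtain ⟨hv, hlt⟩ := Expr.ev_eq_val hok
  refine ⟨_, _, σ, e1.seq (Exec.emit 32 s1), ?_, ?_⟩
  · intro y hy
    simp [f1 y (by omega), hs y hy]
  · simpa [o1, ho, r1, hv] using h

theorem ifExpr {a : Expr} {p q : Cmd} (hwf : a.wf = true) (hok : a.ok w e σ)
    (ht : a.val w e σ ≠ 0 → Runs w e p σ o (T + (a.cost + 1)) Q)
    (hf : a.val w e σ = 0 → Runs w e q σ o (T + (a.cost + 1)) Q) :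
    Runs w e (Cmd.ifExpr a p q) σ o T Q := by
  intro s hs ho
  obtain ⟨s1, e1, r1, f1, o1⟩ := a.exec_compile w e σ hwf 32 s le_rfl hs
  obtain ⟨hv, hlt⟩ := Expr.ev_eq_val hok
  have hs1 : ∀ x < 32, s1.reg x = σ x := fun x hx => by rw [f1 x (by omega), hs x hx]
  by_cases h0 : a.val w e σ = 0
  · obtain ⟨t, s', σ', h1, h2, h3⟩ := hf h0 s1 hs1 (o1.trans ho)
    exact ⟨_, s', σ', e1.seq (Exec.iteFalse (by rw [r1, hv, h0]) h1), h2,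
      by convert h3 using 1; omega⟩
  · obtain ⟨t, s', σ', h1, h2, h3⟩ := ht h0 s1 hs1 (o1.trans ho)
    exact ⟨_, s', σ', e1.seq (Exec.iteTrue (by rwa [r1, hv]) h1), h2,
      by convert h3 using 1; omega⟩

/-- The index `k` of the invariant bounds the number of remaining rounds: a nonzero test must
exhibit `k` as a successor, so the loop ends by induction on `k`. -/
theorem whileExpr {a : Expr} {p : Cmd} (hwf : a.wf = true)
    (I : ℕ → (ℕ → ℕ) → List ℕ → ℕ → Prop) (k : ℕ)
    (hstep : ∀ k σ o T, I k σ o T → a.ok w e σ ∧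
      (a.val w e σ = 0 → Q σ o (T + (a.cost + 1))) ∧
      (a.val w e σ ≠ 0 → ∃ k', k = k' + 1 ∧ Runs w e p σ o (T + (a.cost + 1)) (I k')))
    (h0 : I k σ o T) : Runs w e (Cmd.whileExpr a p) σ o T Q := by
  -- At the loop head the test has already been evaluated into register `32`, which accounts for the
  -- extra `a.cost` in the time.
  have key : ∀ k σ o T, I k σ o T → ∀ s : State, (∀ x < 32, s.reg x = σ x) → s.out = o →
      s.reg 32 = a.ev w e σ → ∃ t s' σ', Exec w e (.loop 32 (.seq p (a.compile 32))) s t s' ∧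
        (∀ x < 32, s'.reg x = σ' x) ∧ Q σ' s'.out (T + a.cost + t) := by
    intro k
    induction k with
    | zero =>
      intro σ o T hI s hs ho h32
      obtain ⟨hok, hz, hnz⟩ := hstep _ σ o T hI
      obtain ⟨hv, hlt⟩ := Expr.ev_eq_val hok
      by_cases h0 : a.val w e σ = 0
      · exact ⟨1, s, σ, Exec.loopDone (by rw [h32, hv, h0]), hs, by
          rw [ho, add_assoc]; exact hz h0⟩
      · obtain ⟨k', hk', -⟩ := hnz h0
        omega
    | succ k ih =>
      intro σ o T hI s hs ho h32
      obtain ⟨hok, hz, hnz⟩ := hstep _ σ o T hI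
      obtain ⟨hv, hlt⟩ := Expr.ev_eq_val hok
      by_cases h0 : a.val w e σ = 0
      · exact ⟨1, s, σ, Exec.loopDone (by rw [h32, hv, h0]), hs, by
          rw [ho, add_assoc]; exact hz h0⟩
      · obtain ⟨k', hk', hr⟩ := hnz h0
        obtain rfl : k = k' := by omega
        obtain ⟨t1, s1, σ1, x1, f1, q1⟩ := hr s hs ho
        obtain ⟨s2, x2, r2, f2, o2⟩ := a.exec_compile w e σ1 hwf 32 s1 le_rfl f1
        obtain ⟨t3, s3, σ3, x3, f3, q3⟩ := ih σ1 s1.out _ q1 s2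
          (fun x hx => by rw [f2 x hx, f1 x hx]) o2 r2
        refine ⟨_, s3, σ3, Exec.loopStep (by rwa [h32, hv]) (x1.seq x2) x3, f3, ?_⟩
        convert q3 using 1
        omega
  intro s hs ho
  obtain ⟨s1, e1, r1, f1, o1⟩ := a.exec_compile w e σ hwf 32 s le_rfl hs
  obtain ⟨t, s', σ', h1, h2, h3⟩ := key k σ o T h0 s1
    (fun x hx => by rw [f1 x hx, hs x hx]) (o1.trans ho) r1
  exact ⟨_, s', σ', e1.seq h1, h2, by rwa [← add_assoc]⟩

end Runs

end WordRAM

/-! ### A static dictionary with rank and select -/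

namespace SparseDict

open WordRAM

/-- The `k` low order bits of `v`, least significant bit first. -/
def bits : ℕ → ℕ → List Bool
  | 0, _ => []
  | k + 1, v => decide (v % 2 = 1) :: bits k (v / 2)

@[simp] theorem length_bits (k v : ℕ) : (bits k v).length = k := by
  induction k generalizing v with
  | zero => rfl
  | succ k ih => simp [bits, ih]

theorem ofDigits_bits (k v : ℕ) (h : v < 2 ^ k) :
    Nat.ofDigits 2 ((bits k v).map Bool.toNat) = v := by
  induction k generalizing v with
  | zero => simp at h; simp [bits, h]
  | succ k ih =>
    have h2 : v / 2 < 2 ^ k := by rw [pow_succ] at h; omega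
    simp only [bits, List.map_cons, Nat.ofDigits_cons, ih _ h2]
    rcases Nat.mod_two_eq_zero_or_one v with h1 | h1 <;> simp [h1] <;> omega

theorem readBits_append (w : ℕ) (pre post : List Bool) (k v : ℕ) (hk : k ≤ w) (hv : v < 2 ^ k) :
    readBits w (pre ++ (bits k v ++ post)) pre.length k = v := by
  simp only [readBits, List.drop_left, min_eq_left hk]
  rw [List.take_left' (length_bits k v), ofDigits_bits k v hv]

theorem readBits_of_eq {w : ℕ} {e pre post : List Bool} {a k v : ℕ} (hk : k ≤ w) (hv : v < 2 ^ k)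
    (he : e = pre ++ (bits k v ++ post)) (ha : pre.length = a) : readBits w e a k = v := by
  subst he ha
  exact readBits_append w pre post k v hk hv

theorem count_sub_count_le (S : ℕ → Prop) [DecidablePred S] (a b : ℕ) :
    Nat.count S b - Nat.count S a ≤ b - a := by
  rcases le_total a b with h | h
  · obtain ⟨c, rfl⟩ := Nat.exists_eq_add_of_le h
    have := Nat.count_le (p := fun k => S (a + k)) (n := c)
    rw [Nat.count_add]
    omega
  · have := Nat.count_monotone S h
    omega

theorem lt_card_of_lt_count {S : ℕ → Prop} [DecidablePred S] {k b : ℕ} (h : k < Nat.count S b)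
    (hf : (Set.ofPred S).Finite) : k < hf.toFinset.card := by
  refine lt_of_lt_of_le h ?_
  rw [Nat.count_eq_card_filter_range]
  apply Finset.card_le_card
  intro x hx
  simpa using (Finset.mem_filter.mp hx).2

theorem nth_mem_of_lt_count {S : ℕ → Prop} [DecidablePred S] {k b : ℕ} (h : k < Nat.count S b) :
    S (Nat.nth S k) := Nat.nth_mem k (lt_card_of_lt_count h)

/-- `Nat.nth` and `Nat.count` are adjoint only at indices that are attained, because `Nat.nth` of a
finite set is `0` beyond its last element; hence the hypothesis. -/
theorem nth_lt_iff {S : ℕ → Prop} [DecidablePred S] {k b v : ℕ} (h : k < Nat.count S b) :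
    Nat.nth S k < v ↔ k < Nat.count S v := by
  refine ⟨fun hv => ?_, Nat.nth_lt_of_lt_count⟩
  have h1 : Nat.count S (Nat.nth S k) = k := Nat.count_nth (lt_card_of_lt_count h)
  have h2 : Nat.count S (Nat.nth S k + 1) = k + 1 := by
    rw [Nat.count_succ, h1, if_pos (nth_mem_of_lt_count h)]
  have := Nat.count_monotone S (show Nat.nth S k + 1 ≤ v from hv)
  omega

/-- A complete binary tree of height `h` in preorder; each inner node holds the number of elements
of `S` in its left half, and the leaves are intervals of length `2 ^ q`. -/
def tree (S : ℕ → Prop) [DecidablePred S] (q : ℕ) : ℕ → ℕ → List Bool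
  | 0, _ => []
  | h + 1, t =>
    bits (h + q + 1) (Nat.count S ((2 * t + 1) * 2 ^ (h + q)) -
        Nat.count S (2 * t * 2 ^ (h + q))) ++
      (tree S q h (2 * t) ++ tree S q h (2 * t + 1))

/-- Counters get narrower towards the leaves, so the sum is linear in the number of leaves with a
factor `q + 2` and no factor `h`. The closed form also tells the descent how many bits to skip when
it turns right. -/
theorem length_tree (S : ℕ → Prop) [DecidablePred S] (q h t : ℕ) :
    (tree S q h t).length + (h + q + 2) = (q + 2) * 2 ^ h := by
  induction h generalizing t with
  | zero => simp [tree]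
  | succ h ih =>
    have h1 := ih (2 * t)
    have h2 := ih (2 * t + 1)
    simp only [tree, List.length_append, length_bits]
    rw [pow_succ, ← mul_assoc]
    omega

/-- The residues modulo `2 ^ q` of the first `N` elements of `S`. -/
noncomputable def lows (S : ℕ → Prop) [DecidablePred S] (q N : ℕ) : List Bool :=
  (List.range N).flatMap (fun k => bits q (Nat.nth S k % 2 ^ q))

theorem length_lows (S : ℕ → Prop) [DecidablePred S] (q N : ℕ) :
    (lows S q N).length = q * N := by
  simp [lows, List.length_flatMap, mul_comm]

theorem lows_eq (S : ℕ → Prop) [DecidablePred S] {q N k : ℕ} (hk : k < N) :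
    ∃ pre post, lows S q N = pre ++ (bits q (Nat.nth S k % 2 ^ q) ++ post) ∧
      pre.length = q * k := by
  obtain ⟨m, rfl⟩ := Nat.exists_eq_add_of_lt hk
  refine ⟨lows S q k, ?_⟩
  have : List.range (k + m + 1) = List.range k ++ k :: (List.range m).map (fun i => k + 1 + i) := by
    rw [show k + m + 1 = k + (m + 1) by ring, List.range_add, List.range_succ_eq_map]
    simp only [List.map_cons, List.map_map, add_zero]
    congr 2
    apply List.map_congr_left
    intro a _
    simp only [Function.comp_apply]
    omega
  refine ⟨((List.range m).map (fun i => k + 1 + i)).flatMap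
    (fun k => bits q (Nat.nth S k % 2 ^ q)), ?_, length_lows S q k⟩
  rw [lows, this, List.flatMap_append, List.flatMap_cons]
  rfl

/-- The encoding `e` consists of a header, the tree and the residues of the elements of `S`, a set
of numbers below `2 ^ (K + 3 + q)`. -/
structure Represents (w : ℕ) (e : List Bool) (K q : ℕ) (S : ℕ → Prop) [DecidablePred S] :
    Prop where
  eq : ∃ hd, e = hd ++ (tree S q (K + 3) 0 ++ lows S q (Nat.count S (2 ^ (K + 3 + q)))) ∧
    hd.length = 4 * K
  length_lt : e.length < 2 ^ (5 * K)
  four_le : 4 ≤ K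
  le : q ≤ K
  word : 10 * K ≤ w

namespace Represents

variable {w : ℕ} {e : List Bool} {K q : ℕ} {S : ℕ → Prop} [DecidablePred S]

theorem two_pow_le (H : Represents w e K q S) {a : ℕ} (ha : a ≤ 10 * K) : 2 ^ a ≤ 2 ^ w :=
  Nat.pow_le_pow_right (by norm_num) (ha.trans H.word)

/-- Reading the residue of an element. -/
theorem read_low (H : Represents w e K q S) {k : ℕ} (hk : k < Nat.count S (2 ^ (K + 3 + q))) :
    readBits w e (4 * K + ((q + 2) * 2 ^ (K + 3) - (K + 3 + q + 2)) + q * k) q =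
      Nat.nth S k % 2 ^ q ∧
    4 * K + ((q + 2) * 2 ^ (K + 3) - (K + 3 + q + 2)) + q * k ≤ e.length := by
  obtain ⟨hd, he, hl⟩ := H.eq
  obtain ⟨pre, post, h1, h2⟩ := lows_eq S (q := q) hk
  have h3 := length_tree S q (K + 3) 0
  have h4 : (hd ++ (tree S q (K + 3) 0 ++ pre)).length =
      4 * K + ((q + 2) * 2 ^ (K + 3) - (K + 3 + q + 2)) + q * k := by
    simp only [List.length_append, h2, hl]
    omega
  have h5 : e = (hd ++ (tree S q (K + 3) 0 ++ pre)) ++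
      (bits q (Nat.nth S k % 2 ^ q) ++ post) := by
    rw [he, h1]; simp
  refine ⟨readBits_of_eq ?_ (Nat.mod_lt _ (by positivity)) h5 h4, ?_⟩
  · have := H.le; have := H.word; omega
  · rw [← h4, h5]
    simp

end Represents

end SparseDict

/-! ### Descent in the tree of counts -/

namespace SparseDict

open WordRAM

/-- Descend in the tree to a leaf; the expression `dec` decides about going left. -/
def descend (dec : Expr) : Cmd := .block [
  .assign 22 (.bin .add (.var 3) (.lit 3)),
  .assign 23 (.bin .mul (.var 3) (.lit 4)),
  .assign 25 (.lit 0),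
  .assign 21 (.lit 0),
  .assign 26 (.var 19),
  .whileExpr (.var 22) (.block [
    .assign 22 (.bin .sub (.var 22) (.lit 1)),
    .assign 24 (.bin .add (.var 21)
      (.rd (.var 23) (.bin .add (.bin .add (.var 22) (.var 4)) (.lit 1)))),
    .assign 23 (.bin .add (.var 23) (.bin .add (.bin .add (.var 22) (.var 4)) (.lit 1))),
    .ifExpr dec
      (.block [.assign 26 (.var 24), .assign 25 (.bin .mul (.lit 2) (.var 25))])
      (.block [
        .assign 21 (.var 24),
        .assign 23 (.bin .add (.var 23) (.bin .sub
          (.bin .shl (.bin .add (.var 4) (.lit 2)) (.var 22))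
          (.bin .add (.bin .add (.var 22) (.var 4)) (.lit 2)))),
        .assign 25 (.bin .add (.bin .mul (.lit 2) (.var 25)) (.lit 1))])])]

variable {w : ℕ} {e : List Bool} {K q : ℕ} {S : ℕ → Prop} [DecidablePred S]

theorem node_bounds {y P c m : ℕ} (hP : 0 < P) (hm : m = c * (2 * P)) (hy : y < m) :
    y / (2 * P) * (2 * P) ≤ y ∧ y < (y / (2 * P) + 1) * (2 * P) ∧
      (y / (2 * P) + 1) * (2 * P) ≤ m := by
  refine ⟨Nat.div_mul_le_self _ _, Nat.lt_mul_of_div_lt (Nat.lt_succ_self _) (by positivity), ?_⟩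
  rw [hm]
  apply Nat.mul_le_mul_right
  apply Nat.succ_le_of_lt
  rw [hm] at hy
  exact Nat.div_lt_of_lt_mul (by rwa [mul_comm])

theorem div_eq_left {y P : ℕ} (h : y < (2 * (y / (2 * P)) + 1) * P) :
    y / P = 2 * (y / (2 * P)) := by
  have := Nat.div_mul_le_self y (2 * P)
  apply Nat.div_eq_of_lt_le
  · linarith
  · exact h

theorem div_eq_right {y P : ℕ} (hP : 0 < P) (h : (2 * (y / (2 * P)) + 1) * P ≤ y) :
    y / P = 2 * (y / (2 * P)) + 1 := by
  have : y < (y / (2 * P) + 1) * (2 * P) :=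
    Nat.lt_mul_of_div_lt (Nat.lt_succ_self _) (by positivity)
  apply Nat.div_eq_of_lt_le
  · exact h
  · linarith

namespace Represents

/-- Bounds for the addresses and counters that occur in the programs. -/
theorem bounds (H : Represents w e K q S) :
    K < 2 ^ K ∧ 16 ≤ 2 ^ K ∧ e.length < 2 ^ (5 * K) ∧ 2 ^ (K + 3 + q) ≤ 2 ^ (5 * K) ∧
      16 * 2 ^ (5 * K) ≤ 2 ^ w ∧ 16 * 2 ^ K ≤ 2 ^ (5 * K) ∧
      (∀ h ≤ K + 3, (q + 2) * 2 ^ h ≤ 2 ^ (5 * K)) ∧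
      Nat.count S (2 ^ (K + 3 + q)) ≤ 2 ^ (5 * K) := by
  have hK := H.four_le
  have hqK := H.le
  have hKlt : K < 2 ^ K := Nat.lt_two_pow_self
  have mono : ∀ {a b : ℕ}, a ≤ b → 2 ^ a ≤ 2 ^ b := fun h => Nat.pow_le_pow_right (by norm_num) h
  have htop : 2 ^ (K + 3 + q) ≤ 2 ^ (5 * K) := mono (by omega)
  refine ⟨hKlt, mono hK, H.length_lt, htop, ?_, ?_, ?_,
    (Nat.count_le _).trans htop⟩
  · rw [show (16 : ℕ) = 2 ^ 4 by norm_num, ← pow_add]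
    exact H.two_pow_le (by omega)
  · rw [show (16 : ℕ) = 2 ^ 4 by norm_num, ← pow_add]
    exact mono (by omega)
  · intro h hh
    have h1 : q + 2 ≤ 2 ^ (K + 1) := by rw [pow_succ]; omega
    calc (q + 2) * 2 ^ h ≤ 2 ^ (K + 1) * 2 ^ (K + 3) := Nat.mul_le_mul h1 (mono hh)
      _ ≤ 2 ^ (5 * K) := by rw [← pow_add]; exact mono (by omega)

end Represents

/-- The invariant of the descent towards `y`, at a node of height `k`. -/
structure AtNode (e : List Bool) (q : ℕ) (S : ℕ → Prop) [DecidablePred S] (σ : ℕ → ℕ) (y k : ℕ)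
    (σ' : ℕ → ℕ) : Prop where
  frame : ∀ x < 21, σ' x = σ x
  height : σ' 22 = k
  node : σ' 25 = y / 2 ^ (k + q)
  lower : σ' 21 = Nat.count S (y / 2 ^ (k + q) * 2 ^ (k + q))
  upper : σ' 26 = Nat.count S ((y / 2 ^ (k + q) + 1) * 2 ^ (k + q))
  addr : ∃ pre post, e = pre ++ (tree S q k (y / 2 ^ (k + q)) ++ post) ∧ pre.length = σ' 23

/-- The stored counter added to the rank of the left end gives the rank `M` of the midpoint. The
left subtree directly follows the counter, and the right one comes after it. The new configuration
`σ''` is left arbitrary so that any sequence of register updates can be plugged in. -/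
theorem AtNode.step (H : Represents w e K q S) {σ σ' : ℕ → ℕ} {y h : ℕ}
    (I : AtNode e q S σ y (h + 1) σ') (hy : y < 2 ^ (K + 3 + q)) (hh : h + 1 ≤ K + 3) :
    ∃ t M, t = y / 2 ^ (h + 1 + q) ∧ M = Nat.count S ((2 * t + 1) * 2 ^ (h + q)) ∧
      (2 * t + 1) * 2 ^ (h + q) ≤ 2 ^ (K + 3 + q) ∧ t ≤ 2 ^ (K + 3 + q) ∧
      σ' 21 + readBits w e (σ' 23) (h + q + 1) = M ∧
      M ≤ 2 ^ (K + 3 + q) ∧ σ' 23 + (h + q + 1) ≤ e.length ∧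
      h + q + 2 ≤ (q + 2) * 2 ^ h ∧
      (y < (2 * t + 1) * 2 ^ (h + q) → ∀ σ'' : ℕ → ℕ, (∀ x < 21, σ'' x = σ' x) →
        σ'' 22 = h → σ'' 25 = 2 * t → σ'' 21 = σ' 21 → σ'' 26 = M →
        σ'' 23 = σ' 23 + (h + q + 1) → AtNode e q S σ y h σ'') ∧
      (¬ y < (2 * t + 1) * 2 ^ (h + q) → ∀ σ'' : ℕ → ℕ, (∀ x < 21, σ'' x = σ' x) →
        σ'' 22 = h → σ'' 25 = 2 * t + 1 → σ'' 21 = M → σ'' 26 = σ' 26 →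
        σ'' 23 = σ' 23 + (h + q + 1) + ((q + 2) * 2 ^ h - (h + q + 2)) →
        AtNode e q S σ y h σ'') := by
  obtain ⟨hf, h22, h25, h21, h26, ⟨pre, post, hpp, hpl⟩⟩ := I
  have hpow : 2 ^ (h + 1 + q) = 2 * 2 ^ (h + q) := by
    rw [show h + 1 + q = (h + q) + 1 by ring, pow_succ]; ring
  obtain ⟨c, hc⟩ := Nat.exists_eq_add_of_le (show h + 1 + q ≤ K + 3 + q by omega)
  have hPpos : 0 < 2 ^ (h + q) := by positivity
  have htop : 2 ^ (K + 3 + q) = 2 ^ c * (2 * 2 ^ (h + q)) := by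
    rw [hc, pow_add, hpow]; ring
  obtain ⟨hb1, hb2, hb3⟩ := node_bounds hPpos htop hy
  have hl := div_eq_left (y := y) (P := 2 ^ (h + q))
  have hr := div_eq_right (y := y) hPpos
  have hl1 := length_tree S q h (2 * (y / 2 ^ (h + 1 + q)))
  have hwK := H.word
  have hqK := H.le
  have hK4 := H.four_le
  simp only [tree] at hpp
  rw [hpow] at h25 h21 h26 hpp hl1
  rw [hpow]
  generalize hP : 2 ^ (h + q) = P at *
  generalize ht : y / (2 * P) = t at *
  have hmid : (2 * t + 1) * P ≤ 2 ^ (K + 3 + q) := le_trans (by nlinarith) hb3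
  have hcm : Nat.count S ((2 * t + 1) * P) ≤ (2 * t + 1) * P := Nat.count_le _
  have hmono : Nat.count S (2 * t * P) ≤ Nat.count S ((2 * t + 1) * P) :=
    Nat.count_monotone S (by nlinarith)
  have h21' : σ' 21 = Nat.count S (2 * t * P) := by
    rw [h21]; congr 1; ring
  have hle := congrArg List.length hpp
  simp only [List.length_append, length_bits] at hle
  have hcs := count_sub_count_le S (2 * t * P) ((2 * t + 1) * P)
  have h1 : (2 * t + 1) * P - 2 * t * P = P := by
    rw [← Nat.sub_mul]; simp
  refine ⟨t, _, rfl, rfl, hmid, le_trans (by nlinarith) hb3, ?_, hcm.trans hmid, by omega,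
    by omega, ?_, ?_⟩
  -- All `2 ^ (h + q)` numbers of the left half may belong to `S`, hence a counter of `h + q + 1`
  -- bits.
  · have hlt : Nat.count S ((2 * t + 1) * P) - Nat.count S (2 * t * P) < 2 ^ (h + q + 1) := by
      rw [pow_succ, hP]; omega
    rw [readBits_of_eq (by omega) hlt (by rw [hpp, List.append_assoc]) hpl]
    omega
  · intro hlt σ'' f g22 g25 g21 g26 g23
    have hyt := hl hlt
    refine ⟨fun x hx => (f x hx).trans (hf x hx), g22, ?_, ?_, ?_, ?_⟩
    · rw [g25, hP, hyt]
    · rw [g21, hP, hyt, h21']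
    · rw [g26, hP, hyt]
    · rw [hP, hyt]
      exact ⟨pre ++ bits (h + q + 1) (Nat.count S ((2 * t + 1) * P) - Nat.count S (2 * t * P)),
        tree S q h (2 * t + 1) ++ post, by rw [hpp]; simp, by simp [hpl, g23]⟩
  · intro hlt σ'' f g22 g25 g21 g26 g23
    have hyt := hr (not_lt.mp hlt)
    refine ⟨fun x hx => (f x hx).trans (hf x hx), g22, ?_, ?_, ?_, ?_⟩
    · rw [g25, hP, hyt]
    · rw [g21, hP, hyt]
    · rw [g26, hP, hyt, h26]; congr 1; ring
    · rw [hP, hyt]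
      refine ⟨pre ++ bits (h + q + 1) (Nat.count S ((2 * t + 1) * P) - Nat.count S (2 * t * P)) ++
        tree S q h (2 * t), post, by rw [hpp]; simp, ?_⟩
      simp only [List.length_append, length_bits]
      omega

/-- Shared by rank and select. The target `y` is a ghost value that the machine need not know; it
only evaluates `dec`, which has to decide whether `y` lies left of the midpoint. -/
theorem runs_descend (H : Represents w e K q S) {dec : Expr} {σ : ℕ → ℕ} {o : List ℕ} {T y : ℕ}
    {Q : (ℕ → ℕ) → List ℕ → ℕ → Prop} (h3 : σ 3 = K) (h4 : σ 4 = q)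
    (h19 : σ 19 = Nat.count S (2 ^ (K + 3 + q))) (hy : y < 2 ^ (K + 3 + q))
    (hwf : dec.wf = true) (hcost : dec.cost ≤ 20)
    (hdec : ∀ σ' : ℕ → ℕ, (∀ x < 21, σ' x = σ x) → ∀ h t, σ' 22 = h → σ' 25 = t →
      σ' 24 = Nat.count S ((2 * t + 1) * 2 ^ (h + q)) → h < K + 3 →
      (2 * t + 1) * 2 ^ (h + q) ≤ 2 ^ (K + 3 + q) →
      dec.ok w e σ' ∧ (dec.val w e σ' ≠ 0 ↔ y < (2 * t + 1) * 2 ^ (h + q)))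
    (hQ : ∀ σ' T', (∀ x < 21, σ' x = σ x) → σ' 21 = Nat.count S (y / 2 ^ q * 2 ^ q) →
      σ' 26 = Nat.count S ((y / 2 ^ q + 1) * 2 ^ q) → σ' 25 = y / 2 ^ q →
      T' ≤ T + 100 * (K + 3) + 30 → Q σ' o T') :
    Runs w e (descend dec) σ o T Q := by
  obtain ⟨b1, b2, b3, b4, b5, b6, b7, b8⟩ := H.bounds
  have hqK := H.le
  have hw0 : w ≠ 0 := by have := H.word; have := H.four_le; omega
  unfold descend
  refine Runs.block_cons (Runs.assign rfl ?_ ?_)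
  · simp only [Expr.ok, Expr.val, BinOp.safe, h3]; omega
  refine Runs.block_cons (Runs.assign rfl ?_ ?_)
  · simp [Expr.ok, Expr.val, BinOp.safe, BinOp.nat, h3]; omega
  refine Runs.block_cons (Runs.assign rfl ?_ ?_)
  · simp [Expr.ok]
  refine Runs.block_cons (Runs.assign rfl ?_ ?_)
  · simp [Expr.ok]
  refine Runs.block_cons (Runs.assign rfl ?_ ?_)
  · simp [Expr.ok, h19]; omega
  refine Runs.block_cons (Runs.whileExpr rfl (fun k σ' o' T' => o' = o ∧ AtNode e q S σ y k σ' ∧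
    k ≤ K + 3 ∧ T' + 100 * k ≤ T + 100 * (K + 3) + 18) (K + 3) ?_ ?_)
  · rintro k σ1 o1 T1 ⟨ho1, I, hk, hT⟩
    have k3 : σ1 3 = K := by rw [I.frame 3 (by norm_num), h3]
    have k4 : σ1 4 = q := by rw [I.frame 4 (by norm_num), h4]
    have k22 := I.height
    refine ⟨?_, ?_, ?_⟩
    · simp only [Expr.ok]; omega
    · intro h0
      simp only [Expr.val] at h0
      obtain rfl : k = 0 := by omega
      subst ho1
      obtain ⟨hf, h22, h25, h21, h26, -⟩ := I
      rw [zero_add] at h25 h21 h26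
      exact Runs.block_nil (hQ _ _ hf h21 h26 h25 (by simp only [Expr.cost]; omega))
    · intro h0
      simp only [Expr.val] at h0
      obtain ⟨h, rfl⟩ : ∃ h, k = h + 1 := ⟨k - 1, by omega⟩
      refine ⟨h, rfl, ?_⟩
      obtain ⟨t, M, ht, hM, hmid, htt, hread, hMle, hlen, hsz, hleft, hright⟩ := I.step H hy hk
      have h25 : σ1 25 = t := by rw [I.node, ht]
      have h7 := b7 h (by omega)
      have h21 : σ1 21 ≤ M := by omega
      have ha : h + q + 1 < 2 ^ w := by omega
      refine Runs.block_cons (Runs.assign rfl ?_ ?_)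
      · simp [Expr.ok, Expr.val, BinOp.safe, k22]
        omega
      simp only [Expr.val, BinOp.nat, k22, Nat.add_sub_cancel]
      refine Runs.block_cons (Runs.assign rfl ?_ ?_)
      · simp [Expr.ok, Expr.val, BinOp.safe, BinOp.nat, k4, hread]
        omega
      simp [Expr.val, BinOp.nat, k4, hread]
      refine Runs.block_cons (Runs.assign rfl ?_ ?_)
      · simp [Expr.ok, Expr.val, BinOp.safe, BinOp.nat, k4]
        omega
      simp [Expr.val, BinOp.nat, k4]
      refine Runs.block_cons ?_
      have hd := hdec (Function.update (Function.update (Function.update σ1 22 h) 24 M) 23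
        (σ1 23 + (h + q + 1))) (fun x hx => by
          rw [Function.update_of_ne (by omega), Function.update_of_ne (by omega),
            Function.update_of_ne (by omega), I.frame x hx]) h t (by simp) (by simp [h25])
            (by simp [hM]) (by omega) hmid
      refine Runs.ifExpr hwf hd.1 ?_ ?_
      · intro hnz
        have hlt := hd.2.mp hnz
        refine Runs.block_cons (Runs.assign rfl ?_ ?_)
        · simp [Expr.ok]
          omega
        refine Runs.block_cons (Runs.assign rfl ?_ ?_)
        · simp [Expr.ok, Expr.val, BinOp.safe, h25]
          omega
        refine Runs.block_nil (Runs.block_nil ⟨ho1, hleft hlt _ ?_ ?_ ?_ ?_ ?_ ?_, by omega, ?_⟩)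
        · intro x hx
          simp (disch := omega) only [Function.update_of_ne]
        · simp
        · simp [Expr.val, BinOp.nat, h25]
        · simp
        · simp [Expr.val]
        · simp
        · simp only [Expr.cost]; omega
      · intro hz
        have hlt : ¬ y < (2 * t + 1) * 2 ^ (h + q) := fun h => hd.2.mpr h hz
        refine Runs.block_cons (Runs.assign rfl ?_ ?_)
        · simp [Expr.ok]
          omega
        refine Runs.block_cons (Runs.assign rfl ?_ ?_)
        · simp [Expr.ok, Expr.val, BinOp.safe, BinOp.nat, k4]
          omega
        refine Runs.block_cons (Runs.assign rfl ?_ ?_)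
        · simp [Expr.ok, Expr.val, BinOp.safe, BinOp.nat, h25]
          have := Nat.le_mul_of_pos_right (2 * t + 1) (show 0 < 2 ^ (h + q) by positivity)
          omega
        refine Runs.block_nil (Runs.block_nil ⟨ho1, hright hlt _ ?_ ?_ ?_ ?_ ?_ ?_, by omega, ?_⟩)
        · intro x hx
          simp (disch := omega) only [Function.update_of_ne]
        · simp
        · simp [Expr.val, BinOp.nat, h25]
        · simp [Expr.val]
        · simp
        · simp [Expr.val, BinOp.nat, k4]
        · simp only [Expr.cost]; omega
  · have h0 : y / 2 ^ (K + 3 + q) = 0 := Nat.div_eq_of_lt hy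
    refine ⟨rfl, ⟨?_, ?_, ?_, ?_, ?_, ?_⟩, le_rfl, ?_⟩
    · intro x hx
      simp (disch := omega) only [Function.update_of_ne]
    · simp [Expr.val, BinOp.nat, h3]
    · simp [Expr.val, h0]
    · simp [Expr.val, h0]
    · simp [Expr.val, h0, h19]
    · obtain ⟨hd, he, hhd⟩ := H.eq
      exact ⟨hd, _, by rw [h0]; exact he, by simp [Expr.val, BinOp.nat, h3, hhd, mul_comm]⟩
    · simp only [Expr.cost]; omega

end SparseDict

/-! ### Rank and select -/

namespace SparseDict

open WordRAM

/-- The address of the residue with the given number. -/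
def lowAddr (a : Expr) : Expr :=
  .bin .add
    (.bin .add (.bin .mul (.var 3) (.lit 4))
      (.bin .sub (.bin .shl (.bin .add (.var 4) (.lit 2)) (.bin .add (.var 3) (.lit 3)))
        (.bin .add (.bin .add (.bin .add (.var 3) (.lit 3)) (.var 4)) (.lit 2))))
    (.bin .mul (.var 4) a)

/-- The number of elements below the number in register `20`. -/
def rank : Cmd := .block [
  descend (.bin .lt (.var 20)
    (.bin .shl (.bin .shl (.bin .add (.bin .mul (.lit 2) (.var 25)) (.lit 1)) (.var 22)) (.var 4))),
  .assign 29 (.bin .mod (.var 20) (.bin .shl (.lit 1) (.var 4))),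
  .whileExpr (.bin .lt (.var 21) (.var 26)) (.block [
    .assign 30 (.bin .shr (.bin .add (.var 21) (.var 26)) (.lit 1)),
    .ifExpr (.bin .lt (.rd (lowAddr (.var 30)) (.var 4)) (.var 29))
      (.assign 21 (.bin .add (.var 30) (.lit 1)))
      (.assign 26 (.var 30))])]

/-- The element with the number in register `20`. -/
def select : Cmd := .block [
  descend (.bin .lt (.var 20) (.var 24)),
  .assign 21 (.bin .add (.bin .shl (.var 25) (.var 4)) (.rd (lowAddr (.var 20)) (.var 4)))]

variable {w : ℕ} {e : List Bool} {K q : ℕ} {S : ℕ → Prop} [DecidablePred S]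

theorem lowAddr_spec (H : Represents w e K q S) {σ : ℕ → ℕ} {a : Expr} (h3 : σ 3 = K)
    (h4 : σ 4 = q) (hok : a.ok w e σ) (ha : a.val w e σ < Nat.count S (2 ^ (K + 3 + q))) :
    (lowAddr a).ok w e σ ∧ readBits w e ((lowAddr a).val w e σ) q =
      Nat.nth S (a.val w e σ) % 2 ^ q := by
  obtain ⟨b1, b2, b3, b4, b5, b6, b7, b8⟩ := H.bounds
  have hqK := H.le
  have hK4 := H.four_le
  have hw0 : w ≠ 0 := by have := H.word; omega
  obtain ⟨r1, r2⟩ := H.read_low ha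
  have h7 := b7 (K + 3) le_rfl
  have hl := length_tree S q (K + 3) 0
  refine ⟨?_, ?_⟩
  · simp only [lowAddr, Expr.ok, Expr.val, BinOp.safe, BinOp.nat, h3, h4]
    refine ⟨⟨?_, ?_, ?_⟩, ?_, ?_⟩ <;> try simp only [hok, true_and]
    all_goals omega
  · simp only [lowAddr, Expr.val, BinOp.nat, h3, h4]
    rw [mul_comm K 4, r1]

/-- After the descent the answer lies between the ranks of the two ends of a leaf interval. Elements
numbered within this window have the same quotient by `2 ^ q`, so comparing stored residues compares
the elements, and binary search applies. -/
theorem runs_rank (H : Represents w e K q S) {σ : ℕ → ℕ} {o : List ℕ} {T v : ℕ}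
    {Q : (ℕ → ℕ) → List ℕ → ℕ → Prop} (h3 : σ 3 = K) (h4 : σ 4 = q)
    (h19 : σ 19 = Nat.count S (2 ^ (K + 3 + q))) (h20 : σ 20 = v) (hv : v < 2 ^ (K + 3 + q))
    (hQ : ∀ σ' T', (∀ x < 21, σ' x = σ x) → σ' 21 = Nat.count S v →
      T' ≤ T + 200 * (K + 3) → Q σ' o T') :
    Runs w e rank σ o T Q := by
  obtain ⟨b1, b2, b3, b4, b5, b6, b7, b8⟩ := H.bounds
  have hqK := H.le
  have hK4 := H.four_le
  have hw0 : 0 < w := by have := H.word; omega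
  unfold rank
  refine Runs.block_cons (runs_descend H h3 h4 h19 hv rfl (by decide) ?_ ?_)
  · intro σ' hf h t k22 k25 k24 hh ht
    have k20 : σ' 20 = v := by rw [hf 20 (by norm_num), h20]
    have k4 : σ' 4 = q := by rw [hf 4 (by norm_num), h4]
    have hp : (2 * t + 1) * 2 ^ h * 2 ^ q = (2 * t + 1) * 2 ^ (h + q) := by rw [pow_add]; ring
    have hq1 : 1 ≤ 2 ^ q := Nat.one_le_two_pow
    have hh1 : 1 ≤ 2 ^ h := Nat.one_le_two_pow
    have hle1 := Nat.le_mul_of_pos_right ((2 * t + 1) * 2 ^ h) hq1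
    have hle2 := Nat.le_mul_of_pos_right (2 * t + 1) hh1
    refine ⟨?_, ?_⟩
    · simp only [Expr.ok, Expr.val, BinOp.safe, BinOp.nat, k20, k4, k22, k25]
      omega
    · simp only [Expr.val, BinOp.nat, k20, k4, k22, k25, hp, ne_eq, ltNat_eq_zero, not_not]
  intro σ1 T1 hf1 k21 k26 k25 hT1
  have k3 : σ1 3 = K := by rw [hf1 3 (by norm_num), h3]
  have k4 : σ1 4 = q := by rw [hf1 4 (by norm_num), h4]
  have k20 : σ1 20 = v := by rw [hf1 20 (by norm_num), h20]
  have hqq : 2 ^ q ≤ 2 ^ K := Nat.pow_le_pow_right (by norm_num) hqK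
  have hqpos : 0 < 2 ^ q := by positivity
  refine Runs.block_cons (Runs.assign rfl ?_ ?_)
  · simp only [Expr.ok, Expr.val, BinOp.safe, k4, k20]
    exact ⟨by omega, ⟨by omega, by omega, by omega⟩, trivial⟩
  simp only [Expr.val, BinOp.nat, k4, k20, one_mul]
  have hdm := Nat.div_add_mod v (2 ^ q)
  have hml := Nat.mod_lt v hqpos
  have hlow : v / 2 ^ q * 2 ^ q ≤ v := Nat.div_mul_le_self _ _
  have hup : v ≤ (v / 2 ^ q + 1) * 2 ^ q := by rw [add_mul, mul_comm]; omega
  have hupt : (v / 2 ^ q + 1) * 2 ^ q ≤ 2 ^ (K + 3 + q) := by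
    rw [pow_add _ (K + 3) q]
    apply Nat.mul_le_mul_right
    apply Nat.succ_le_of_lt
    apply Nat.div_lt_of_lt_mul
    rw [mul_comm, ← pow_add]; exact hv
  have hcN := Nat.count_monotone S hupt
  -- The window is shorter than `2 ^ k`. It may have full length `2 ^ q` at first, so `k` starts at
  -- `q + 1`.
  refine Runs.block_cons (Runs.whileExpr rfl (fun k σ' o' T' => o' = o ∧
    (∀ x < 21, σ' x = σ x) ∧ σ' 29 = v % 2 ^ q ∧
    Nat.count S (v / 2 ^ q * 2 ^ q) ≤ σ' 21 ∧ σ' 21 ≤ Nat.count S v ∧ Nat.count S v ≤ σ' 26 ∧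
    σ' 26 ≤ Nat.count S ((v / 2 ^ q + 1) * 2 ^ q) ∧ σ' 26 - σ' 21 < 2 ^ k ∧
    T' + 50 * k ≤ T + 100 * (K + 3) + 40 + 50 * (q + 1)) (q + 1) ?_ ?_)
  · rintro k σ2 o2 T2 ⟨rfl, hf, k29, hlo1, hlo2, hhi1, hhi2, hk, hT⟩
    have l3 : σ2 3 = K := by rw [hf 3 (by norm_num), h3]
    have l4 : σ2 4 = q := by rw [hf 4 (by norm_num), h4]
    refine ⟨?_, ?_, ?_⟩
    · simp only [Expr.ok, BinOp.safe]
      omega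
    · intro h0
      simp only [Expr.val, BinOp.nat, ltNat_eq_zero, not_lt] at h0
      refine Runs.block_nil (hQ _ _ hf (by omega) ?_)
      simp only [Expr.cost]
      omega
    · intro h0
      simp only [Expr.val, BinOp.nat, ne_eq, ltNat_eq_zero, not_not] at h0
      obtain ⟨k', rfl⟩ : ∃ k', k = k' + 1 := by
        refine ⟨k - 1, ?_⟩
        rcases k with _ | k
        · simp only [pow_zero] at hk; omega
        · simp
      refine ⟨k', rfl, ?_⟩
      rw [pow_succ] at hk
      refine Runs.block_cons (Runs.assign rfl ?_ ?_)
      · simp only [Expr.ok, Expr.val, BinOp.safe]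
        exact ⟨⟨by omega, by omega, by omega⟩, by omega, trivial⟩
      simp only [Expr.val, BinOp.nat, pow_one]
      generalize hm : (σ2 21 + σ2 26) / 2 = m
      have hmN : m < Nat.count S (2 ^ (K + 3 + q)) := by omega
      obtain ⟨hok, hval⟩ := lowAddr_spec H (σ := Function.update σ2 30 m) (a := .var 30)
        (by simp [l3]) (by simp [l4]) (by simp [Expr.ok]; omega) (by simp [Expr.val]; omega)
      rw [show Expr.val w e (Function.update σ2 30 m) (.var 30) = m by simp [Expr.val]] at hval
      have hcell : v / 2 ^ q * 2 ^ q ≤ Nat.nth S m := by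
        by_contra hlt
        have := (nth_lt_iff hmN).mp (not_le.mp hlt)
        omega
      have hcell2 : Nat.nth S m < (v / 2 ^ q + 1) * 2 ^ q := (nth_lt_iff hmN).mpr (by omega)
      have hdiv : Nat.nth S m / 2 ^ q = v / 2 ^ q := Nat.div_eq_of_lt_le hcell hcell2
      have hdm2 := Nat.div_add_mod (Nat.nth S m) (2 ^ q)
      rw [hdiv] at hdm2
      have hiff : Nat.nth S m % 2 ^ q < v % 2 ^ q ↔ m < Nat.count S v := by
        rw [← nth_lt_iff hmN]; omega
      refine Runs.block_cons (Runs.ifExpr rfl ?_ ?_ ?_)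
      · simp only [Expr.ok, BinOp.safe]
        refine ⟨⟨hok, ?_⟩, ?_, hw0⟩
        · simp [l4]; omega
        · simp [k29]; omega
      · intro hnz
        have hlt : m < Nat.count S v := by
          rw [← hiff]
          simpa [Expr.val, BinOp.nat, l4, hval, k29, ltNat_eq_zero] using hnz
        refine Runs.assign rfl ?_ (Runs.block_nil ⟨rfl, ?_, ?_, ?_, ?_, ?_, ?_, ?_, ?_⟩)
        · simp [Expr.ok, Expr.val, BinOp.safe]
          omega
        · intro x hx
          simp (disch := omega) only [Function.update_of_ne]
          exact hf x hx
        all_goals simp [Expr.val, BinOp.nat, Expr.cost, lowAddr, k29]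
        all_goals omega
      · intro hz
        have hlt : ¬ m < Nat.count S v := by
          rw [← hiff]
          simpa [Expr.val, BinOp.nat, l4, hval, k29, ltNat_eq_zero] using hz
        refine Runs.assign rfl ?_ (Runs.block_nil ⟨rfl, ?_, ?_, ?_, ?_, ?_, ?_, ?_, ?_⟩)
        · simp [Expr.ok]
          omega
        · intro x hx
          simp (disch := omega) only [Function.update_of_ne]
          exact hf x hx
        all_goals simp [Expr.val, Expr.cost, lowAddr, k29]
        all_goals omega
  · have c1 := Nat.count_monotone S hlow
    have c2 := Nat.count_monotone S hup
    have c3 := count_sub_count_le S (v / 2 ^ q * 2 ^ q) ((v / 2 ^ q + 1) * 2 ^ q)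
    rw [add_mul, one_mul] at c3
    refine ⟨rfl, ?_, ?_, ?_, ?_, ?_, ?_, ?_, ?_⟩
    · intro x hx
      simp (disch := omega) only [Function.update_of_ne]
      exact hf1 x hx
    all_goals simp [k21, k26, Expr.cost]
    · exact c1
    · exact c2
    · rw [add_mul, one_mul, pow_succ]; omega
    · linarith

/-- The sought element is the ghost target: by `nth_lt_iff` it lies left of a midpoint iff `k` is
below the rank of the midpoint, which the tree supplies. The leaf number and the stored residue then
make up the element without any search. -/
theorem runs_select (H : Represents w e K q S) {σ : ℕ → ℕ} {o : List ℕ} {T k : ℕ}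
    {Q : (ℕ → ℕ) → List ℕ → ℕ → Prop} (h3 : σ 3 = K) (h4 : σ 4 = q)
    (h19 : σ 19 = Nat.count S (2 ^ (K + 3 + q))) (h20 : σ 20 = k)
    (hk : k < Nat.count S (2 ^ (K + 3 + q)))
    (hQ : ∀ σ' T', (∀ x < 21, σ' x = σ x) → σ' 21 = Nat.nth S k →
      T' ≤ T + 200 * (K + 3) → Q σ' o T') :
    Runs w e select σ o T Q := by
  obtain ⟨b1, b2, b3, b4, b5, b6, b7, b8⟩ := H.bounds
  have hqK := H.le
  have hK4 := H.four_le
  have hw0 : 0 < w := by have := H.word; omega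
  have hlt : Nat.nth S k < 2 ^ (K + 3 + q) := (nth_lt_iff hk).mpr hk
  unfold select
  refine Runs.block_cons (runs_descend H (y := Nat.nth S k) h3 h4 h19 hlt rfl (by decide) ?_ ?_)
  · intro σ' hf h t k22 k25 k24 hh ht
    have k20 : σ' 20 = k := by rw [hf 20 (by norm_num), h20]
    have hc := Nat.count_monotone S ht
    refine ⟨?_, ?_⟩
    · simp only [Expr.ok, BinOp.safe, k20, k24]
      omega
    · simp only [Expr.val, BinOp.nat, k20, k24, nth_lt_iff hk, ne_eq, ltNat_eq_zero,
        not_not]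
  intro σ1 T1 hf1 k21 k26 k25 hT1
  have k3 : σ1 3 = K := by rw [hf1 3 (by norm_num), h3]
  have k4 : σ1 4 = q := by rw [hf1 4 (by norm_num), h4]
  have k20 : σ1 20 = k := by rw [hf1 20 (by norm_num), h20]
  obtain ⟨hok, hval⟩ := lowAddr_spec H (σ := σ1) (a := .var 20) k3 k4
    (by simp only [Expr.ok]; omega) (by simp only [Expr.val]; omega)
  rw [show Expr.val w e σ1 (.var 20) = k from k20] at hval
  have hdm := Nat.div_add_mod (Nat.nth S k) (2 ^ q)
  rw [mul_comm] at hdm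
  have hqpos : 0 < 2 ^ q := by positivity
  have hle := Nat.le_mul_of_pos_right (Nat.nth S k / 2 ^ q) hqpos
  refine Runs.block_cons (Runs.assign rfl ?_ ?_)
  · simp only [Expr.ok, Expr.val, BinOp.safe, BinOp.nat, k4, k25, hval, hok, true_and]
    omega
  · refine Runs.block_nil (hQ _ _ ?_ ?_ ?_)
    · intro x hx
      rw [Function.update_of_ne (by omega)]
      exact hf1 x hx
    · simp only [Expr.val, BinOp.nat, Function.update_self, k4, k25, hval]
      exact hdm
    · simp [Expr.cost, lowAddr]
      omega

end SparseDict

/-! ### Maximal dyadic blocks in which an element is frequent -/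

namespace HeavyBlocks

open scoped Classical

universe v

theorem div_two_pow_mono {a b r s : ℕ} (h : a / 2 ^ r = b / 2 ^ r) (hrs : r ≤ s) :
    a / 2 ^ s = b / 2 ^ s := by
  obtain ⟨c, rfl⟩ := Nat.exists_eq_add_of_le hrs
  rw [pow_add, ← Nat.div_div_eq_div_mul, ← Nat.div_div_eq_div_mul, h]

section

variable {α : Type v} (K q : ℕ) (B : ℕ → Option α)

/-- The occurrences of the element at position `l` in the block of size `2 ^ s` around `l`. -/
noncomputable def occ (s l : ℕ) : Finset ℕ :=
  (Finset.range (2 ^ (K + 1))).filter (fun l' => l' / 2 ^ s = l / 2 ^ s ∧ B l' = B l)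

/-- The element at position `l` makes up a fraction of `2 ^ (-q)` of the block of size `2 ^ s`
around `l`. -/
def Heavy (s l : ℕ) : Prop := 2 ^ s ≤ 2 ^ q * (occ K B s l).card

/-- The level of the maximal block around `l` in which the element at `l` is heavy. -/
noncomputable def lev (l : ℕ) : ℕ := Nat.findGreatest (fun s => Heavy K q B s l) K

/-- The first occurrence of the element at `l` in its maximal block around `l`. -/
noncomputable def lead (l : ℕ) : ℕ :=
  Nat.find (⟨l, rfl, rfl⟩ : ∃ l', l' / 2 ^ lev K q B l = l / 2 ^ lev K q B l ∧ B l' = B l)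

/-- `l` is the first occurrence of its element in its maximal block. -/
def IsLead (l : ℕ) : Prop := B l ≠ none ∧ lead K q B l = l

/-- The number of the maximal block around `l` in the heap order of all blocks. -/
noncomputable def heap (l : ℕ) : ℕ := (2 ^ (K + 1) + l) / 2 ^ lev K q B l

/-- The leaders are ordered by block, and by position in a block. -/
noncomputable def ord (l : ℕ) : ℕ := heap K q B l * 2 ^ (K + 1) + l

/-- `c` is `ord l` for a leader `l`. -/
def IsCode (c : ℕ) : Prop :=
  IsLead K q B (c % 2 ^ (K + 1)) ∧ heap K q B (c % 2 ^ (K + 1)) = c / 2 ^ (K + 1)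

/-- The number of cells of the leaders with a code below `c`. -/
noncomputable def cells (c : ℕ) : ℕ :=
  ∑ k ∈ Finset.range c, if IsCode K q B k then 2 ^ (lev K q B (k % 2 ^ (K + 1)) - q) else 0

/-- The first key of the leader `l`. -/
noncomputable def base (l : ℕ) : ℕ := (2 ^ (K + 2) + cells K q B (ord K q B l)) * 2 ^ q

/-- The key of the position `l`. -/
noncomputable def key (l : ℕ) : ℕ := base K q B (lead K q B l) + l % 2 ^ lev K q B l

/-- The number of leaders of a block. -/
noncomputable def leaders (b : ℕ) : ℕ :=
  Nat.count (fun l => IsLead K q B l ∧ heap K q B l = b) (2 ^ (K + 1))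

/-- The set that encodes the maximal blocks: the numbers of leaders of all blocks, and the keys of
all positions. -/
def Keys (v : ℕ) : Prop :=
  (v / 2 ^ q < 2 ^ (K + 2) ∧ v % 2 ^ q < leaders K q B (v / 2 ^ q)) ∨
    ∃ l, B l ≠ none ∧ v = key K q B l

end

variable {α : Type v} {K q : ℕ} {B : ℕ → Option α}

/-- All positions lie below `2 ^ (K + 1)`. -/
structure Bounded (K q : ℕ) (B : ℕ → Option α) : Prop where
  lt : ∀ l, B l ≠ none → l < 2 ^ (K + 1)
  le : q ≤ K

theorem heavy_congr {s l l' : ℕ} (h : l / 2 ^ s = l' / 2 ^ s) (hB : B l = B l') :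
    Heavy K q B s l ↔ Heavy K q B s l' := by
  simp only [Heavy, occ, h, hB]

theorem lev_le (l : ℕ) : lev K q B l ≤ K := Nat.findGreatest_le K

namespace Bounded

theorem mem_occ (H : Bounded K q B) {l : ℕ} (s : ℕ) (hl : B l ≠ none) : l ∈ occ K B s l := by
  simp [occ, H.lt l hl]

theorem heavy_q (H : Bounded K q B) {l : ℕ} (hl : B l ≠ none) : Heavy K q B q l :=
  Nat.le_mul_of_pos_right _ (Finset.card_pos.mpr ⟨l, H.mem_occ q hl⟩)

theorem heavy_lev (H : Bounded K q B) {l : ℕ} (hl : B l ≠ none) : Heavy K q B (lev K q B l) l :=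
  Nat.findGreatest_spec (P := fun s => Heavy K q B s l) H.le (H.heavy_q hl)

theorem le_lev (H : Bounded K q B) {l : ℕ} (hl : B l ≠ none) : q ≤ lev K q B l :=
  Nat.le_findGreatest H.le (H.heavy_q hl)

/-- Positions that share a block share all larger ones, and heaviness depends only on block and
element; a greater level for one position would therefore be available to the other. -/
theorem lev_congr (H : Bounded K q B) {l l' : ℕ} (hl : B l ≠ none)
    (h : l' / 2 ^ lev K q B l = l / 2 ^ lev K q B l) (hB : B l' = B l) :
    lev K q B l' = lev K q B l := by
  have hl' : B l' ≠ none := by rwa [hB]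
  apply le_antisymm
  · by_contra hlt
    rw [not_le] at hlt
    have h1 := H.heavy_lev hl'
    rw [heavy_congr (div_two_pow_mono h hlt.le) hB] at h1
    exact absurd (Nat.le_findGreatest (lev_le l') h1) (not_le.mpr hlt)
  · refine Nat.le_findGreatest (lev_le l) ?_
    rw [heavy_congr h hB]
    exact H.heavy_lev hl

end Bounded

theorem lead_spec (l : ℕ) : lead K q B l / 2 ^ lev K q B l = l / 2 ^ lev K q B l ∧
    B (lead K q B l) = B l :=
  Nat.find_spec (⟨l, rfl, rfl⟩ : ∃ l', l' / 2 ^ lev K q B l = l / 2 ^ lev K q B l ∧ B l' = B l)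

namespace Bounded

theorem lead_congr (H : Bounded K q B) {l l' : ℕ} (hl : B l ≠ none)
    (h : l' / 2 ^ lev K q B l = l / 2 ^ lev K q B l) (hB : B l' = B l) :
    lead K q B l' = lead K q B l := by
  have := H.lev_congr hl h hB
  simp only [lead, this, h, hB]

theorem lev_lead (H : Bounded K q B) {l : ℕ} (hl : B l ≠ none) :
    lev K q B (lead K q B l) = lev K q B l :=
  H.lev_congr hl (lead_spec l).1 (lead_spec l).2

theorem isLead_lead (H : Bounded K q B) {l : ℕ} (hl : B l ≠ none) : IsLead K q B (lead K q B l) :=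
  ⟨by rw [(lead_spec (K := K) (q := q) (B := B) l).2]; exact hl,
    H.lead_congr hl (lead_spec l).1 (lead_spec l).2⟩

theorem heap_eq (l : ℕ) :
    heap K q B l = 2 ^ (K + 1 - lev K q B l) + l / 2 ^ lev K q B l := by
  have h := lev_le (K := K) (q := q) (B := B) l
  obtain ⟨c, hc⟩ := Nat.exists_eq_add_of_le (show lev K q B l ≤ K + 1 by omega)
  have h2 : K + 1 - lev K q B l = c := by omega
  have h3 : 2 ^ (K + 1) = 2 ^ lev K q B l * 2 ^ c := by rw [← pow_add, ← hc]
  rw [heap, h2, h3, Nat.mul_add_div (by positivity)]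

theorem le_heap (l : ℕ) : 2 ^ (K + 1 - lev K q B l) ≤ heap K q B l := by
  rw [heap_eq]; exact Nat.le_add_right _ _

theorem heap_lt {l : ℕ} (hl : l < 2 ^ (K + 1)) : heap K q B l < 2 ^ (K + 2 - lev K q B l) := by
  have h := lev_le (K := K) (q := q) (B := B) l
  obtain ⟨c, hc⟩ := Nat.exists_eq_add_of_le (show lev K q B l ≤ K + 1 by omega)
  have h2 : K + 1 - lev K q B l = c := by omega
  have h3 : 2 ^ (K + 1) = 2 ^ lev K q B l * 2 ^ c := by rw [← pow_add, ← hc]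
  have h4 : K + 2 - lev K q B l = c + 1 := by omega
  have h5 : l / 2 ^ lev K q B l < 2 ^ c := Nat.div_lt_of_lt_mul (by rwa [← h3])
  rw [heap_eq, h2, h4, pow_succ]
  omega

/-- The numbers of the blocks of level `s` fill the interval from `2 ^ (K + 1 - s)` to `2 ^ (K + 2 -
s)`, and these intervals are disjoint, so a block number reveals its level. -/
theorem lev_eq_of_heap {l s : ℕ} (hl : l < 2 ^ (K + 1)) (h1 : 2 ^ (K + 1 - s) ≤ heap K q B l)
    (h2 : heap K q B l < 2 ^ (K + 2 - s)) (hs : s ≤ K + 1) : lev K q B l = s := by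
  have h3 := le_heap (K := K) (q := q) (B := B) l
  have h4 := heap_lt (q := q) (B := B) hl
  have h := lev_le (K := K) (q := q) (B := B) l
  have h5 := (Nat.pow_lt_pow_iff_right (show 1 < 2 by norm_num)).mp (h3.trans_lt h2)
  have h6 := (Nat.pow_lt_pow_iff_right (show 1 < 2 by norm_num)).mp (h1.trans_lt h4)
  omega

theorem ord_lt_iff {l b : ℕ} (hl : l < 2 ^ (K + 1)) :
    ord K q B l < b * 2 ^ (K + 1) ↔ heap K q B l < b := by
  rw [ord]
  constructor
  · intro h
    by_contra hb
    have := Nat.mul_le_mul_right (2 ^ (K + 1)) (not_lt.mp hb)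
    omega
  · intro h
    have := Nat.mul_le_mul_right (2 ^ (K + 1)) (show heap K q B l + 1 ≤ b from h)
    rw [add_mul, one_mul] at this
    omega

theorem ord_mod {l : ℕ} (hl : l < 2 ^ (K + 1)) : ord K q B l % 2 ^ (K + 1) = l := by
  rw [ord, mul_comm, Nat.mul_add_mod, Nat.mod_eq_of_lt hl]

theorem ord_div {l : ℕ} (hl : l < 2 ^ (K + 1)) : ord K q B l / 2 ^ (K + 1) = heap K q B l := by
  rw [ord, mul_comm, Nat.mul_add_div (by positivity), Nat.div_eq_of_lt hl, add_zero]

theorem ord_inj {l l' : ℕ} (hl : l < 2 ^ (K + 1)) (hl' : l' < 2 ^ (K + 1))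
    (h : ord K q B l = ord K q B l') : l = l' := by
  rw [← ord_mod (q := q) (B := B) hl, h, ord_mod hl']

theorem isCode_ord (H : Bounded K q B) {l : ℕ} (hl : IsLead K q B l) :
    IsCode K q B (ord K q B l) := by
  have := H.lt l hl.1
  rw [IsCode, ord_mod this, ord_div this]
  exact ⟨hl, rfl⟩

theorem ord_of_isCode {c : ℕ} (hc : IsCode K q B c) : ord K q B (c % 2 ^ (K + 1)) = c := by
  rw [ord, hc.2, mul_comm]
  exact Nat.div_add_mod c _

end Bounded

end HeavyBlocks

/-! ### Counting leaders, cells and keys -/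

namespace HeavyBlocks

open scoped Classical

universe v

variable {α : Type v} {K q : ℕ} {B : ℕ → Option α}

theorem mem_occ_iff {s l x : ℕ} :
    x ∈ occ K B s l ↔ x < 2 ^ (K + 1) ∧ x / 2 ^ s = l / 2 ^ s ∧ B x = B l := by
  simp [occ]

namespace Bounded

/-- Makes the occurrence sets of different leaders disjoint, on which the counting arguments rest.
-/
theorem lead_of_mem_occ (H : Bounded K q B) {l x : ℕ} (hl : IsLead K q B l)
    (hx : x ∈ occ K B (lev K q B l) l) : B x ≠ none ∧ lead K q B x = l := by
  obtain ⟨-, h2, h3⟩ := mem_occ_iff.mp hx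
  refine ⟨by rw [h3]; exact hl.1, ?_⟩
  rw [H.lead_congr hl.1 h2 h3, hl.2]

theorem two_pow_lev_sub_le (H : Bounded K q B) {l : ℕ} (hl : B l ≠ none) :
    2 ^ (lev K q B l - q) ≤ (occ K B (lev K q B l) l).card := by
  have h1 := H.heavy_lev hl
  have h2 := H.le_lev hl
  have h3 : 2 ^ lev K q B l = 2 ^ q * 2 ^ (lev K q B l - q) := by rw [← pow_add]; congr 1; omega
  rw [Heavy] at h1
  nth_rewrite 1 [h3] at h1
  exact Nat.le_of_mul_le_mul_left h1 (by positivity)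

/-- A leader pays for its `2 ^ (lev - q)` cells with its occurrences, of which heaviness guarantees
at least as many, and no position pays for two leaders. -/
theorem cells_le (H : Bounded K q B) (c : ℕ) : cells K q B c ≤ 2 ^ (K + 1) := by
  rw [cells, ← Finset.sum_filter]
  calc _ ≤ ∑ k ∈ (Finset.range c).filter (IsCode K q B),
        ((Finset.range (2 ^ (K + 1))).filter (fun l => ord K q B (lead K q B l) = k)).card := by
        apply Finset.sum_le_sum
        intro k hk
        obtain ⟨-, hk⟩ := Finset.mem_filter.mp hk
        refine (H.two_pow_lev_sub_le hk.1.1).trans (Finset.card_le_card ?_)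
        intro x hx
        rw [Finset.mem_filter, Finset.mem_range, (H.lead_of_mem_occ hk.1 hx).2, ord_of_isCode hk]
        exact ⟨(mem_occ_iff.mp hx).1, rfl⟩
    _ ≤ (Finset.range (2 ^ (K + 1))).card := by
        rw [← Finset.card_biUnion]
        · apply Finset.card_le_card
          intro x hx
          obtain ⟨k, -, hk⟩ := Finset.mem_biUnion.mp hx
          exact (Finset.mem_filter.mp hk).1
        · intro a _ b _ hab
          rw [Function.onFun, Finset.disjoint_left]
          intro x hx hx'
          exact hab ((Finset.mem_filter.mp hx).2.symm.trans (Finset.mem_filter.mp hx').2)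
    _ = 2 ^ (K + 1) := by simp

/-- Each leader of a block of size `2 ^ s` owns at least `2 ^ (s - q)` positions of the block, and
no position is owned twice. -/
theorem leaders_le (H : Bounded K q B) (b : ℕ) : leaders K q B b ≤ 2 ^ q := by
  rw [leaders, Nat.count_eq_card_filter_range]
  set F := (Finset.range (2 ^ (K + 1))).filter (fun l => IsLead K q B l ∧ heap K q B l = b) with hF
  rcases F.eq_empty_or_nonempty with h0 | ⟨l0, h0⟩
  · rw [h0]; simp
  have hmem : ∀ l ∈ F, l < 2 ^ (K + 1) ∧ IsLead K q B l ∧ heap K q B l = b := by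
    intro l hl
    simpa [hF] using hl
  obtain ⟨hl0, hlead0, hb0⟩ := hmem l0 h0
  set s := lev K q B l0 with hs
  have hsK : s ≤ K := lev_le l0
  have hqs : q ≤ s := H.le_lev hlead0.1
  have hlev : ∀ l ∈ F, lev K q B l = s := by
    intro l hl
    obtain ⟨h1, h2, h3⟩ := hmem l hl
    apply lev_eq_of_heap h1
    · rw [h3, ← hb0]; exact le_heap l0
    · rw [h3, ← hb0]; exact heap_lt hl0
    · omega
  have hdiv : ∀ l ∈ F, ∀ x ∈ occ K B s l, x / 2 ^ s = l0 / 2 ^ s := by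
    intro l hl x hx
    obtain ⟨h1, h2, h3⟩ := hmem l hl
    rw [(mem_occ_iff.mp hx).2.1]
    have h4 := heap_eq (K := K) (q := q) (B := B) l
    have h5 := heap_eq (K := K) (q := q) (B := B) l0
    rw [hlev l hl] at h4
    rw [← hs] at h5
    omega
  have hsum : F.card * 2 ^ (s - q) ≤ 2 ^ s := by
    calc F.card * 2 ^ (s - q) ≤ ∑ l ∈ F, (occ K B s l).card := by
          rw [← smul_eq_mul]
          apply Finset.card_nsmul_le_sum
          intro l hl
          have := H.two_pow_lev_sub_le (hmem l hl).2.1.1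
          rwa [hlev l hl] at this
      _ = (F.biUnion (fun l => occ K B s l)).card := by
          rw [Finset.card_biUnion]
          intro a ha c hc hac
          rw [Function.onFun, Finset.disjoint_left]
          intro x hx hx'
          rw [← hlev a ha] at hx
          rw [← hlev c hc] at hx'
          exact hac ((H.lead_of_mem_occ (hmem a ha).2.1 hx).2.symm.trans
            (H.lead_of_mem_occ (hmem c hc).2.1 hx').2)
      _ ≤ (Finset.Ico (l0 / 2 ^ s * 2 ^ s) (l0 / 2 ^ s * 2 ^ s + 2 ^ s)).card := by
          apply Finset.card_le_card
          intro x hx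
          obtain ⟨l, hl, hx⟩ := Finset.mem_biUnion.mp hx
          have h1 := hdiv l hl x hx
          have h2 := Nat.div_add_mod x (2 ^ s)
          have h3 := Nat.mod_lt x (show 0 < 2 ^ s by positivity)
          rw [h1, mul_comm] at h2
          rw [Finset.mem_Ico]
          omega
      _ = 2 ^ s := by simp
  have h3 : 2 ^ s = 2 ^ q * 2 ^ (s - q) := by rw [← pow_add]; congr 1; omega
  rw [h3] at hsum
  exact Nat.le_of_mul_le_mul_right hsum (by positivity)

theorem cells_succ (c : ℕ) : cells K q B (c + 1) = cells K q B c +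
    if IsCode K q B c then 2 ^ (lev K q B (c % 2 ^ (K + 1)) - q) else 0 := by
  rw [cells, Finset.sum_range_succ, cells]

theorem cells_mono {c d : ℕ} (h : c ≤ d) : cells K q B c ≤ cells K q B d :=
  Finset.sum_le_sum_of_subset (Finset.range_mono h)

/-- Levels do not exceed `K`, so leaders have block numbers of at least `2`. This is the value from
which the program starts accumulating cells. -/
theorem cells_eq_zero {c : ℕ} (hc : c ≤ 2 * 2 ^ (K + 1)) : cells K q B c = 0 := by
  apply Finset.sum_eq_zero
  intro k hk
  rw [Finset.mem_range] at hk
  rw [if_neg]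
  intro h
  have h1 := le_heap (K := K) (q := q) (B := B) (k % 2 ^ (K + 1))
  have h2 : k / 2 ^ (K + 1) < 2 := Nat.div_lt_of_lt_mul (by rw [mul_comm]; omega)
  have h3 := lev_le (K := K) (q := q) (B := B) (k % 2 ^ (K + 1))
  have h4 : 2 ^ 1 ≤ 2 ^ (K + 1 - lev K q B (k % 2 ^ (K + 1))) :=
    Nat.pow_le_pow_right (by norm_num) (by omega)
  rw [h.2] at h1
  omega

/-- The cells of a level. -/
theorem cells_level {s : ℕ} (hs : s ≤ K + 1) (d : ℕ)
    (hd : 2 ^ (K + 1 - s) * 2 ^ (K + 1) + d ≤ 2 ^ (K + 2 - s) * 2 ^ (K + 1)) :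
    cells K q B (2 ^ (K + 1 - s) * 2 ^ (K + 1) + d) =
      cells K q B (2 ^ (K + 1 - s) * 2 ^ (K + 1)) +
      (Nat.count (IsCode K q B) (2 ^ (K + 1 - s) * 2 ^ (K + 1) + d) -
        Nat.count (IsCode K q B) (2 ^ (K + 1 - s) * 2 ^ (K + 1))) * 2 ^ (s - q) := by
  induction d with
  | zero => simp
  | succ d ih =>
    have ih := ih (by omega)
    set c0 := 2 ^ (K + 1 - s) * 2 ^ (K + 1)
    have hm := Nat.count_monotone (IsCode K q B) (show c0 ≤ c0 + d by omega)
    rw [← add_assoc, cells_succ, ih, Nat.count_succ]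
    by_cases hc : IsCode K q B (c0 + d)
    -- Codes in this window belong to blocks of level `s`, so each leader adds the same number of
    -- cells.
    · have hlev : lev K q B ((c0 + d) % 2 ^ (K + 1)) = s := by
        apply lev_eq_of_heap (Nat.mod_lt _ (by positivity)) _ _ hs
        · rw [hc.2, Nat.le_div_iff_mul_le (by positivity)]
          exact Nat.le_add_right _ _
        · rw [hc.2, Nat.div_lt_iff_lt_mul (by positivity)]
          omega
      rw [if_pos hc, if_pos hc, hlev, Nat.sub_add_comm hm, add_mul, one_mul, add_assoc]
    · rw [if_neg hc, if_neg hc]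
      rfl

theorem cells_ord_succ_le (H : Bounded K q B) {l l' : ℕ} (hl : IsLead K q B l)
    (h : ord K q B l < ord K q B l') :
    cells K q B (ord K q B l) + 2 ^ (lev K q B l - q) ≤ cells K q B (ord K q B l') := by
  refine le_trans ?_ (cells_mono (show ord K q B l + 1 ≤ ord K q B l' from h))
  rw [cells_succ, if_pos (H.isCode_ord hl), ord_mod (H.lt l hl.1)]

/-- Bit vectors of different leaders occupy disjoint intervals, in the order of the codes. -/
theorem base_add_le (H : Bounded K q B) {l l' : ℕ} (hl : IsLead K q B l)
    (h : ord K q B l < ord K q B l') :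
    base K q B l + 2 ^ lev K q B l ≤ base K q B l' := by
  have h1 := H.cells_ord_succ_le hl h
  have h2 := H.le_lev hl.1
  have h3 : 2 ^ lev K q B l = 2 ^ (lev K q B l - q) * 2 ^ q := by rw [← pow_add]; congr 1; omega
  rw [base, base, h3, ← add_mul]
  exact Nat.mul_le_mul_right _ (by omega)

/-- Here `6 * 2 ^ K` is `2 ^ (K + 2)` for the block counters plus `2 ^ (K + 1)` for the cells; so
all keys stay below `2 ^ (K + 3 + q)`. -/
theorem base_add_lt (H : Bounded K q B) {l : ℕ} (hl : IsLead K q B l) :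
    base K q B l + 2 ^ lev K q B l ≤ 6 * (2 ^ K * 2 ^ q) := by
  have h1 := H.cells_le (ord K q B l + 1)
  rw [cells_succ, if_pos (H.isCode_ord hl), ord_mod (H.lt l hl.1)] at h1
  have h2 := H.le_lev hl.1
  have h3 : 2 ^ lev K q B l = 2 ^ (lev K q B l - q) * 2 ^ q := by rw [← pow_add]; congr 1; omega
  rw [base, h3, ← add_mul, ← mul_assoc]
  apply Nat.mul_le_mul_right
  rw [pow_add 2 K 2]
  rw [pow_succ] at h1
  omega

theorem le_key (l : ℕ) : 2 ^ (K + 2) * 2 ^ q ≤ key K q B l := by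
  rw [key, base, add_mul, add_assoc]
  exact Nat.le_add_right _ _

/-- The keys of a leader stand for the occurrences of its element in its block. -/
theorem keys_base_add_iff (H : Bounded K q B) {l r : ℕ} (hl : IsLead K q B l)
    (hr : r < 2 ^ lev K q B l) :
    Keys K q B (base K q B l + r) ↔
      B (l / 2 ^ lev K q B l * 2 ^ lev K q B l + r) = B l := by
  have hpos : 0 < 2 ^ lev K q B l := by positivity
  constructor
  · rintro (⟨h, -⟩ | ⟨x, hx, h⟩)
    · rw [Nat.div_lt_iff_lt_mul (by positivity), base, add_mul] at h
      omega
    · rw [key] at h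
      have hlx := H.isLead_lead hx
      have hmx := Nat.mod_lt x (show 0 < 2 ^ lev K q B x by positivity)
      rw [← H.lev_lead hx] at hmx
      -- The key of `x` lies in the interval of its own leader; if that is not `l`, the two
      -- intervals are disjoint by `base_add_le`.
      rcases lt_trichotomy (ord K q B l) (ord K q B (lead K q B x)) with h1 | h1 | h1
      · have := H.base_add_le hl h1
        omega
      · have h2 := ord_inj (H.lt _ hl.1) (H.lt _ hlx.1) h1
        have h3 := H.lev_lead hx
        have h4 := (lead_spec (K := K) (q := q) (B := B) x)
        rw [← h2] at h h3 h4
        rw [← h3] at h h4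
        have h5 := Nat.div_add_mod x (2 ^ lev K q B l)
        rw [← h4.1, mul_comm] at h5
        rw [show r = x % 2 ^ lev K q B l by omega, h5]
        exact h4.2.symm
      · have := H.base_add_le hlx h1
        rw [H.lev_lead hx] at this hmx
        omega
  · intro h
    right
    set x := l / 2 ^ lev K q B l * 2 ^ lev K q B l + r with hx
    have hdiv : x / 2 ^ lev K q B l = l / 2 ^ lev K q B l := by
      rw [hx, mul_comm, Nat.mul_add_div hpos, Nat.div_eq_of_lt hr, add_zero]
    have hmod : x % 2 ^ lev K q B l = r := by
      rw [hx, mul_comm, Nat.mul_add_mod, Nat.mod_eq_of_lt hr]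
    refine ⟨x, by rw [h]; exact hl.1, ?_⟩
    rw [key, H.lead_congr hl.1 hdiv h, H.lev_congr hl.1 hdiv h, hl.2, hmod]

/-- The rank of the first key of a block is the number of leaders of earlier blocks. -/
theorem count_keys_heap (H : Bounded K q B) {b : ℕ} (hb : b ≤ 2 ^ (K + 2)) :
    Nat.count (Keys K q B) (b * 2 ^ q) = Nat.count (IsCode K q B) (b * 2 ^ (K + 1)) := by
  induction b with
  | zero => simp
  | succ b ih =>
    have hq : 0 < 2 ^ q := by positivity
    have hK : 0 < 2 ^ (K + 1) := by positivity
    rw [add_mul, add_mul, one_mul, one_mul, Nat.count_add, Nat.count_add, ih (by omega)]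
    congr 1
    -- Of the `2 ^ q` numbers reserved for block `b`, exactly the first `leaders b` are keys: a
    -- unary counter, which rank sums up. It fits by `leaders_le`.
    have h1 : Nat.count (fun k => Keys K q B (b * 2 ^ q + k)) (2 ^ q) =
        Nat.count (fun k => k < leaders K q B b) (2 ^ q) := by
      rw [Nat.count_eq_card_filter_range, Nat.count_eq_card_filter_range]
      congr 1
      apply Finset.filter_congr
      intro k hk
      rw [Finset.mem_range] at hk
      have hdiv : (b * 2 ^ q + k) / 2 ^ q = b := by
        rw [mul_comm, Nat.mul_add_div hq, Nat.div_eq_of_lt hk, add_zero]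
      have hmod : (b * 2 ^ q + k) % 2 ^ q = k := by
        rw [mul_comm, Nat.mul_add_mod, Nat.mod_eq_of_lt hk]
      rw [Keys, hdiv, hmod]
      constructor
      · rintro (⟨-, h⟩ | ⟨l, -, h⟩)
        · exact h
        · have h2 := le_key (K := K) (q := q) (B := B) l
          have h3 := Nat.mul_le_mul_right (2 ^ q) hb
          rw [add_mul, one_mul] at h3
          omega
      · intro h
        exact Or.inl ⟨hb, h⟩
    have h2 : Nat.count (fun k => k < leaders K q B b) (2 ^ q) = leaders K q B b := by
      rw [Nat.count_eq_card_filter_range]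
      have : (Finset.range (2 ^ q)).filter (fun k => k < leaders K q B b) =
          Finset.range (leaders K q B b) := by
        ext k
        have := H.leaders_le b
        simp only [Finset.mem_filter, Finset.mem_range]
        omega
      rw [this, Finset.card_range]
    rw [h1, h2, leaders, Nat.count_eq_card_filter_range, Nat.count_eq_card_filter_range]
    congr 1
    apply Finset.filter_congr
    intro k hk
    rw [Finset.mem_range] at hk
    have hdiv : (b * 2 ^ (K + 1) + k) / 2 ^ (K + 1) = b := by
      rw [mul_comm, Nat.mul_add_div hK, Nat.div_eq_of_lt hk, add_zero]
    have hmod : (b * 2 ^ (K + 1) + k) % 2 ^ (K + 1) = k := by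
      rw [mul_comm, Nat.mul_add_mod, Nat.mod_eq_of_lt hk]
    rw [IsCode, hdiv, hmod]

/-- There are at most two keys for each position. -/
theorem count_keys_le_card (H : Bounded K q B) (v : ℕ) : Nat.count (Keys K q B) v ≤
    2 * ((Finset.range (2 ^ (K + 1))).filter (fun l => B l ≠ none)).card := by
  set D := (Finset.range (2 ^ (K + 1))).filter (fun l => B l ≠ none) with hD
  -- The counters contribute one key for each leader, and leaders are occupied positions; the bit
  -- vectors contribute at most one key for each occupied position.
  have h1 : Nat.count (Keys K q B) (2 ^ (K + 2) * 2 ^ q) ≤ D.card := by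
    rw [H.count_keys_heap le_rfl, Nat.count_eq_card_filter_range]
    calc _ ≤ (D.image (ord K q B)).card := by
          apply Finset.card_le_card
          intro c hc
          obtain ⟨-, hc⟩ := Finset.mem_filter.mp hc
          rw [Finset.mem_image]
          exact ⟨_, Finset.mem_filter.mpr ⟨Finset.mem_range.mpr (Nat.mod_lt _ (by positivity)),
            hc.1.1⟩, ord_of_isCode hc⟩
      _ ≤ _ := Finset.card_image_le
  have h2 : Nat.count (Keys K q B) (2 ^ (K + 2) * 2 ^ q + v) ≤
      Nat.count (Keys K q B) (2 ^ (K + 2) * 2 ^ q) + D.card := by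
    rw [Nat.count_add]
    apply Nat.add_le_add_left
    rw [Nat.count_eq_card_filter_range]
    calc _ ≤ (D.image (fun l => key K q B l - 2 ^ (K + 2) * 2 ^ q)).card := by
          apply Finset.card_le_card
          intro c hc
          obtain ⟨-, hc⟩ := Finset.mem_filter.mp hc
          rw [Finset.mem_image]
          rcases hc with ⟨h, -⟩ | ⟨l, hl, h⟩
          · rw [Nat.div_lt_iff_lt_mul (by positivity)] at h
            omega
          · exact ⟨l, Finset.mem_filter.mpr ⟨Finset.mem_range.mpr (H.lt l hl), hl⟩, by omega⟩
      _ ≤ _ := Finset.card_image_le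
  have h3 := Nat.count_monotone (Keys K q B) (show v ≤ 2 ^ (K + 2) * 2 ^ q + v by omega)
  omega

theorem count_keys_le (H : Bounded K q B) (v : ℕ) : Nat.count (Keys K q B) v ≤ 4 * 2 ^ K := by
  have h1 := H.count_keys_le_card v
  have h2 := Finset.card_filter_le (Finset.range (2 ^ (K + 1))) (fun l => B l ≠ none)
  rw [Finset.card_range] at h2
  have h3 := pow_succ 2 K
  omega

end Bounded

end HeavyBlocks

/-! ### The leaders of the blocks around a position -/

namespace HeavyBlocks

open scoped Classical

universe v

variable {α : Type v} {K q : ℕ} {B : ℕ → Option α}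

/-- The number of a leader. -/
noncomputable def idx (K q : ℕ) (B : ℕ → Option α) (l : ℕ) : ℕ :=
  Nat.count (IsCode K q B) (ord K q B l)

/-- The number of leaders of the blocks before `b`. -/
noncomputable def before (K q : ℕ) (B : ℕ → Option α) (b : ℕ) : ℕ :=
  Nat.count (IsCode K q B) (b * 2 ^ (K + 1))

/-- The number of the block of size `2 ^ s` around `x`. -/
def blockAt (K s x : ℕ) : ℕ := (2 ^ (K + 1) + x) / 2 ^ s

theorem before_mono {b c : ℕ} (h : b ≤ c) : before K q B b ≤ before K q B c :=
  Nat.count_monotone _ (Nat.mul_le_mul_right _ h)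

theorem blockAt_eq {s : ℕ} (hs : s ≤ K) (x : ℕ) : blockAt K s x = 2 ^ (K + 1 - s) + x / 2 ^ s := by
  have h3 : 2 ^ (K + 1) = 2 ^ s * 2 ^ (K + 1 - s) := by rw [← pow_add]; congr 1; omega
  rw [blockAt, h3, Nat.mul_add_div (by positivity)]

theorem le_blockAt {s : ℕ} (hs : s ≤ K) (x : ℕ) : 2 ^ (K + 1 - s) ≤ blockAt K s x := by
  rw [blockAt_eq hs]; exact Nat.le_add_right _ _

theorem blockAt_lt {s x : ℕ} (hs : s ≤ K) (hx : x < 2 ^ (K + 1)) :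
    blockAt K s x < 2 ^ (K + 2 - s) := by
  have h3 : 2 ^ (K + 1) = 2 ^ s * 2 ^ (K + 1 - s) := by rw [← pow_add]; congr 1; omega
  have h4 : x / 2 ^ s < 2 ^ (K + 1 - s) := Nat.div_lt_of_lt_mul (by rwa [← h3])
  have h5 : 2 ^ (K + 2 - s) = 2 ^ (K + 1 - s) * 2 := by rw [← pow_succ]; congr 1; omega
  rw [blockAt_eq hs, h5]
  omega

theorem blockAt_mul {s x : ℕ} (hs : s ≤ K) :
    blockAt K s x * 2 ^ s = 2 ^ (K + 1) + x / 2 ^ s * 2 ^ s := by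
  have h3 : 2 ^ (K + 1) = 2 ^ (K + 1 - s) * 2 ^ s := by rw [← pow_add]; congr 1; omega
  rw [blockAt_eq hs, add_mul, h3]

namespace Bounded

/-- Codes are sorted by block first, so the program's comparisons of leader numbers amount to
comparisons of block numbers. -/
theorem idx_lt_before_iff (H : Bounded K q B) {l b : ℕ} (hl : IsLead K q B l) :
    idx K q B l < before K q B b ↔ heap K q B l < b := by
  rw [← ord_lt_iff (H.lt l hl.1)]
  constructor
  · intro h
    by_contra hb
    exact absurd (Nat.count_monotone (IsCode K q B) (not_lt.mp hb)) (not_le.mpr h)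
  · intro h
    have h1 := Nat.count_monotone (IsCode K q B) (show ord K q B l + 1 ≤ b * 2 ^ (K + 1) from h)
    rw [Nat.count_succ, if_pos (H.isCode_ord hl)] at h1
    exact h1

theorem idx_inj (H : Bounded K q B) {l l' : ℕ} (hl : IsLead K q B l) (hl' : IsLead K q B l')
    (h : idx K q B l = idx K q B l') : l = l' :=
  ord_inj (H.lt l hl.1) (H.lt l' hl'.1)
    (Nat.count_injective (H.isCode_ord hl) (H.isCode_ord hl') h)

/-- The leaders of a block are numbered consecutively, so a loop between two ranks meets only
leaders of that block. -/
theorem exists_idx_eq (H : Bounded K q B) {b e : ℕ} (h1 : before K q B b ≤ e)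
    (h2 : e < before K q B (b + 1)) :
    ∃ l, IsLead K q B l ∧ heap K q B l = b ∧ idx K q B l = e := by
  have hc := SparseDict.nth_mem_of_lt_count h2
  refine ⟨_, hc.1, ?_, ?_⟩
  · have h3 : idx K q B (Nat.nth (IsCode K q B) e % 2 ^ (K + 1)) = e := by
      rw [idx, ord_of_isCode hc, Nat.count_nth (SparseDict.lt_card_of_lt_count h2)]
    have h4 := H.idx_lt_before_iff (b := b) hc.1
    have h5 := H.idx_lt_before_iff (b := b + 1) hc.1
    rw [h3] at h4 h5
    omega
  · rw [idx, ord_of_isCode hc, Nat.count_nth (SparseDict.lt_card_of_lt_count h2)]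

theorem lev_eq_of_heap_blockAt {l s x : ℕ} (H : Bounded K q B) (hl : IsLead K q B l)
    (hs : s ≤ K) (hx : x < 2 ^ (K + 1)) (h : heap K q B l = blockAt K s x) :
    lev K q B l = s ∧ l / 2 ^ s = x / 2 ^ s := by
  have h1 : lev K q B l = s := by
    apply lev_eq_of_heap (H.lt l hl.1)
    · rw [h]; exact le_blockAt hs x
    · rw [h]; exact blockAt_lt hs hx
    · omega
  refine ⟨h1, ?_⟩
  rw [heap_eq, blockAt_eq hs, h1] at h
  omega

/-- What replaces stored pointers: within a level all leaders have equally many cells, so the start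
of a bit vector follows from the cells of the earlier levels and the leader's number inside its
level. -/
theorem base_eq (H : Bounded K q B) {l s : ℕ} (hl : IsLead K q B l) (hs : lev K q B l = s) :
    base K q B l = (2 ^ (K + 2) + (cells K q B (2 ^ (K + 1 - s) * 2 ^ (K + 1)) +
      (idx K q B l - before K q B (2 ^ (K + 1 - s))) * 2 ^ (s - q))) * 2 ^ q := by
  have h1 := le_heap (K := K) (q := q) (B := B) l
  have h2 := heap_lt (q := q) (B := B) (H.lt l hl.1)
  have h3 : 2 ^ (K + 1 - s) * 2 ^ (K + 1) ≤ ord K q B l := by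
    rw [← not_lt, ord_lt_iff (H.lt l hl.1), not_lt, ← hs]
    exact h1
  have h4 : ord K q B l < 2 ^ (K + 2 - s) * 2 ^ (K + 1) := by
    rw [ord_lt_iff (H.lt l hl.1), ← hs]
    exact h2
  have h5 := lev_le (K := K) (q := q) (B := B) l
  obtain ⟨d, hd⟩ := Nat.exists_eq_add_of_le h3
  have h6 := cells_level (K := K) (q := q) (B := B) (s := s) (by omega) d (by omega)
  rw [base, idx, before, hd, h6]

theorem count_keys_add (H : Bounded K q B) {l u m x : ℕ} (hl : IsLead K q B l)
    (hum : u + m ≤ 2 ^ lev K q B l) (hx : l / 2 ^ lev K q B l * 2 ^ lev K q B l + u = x) :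
    Nat.count (Keys K q B) (base K q B l + u + m) =
      Nat.count (Keys K q B) (base K q B l + u) + Nat.count (fun k => B (x + k) = B l) m := by
  rw [Nat.count_add]
  congr 1
  rw [Nat.count_eq_card_filter_range, Nat.count_eq_card_filter_range]
  congr 1
  apply Finset.filter_congr
  intro k hk
  rw [Finset.mem_range] at hk
  rw [add_assoc, H.keys_base_add_iff hl (by omega), ← hx, add_assoc]

/-- The rank of the left end, used as an index for select, yields the first occurrence in the
interval, and the distance of its key from the base gives its position. -/
theorem nth_keys (H : Bounded K q B) {l u m x : ℕ} (hl : IsLead K q B l)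
    (hum : u + m ≤ 2 ^ lev K q B l) (hx : l / 2 ^ lev K q B l * 2 ^ lev K q B l + u = x)
    (hpos : 0 < Nat.count (fun k => B (x + k) = B l) m) :
    ∃ k < m, B (x + k) = B l ∧
      Nat.nth (Keys K q B) (Nat.count (Keys K q B) (base K q B l + u)) =
        base K q B l + u + k := by
  have h1 := H.count_keys_add hl hum hx
  set r := Nat.count (Keys K q B) (base K q B l + u) with hr
  have h2 : r < Nat.count (Keys K q B) (base K q B l + u + m) := by omega
  have h3 := (SparseDict.nth_lt_iff h2).mpr h2
  have h4 : base K q B l + u ≤ Nat.nth (Keys K q B) r := by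
    rw [← not_lt, SparseDict.nth_lt_iff h2, ← hr]
    exact lt_irrefl _
  obtain ⟨k, hk⟩ := Nat.exists_eq_add_of_le h4
  have h5 := SparseDict.nth_mem_of_lt_count h2
  rw [hk, add_assoc, H.keys_base_add_iff hl (by omega), ← add_assoc, hx] at h5
  exact ⟨k, by omega, h5, hk⟩

end Bounded

/-- `l` is the leader of a maximal block of level at least `s0` around `x`. -/
def Around (K q : ℕ) (B : ℕ → Option α) (x s0 l : ℕ) : Prop :=
  IsLead K q B l ∧ heap K q B l = blockAt K (lev K q B l) x ∧ s0 ≤ lev K q B l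

/-- `out` lists an occurrence in the interval of length `m` from `x` on, moved by `off`, of each
element with `Maj` for which there is a maximal block around `x` with a number below `e`. -/
structure Collected (K q : ℕ) (B : ℕ → Option α) (x m s0 off : ℕ) (Maj : Option α → Prop)
    (out : List ℕ) (e : ℕ) : Prop where
  range : ∀ o ∈ out, x ≤ o + off ∧ o + off < x + m
  nodup : (out.map (fun o => B (o + off))).Nodup
  mem : ∀ y, y ∈ out.map (fun o => B (o + off)) ↔
    ∃ l, Around K q B x s0 l ∧ idx K q B l < e ∧ B l = y ∧ Maj y

section

variable {x m s0 off : ℕ} {Maj : Option α → Prop} {out : List ℕ} {e : ℕ}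

/-- Two blocks around `x` are nested. The leader of the smaller one then lies in the larger, maximal
block of the same element, so `lead_congr` identifies the leaders. This is why no element is
reported twice. -/
theorem Bounded.around_unique (H : Bounded K q B) {l l' : ℕ} (hx : x < 2 ^ (K + 1))
    (h : Around K q B x s0 l) (h' : Around K q B x s0 l') (hB : B l = B l') : l = l' := by
  wlog hle : lev K q B l ≤ lev K q B l' generalizing l l'
  · exact (this h' h hB.symm (by omega)).symm
  have h1 := (H.lev_eq_of_heap_blockAt h.1 (lev_le l) hx h.2.1).2
  have h2 := (H.lev_eq_of_heap_blockAt h'.1 (lev_le l') hx h'.2.1).2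
  have h3 := (div_two_pow_mono h1 hle).trans h2.symm
  rw [← h.1.2, ← h'.1.2]
  exact H.lead_congr h'.1.1 h3 hB

theorem Collected.congr (h : Collected K q B x m s0 off Maj out e) {e' : ℕ}
    (he : ∀ l, Around K q B x s0 l → (idx K q B l < e ↔ idx K q B l < e')) :
    Collected K q B x m s0 off Maj out e' := by
  refine ⟨h.range, h.nodup, fun y => ?_⟩
  rw [h.mem]
  constructor
  · rintro ⟨l, h1, h2, h3⟩
    exact ⟨l, h1, (he l h1).mp h2, h3⟩
  · rintro ⟨l, h1, h2, h3⟩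
    exact ⟨l, h1, (he l h1).mpr h2, h3⟩

theorem Collected.skip (h : Collected K q B x m s0 off Maj out e) (H : Bounded K q B) {l : ℕ}
    (hl : IsLead K q B l) (he : idx K q B l = e) (hM : ¬ Maj (B l)) :
    Collected K q B x m s0 off Maj out (e + 1) := by
  refine ⟨h.range, h.nodup, fun y => ?_⟩
  rw [h.mem]
  constructor
  · rintro ⟨l', h1, h2, h3⟩
    exact ⟨l', h1, by omega, h3⟩
  · rintro ⟨l', h1, h2, rfl, h4⟩
    refine ⟨l', h1, ?_, rfl, h4⟩
    by_contra hn
    rw [H.idx_inj hl h1.1 (by omega)] at hM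
    exact hM h4

theorem Collected.push (h : Collected K q B x m s0 off Maj out e) (H : Bounded K q B) {l o : ℕ}
    (hx : x < 2 ^ (K + 1)) (hl : Around K q B x s0 l) (he : idx K q B l = e) (hM : Maj (B l))
    (ho1 : x ≤ o + off) (ho2 : o + off < x + m) (hB : B (o + off) = B l) :
    Collected K q B x m s0 off Maj (out ++ [o]) (e + 1) := by
  refine ⟨?_, ?_, fun y => ?_⟩
  · intro o' ho'
    rcases List.mem_append.mp ho' with h1 | h1
    · exact h.range o' h1
    · rw [List.mem_singleton] at h1
      subst h1
      exact ⟨ho1, ho2⟩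
  · rw [List.map_append, List.map_singleton]
    refine List.nodup_append.mpr ⟨h.nodup, List.nodup_singleton _, ?_⟩
    intro a ha b hb hab
    rw [List.mem_singleton] at hb
    subst hab
    rw [hb, hB, h.mem] at ha
    obtain ⟨l', h1, h2, h3, -⟩ := ha
    have := H.around_unique hx hl h1 h3.symm
    subst this
    omega
  · rw [List.map_append, List.mem_append, h.mem, List.map_singleton, List.mem_singleton, hB]
    constructor
    · rintro (⟨l', h1, h2, h3⟩ | rfl)
      · exact ⟨l', h1, by omega, h3⟩
      · exact ⟨l, hl, by omega, rfl, hM⟩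
    · rintro ⟨l', h1, h2, rfl, h4⟩
      by_cases hlt : idx K q B l' < e
      · exact Or.inl ⟨l', h1, hlt, rfl, h4⟩
      · exact Or.inr (by rw [H.idx_inj hl.1 h1.1 (by omega)])

/-- Only one block of level `s` contains `x`. So no leader around `x` is lost by jumping from the
start of the level to this block, or from its end to the next level. -/
theorem Bounded.idx_lt_level_iff (H : Bounded K q B) {l s : ℕ} (hs : s ≤ K)
    (hx : x < 2 ^ (K + 1)) (hl : Around K q B x s0 l) :
    (idx K q B l < before K q B (2 ^ (K + 1 - s)) ↔
      idx K q B l < before K q B (blockAt K s x)) ∧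
    (idx K q B l < before K q B (blockAt K s x + 1) ↔
      idx K q B l < before K q B (2 ^ (K + 2 - s))) := by
  rw [H.idx_lt_before_iff hl.1, H.idx_lt_before_iff hl.1, H.idx_lt_before_iff hl.1,
    H.idx_lt_before_iff hl.1]
  have h1 := le_blockAt hs x
  have h2 := blockAt_lt hs hx
  have h3 := le_heap (K := K) (q := q) (B := B) l
  have h4 := heap_lt (q := q) (B := B) (H.lt l hl.1.1)
  have h5 := hl.2.1
  have h6 := lev_le (K := K) (q := q) (B := B) l
  rcases lt_trichotomy (lev K q B l) s with h | h | h
  · have : 2 ^ (K + 2 - s) ≤ 2 ^ (K + 1 - lev K q B l) :=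
      Nat.pow_le_pow_right (by norm_num) (by omega)
    omega
  · rw [h] at h5
    omega
  · have : 2 ^ (K + 2 - lev K q B l) ≤ 2 ^ (K + 1 - s) :=
      Nat.pow_le_pow_right (by norm_num) (by omega)
    omega

theorem Bounded.idx_lt_of_around (H : Bounded K q B) {l : ℕ} (hl : Around K q B x s0 l) :
    idx K q B l < before K q B (2 ^ (K + 2 - s0)) := by
  rw [H.idx_lt_before_iff hl.1]
  refine (heap_lt (H.lt l hl.1.1)).trans_le (Nat.pow_le_pow_right (by norm_num) ?_)
  have := hl.2.2
  omega

/-- The bound is `before 2`, written in the shape `2 ^ (K + 2 - s)` of the loop invariant with `s =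
K + 1`; no leader has a smaller block number. -/
theorem Bounded.collected_nil (H : Bounded K q B) :
    Collected K q B x m s0 off Maj [] (before K q B (2 ^ (K + 2 - (K + 1)))) := by
  refine ⟨by simp, by simp, fun y => ?_⟩
  simp only [List.map_nil, List.not_mem_nil, false_iff, not_exists]
  rintro l ⟨h1, h2, -⟩
  rw [H.idx_lt_before_iff h1.1] at h2
  have h3 := le_heap (K := K) (q := q) (B := B) l
  have h6 := lev_le (K := K) (q := q) (B := B) l
  have : 2 ^ (K + 2 - (K + 1)) ≤ 2 ^ (K + 1 - lev K q B l) :=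
    Nat.pow_le_pow_right (by norm_num) (by omega)
  omega

/-- A frequent element of an interval has a maximal block that contains the interval. -/
theorem Bounded.exists_around (H : Bounded K q B) {y : Option α} (hy : y ≠ none) (hs0 : s0 ≤ K)
    (hm : 0 < m) (hblock : x / 2 ^ s0 = (x + (m - 1)) / 2 ^ s0)
    (hpos : 0 < Nat.count (fun k => B (x + k) = y) m)
    (hheavy : 2 ^ s0 ≤ 2 ^ q * Nat.count (fun k => B (x + k) = y) m) :
    ∃ l, Around K q B x s0 l ∧ B l = y := by
  rw [Nat.count_eq_card_filter_range] at hpos hheavy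
  obtain ⟨k, hk⟩ := Finset.card_pos.mp hpos
  rw [Finset.mem_filter, Finset.mem_range] at hk
  obtain ⟨hkm, hky⟩ := hk
  have hdiv : ∀ k < m, (x + k) / 2 ^ s0 = x / 2 ^ s0 := by
    intro k hk
    apply le_antisymm
    · rw [hblock]; exact Nat.div_le_div_right (by omega)
    · exact Nat.div_le_div_right (by omega)
  have hne : B (x + k) ≠ none := by rwa [hky]
  have hH : Heavy K q B s0 (x + k) := by
    refine hheavy.trans (Nat.mul_le_mul_left _ ?_)
    rw [← Finset.card_map (addLeftEmbedding x)]
    apply Finset.card_le_card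
    intro z hz
    obtain ⟨k', hk', rfl⟩ := Finset.mem_map.mp hz
    rw [Finset.mem_filter, Finset.mem_range] at hk'
    rw [mem_occ_iff, addLeftEmbedding_apply]
    exact ⟨H.lt _ (by rw [hk'.2]; exact hy), by rw [hdiv _ hk'.1, hdiv _ hkm], by rw [hk'.2, hky]⟩
  -- The occurrences in the interval alone make the element heavy at level `s0`; its maximal block
  -- around `x + k` is at least that large, hence contains the interval.
  have hlev : s0 ≤ lev K q B (x + k) := Nat.le_findGreatest hs0 hH
  have hlead := lead_spec (K := K) (q := q) (B := B) (x + k)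
  refine ⟨lead K q B (x + k), ⟨H.isLead_lead hne, ?_, ?_⟩, hlead.2.trans hky⟩
  · rw [heap_eq, blockAt_eq (lev_le _), H.lev_lead hne, hlead.1,
      div_two_pow_mono (hdiv k hkm) hlev]
  · rwa [H.lev_lead hne]

end

end HeavyBlocks

/-! ### The query program -/

namespace RangeMajority

open WordRAM SparseDict HeavyBlocks
open scoped Classical

universe v

/-- The rank of the value of an expression. -/
def rankAt (a : Expr) : Cmd := .block [.assign 20 a, rank]

/-- Compute the first key of the leader with the number in register `13`, count its occurrences
in the query interval, and report one of them if they are frequent. -/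
def inspect : Cmd := .block [
  .assign 16 (.bin .shl (.bin .add (.bin .shl (.lit 1) (.bin .add (.var 3) (.lit 2)))
    (.bin .add (.var 10) (.bin .shl (.bin .sub (.var 13) (.var 11))
      (.bin .sub (.var 8) (.var 4))))) (.var 4)),
  rankAt (.bin .add (.var 16) (.bin .sub (.var 1) (.var 15))),
  .assign 18 (.var 21),
  rankAt (.bin .add (.bin .add (.var 16) (.bin .sub (.var 1) (.var 15))) (.var 7)),
  .ifExpr (.bin .lt (.bin .mul (.bin .sub (.var 21) (.var 18)) (.var 6))
      (.bin .mul (.var 5) (.var 7)))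
    .skip
    (.block [
      .assign 20 (.var 18),
      select,
      .put (.bin .sub (.bin .add (.bin .sub (.var 21) (.var 16)) (.var 15)) (.var 9))]),
  .assign 13 (.bin .add (.var 13) (.lit 1))]

/-- Add the cells of the level in register `8` to register `10`. -/
def addCells : Cmd := .block [
  rankAt (.bin .shl (.bin .shl (.lit 1) (.bin .sub (.bin .add (.var 3) (.lit 2)) (.var 8)))
    (.var 4)),
  .assign 10 (.bin .add (.var 10) (.bin .shl (.bin .sub (.var 21) (.var 11))
    (.bin .sub (.var 8) (.var 4))))]

/-- Inspect all leaders of the block of level `s - 1` around the query interval, for the number `s`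
in register `8`. -/
def level : Cmd := .block [
  .assign 8 (.bin .sub (.var 8) (.lit 1)),
  rankAt (.bin .shl (.bin .shl (.lit 1) (.bin .sub (.bin .add (.var 3) (.lit 1)) (.var 8)))
    (.var 4)),
  .assign 11 (.var 21),
  .assign 12 (.bin .shr (.bin .add (.bin .shl (.lit 1) (.bin .add (.var 3) (.lit 1))) (.var 1))
    (.var 8)),
  .assign 15 (.bin .sub (.bin .shl (.var 12) (.var 8))
    (.bin .shl (.lit 1) (.bin .add (.var 3) (.lit 1)))),
  rankAt (.bin .shl (.var 12) (.var 4)),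
  .assign 13 (.var 21),
  rankAt (.bin .shl (.bin .add (.var 12) (.lit 1)) (.var 4)),
  .assign 14 (.var 21),
  .whileExpr (.bin .lt (.var 13) (.var 14)) inspect,
  addCells]

/-- Read the header, and choose the copy of the array in which the query interval does not cross
the boundary of a block. -/
def prepare : Cmd := .block [
  .assign 3 (.lit 0),
  .whileExpr (.bin .lt (.bin .shl (.lit 1) (.var 3)) (.bin .mul (.lit 12) (.var 0)))
    (.assign 3 (.bin .add (.var 3) (.lit 2))),
  .assign 4 (.rd (.lit 0) (.var 3)),
  .assign 5 (.rd (.var 3) (.var 3)),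
  .assign 6 (.rd (.bin .mul (.lit 2) (.var 3)) (.var 3)),
  .assign 19 (.rd (.bin .mul (.lit 3) (.var 3)) (.var 3)),
  .assign 7 (.bin .sub (.bin .add (.var 2) (.lit 1)) (.var 1)),
  .assign 17 (.var 4),
  .whileExpr (.bin .lt (.bin .shl (.lit 1) (.var 17)) (.bin .mul (.lit 3) (.var 7)))
    (.assign 17 (.bin .add (.var 17) (.lit 1))),
  .ifExpr (.bin .eq (.bin .shr (.var 1) (.var 17)) (.bin .shr (.var 2) (.var 17)))
    (.assign 9 (.lit 0))
    (.block [
      .assign 9 (.bin .add (.bin .shl (.lit 1) (.var 3))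
        (.bin .div (.bin .sub (.bin .shl (.lit 1) (.var 3)) (.lit 1)) (.lit 3))),
      .assign 1 (.bin .add (.var 1) (.var 9))]),
  .assign 8 (.bin .add (.var 3) (.lit 1)),
  .assign 10 (.lit 0)]

/-- The program that answers the queries. -/
def query : Cmd := .block [prepare, .whileExpr (.bin .lt (.var 17) (.var 8)) level]

variable {α : Type v} {w : ℕ} {e : List Bool} {K q : ℕ} {B : ℕ → Option α}
  {x m s0 off p d : ℕ}

/-- The encoding `e` represents `B`, and the interval of length `m` from `x` on lies in a block of
size `2 ^ s0`. -/
structure Valid {α : Type v} (w : ℕ) (e : List Bool) (K q : ℕ) (B : ℕ → Option α)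
    (x m s0 off p d : ℕ) : Prop where
  rep : Represents w e K q (Keys K q B)
  bdd : Bounded K q B
  lt : x + m ≤ 2 ^ (K + 1)
  pos : 0 < m
  m_le : m ≤ 2 ^ K
  le_s0 : q ≤ s0
  s0_le : s0 ≤ K
  p_pos : 0 < p
  p_le : p ≤ 2 ^ K
  d_le : d ≤ 2 ^ K
  off_le : off ≤ x
  block : x / 2 ^ s0 = (x + (m - 1)) / 2 ^ s0

/-- The registers that describe the query. -/
structure Regs (K q x m s0 off p d N : ℕ) (σ : ℕ → ℕ) : Prop where
  r1 : σ 1 = x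
  r3 : σ 3 = K
  r4 : σ 4 = q
  r5 : σ 5 = p
  r6 : σ 6 = d
  r7 : σ 7 = m
  r9 : σ 9 = off
  r17 : σ 17 = s0
  r19 : σ 19 = N

/-- The element `y` occurs often enough in the query interval. -/
def Freq (B : ℕ → Option α) (x m p d : ℕ) (y : Option α) : Prop :=
  p * m ≤ Nat.count (fun k => B (x + k) = y) m * d

theorem runs_assign {σ : ℕ → ℕ} {o : List ℕ} {T r : ℕ} {a : Expr} {v : ℕ}
    {Q : (ℕ → ℕ) → List ℕ → ℕ → Prop} (hwf : a.wf = true) (hok : a.ok w e σ)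
    (hv : a.val w e σ = v)
    (h : ∀ σ', σ' r = v → (∀ x, x ≠ r → σ' x = σ x) → Q σ' o (T + (a.cost + 1))) :
    Runs w e (.assign r a) σ o T Q :=
  Runs.assign hwf hok (h _ (by simp [hv]) (fun x hx => Function.update_of_ne hx _ _))

theorem runs_rankAt {S : ℕ → Prop} [DecidablePred S] (H : Represents w e K q S) {σ : ℕ → ℕ}
    {o : List ℕ} {T v : ℕ} {a : Expr} {Q : (ℕ → ℕ) → List ℕ → ℕ → Prop} (hwf : a.wf = true)
    (hcost : a.cost ≤ 20) (h3 : σ 3 = K) (h4 : σ 4 = q)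
    (h19 : σ 19 = Nat.count S (2 ^ (K + 3 + q))) (hok : a.ok w e σ) (hval : a.val w e σ = v)
    (hv : v < 2 ^ (K + 3 + q))
    (hQ : ∀ σ' T', (∀ x < 20, σ' x = σ x) → σ' 21 = Nat.count S v →
      T' ≤ T + 200 * (K + 3) + 30 → Q σ' o T') :
    Runs w e (rankAt a) σ o T Q := by
  unfold rankAt
  refine Runs.block_cons (runs_assign hwf hok hval ?_)
  intro σ1 k20 hf1
  refine Runs.block_cons (runs_rank H (by rw [hf1 3 (by decide), h3])
    (by rw [hf1 4 (by decide), h4])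
    (by rw [hf1 19 (by decide), h19]) k20 hv ?_)
  intro σ2 T2 hf2 k21 hT2
  exact Runs.block_nil (hQ _ _ (fun x hx => by rw [hf2 x (by omega), hf1 x (by omega)]) k21
    (by omega))

/-- With `u` the distance of `x` from the start of its block, the range occupies the keys from `b +
u` to `b + u + m`. Two ranks count the occurrences there, and a select finds the first. -/
theorem runs_inspect (V : Valid w e K q B x m s0 off p d) {σ : ℕ → ℕ} {o : List ℕ}
    {T s l i : ℕ} (R : Regs K q x m s0 off p d (Nat.count (Keys K q B) (2 ^ (K + 3 + q))) σ)
    (h8 : σ 8 = s) (h10 : σ 10 = cells K q B (2 ^ (K + 1 - s) * 2 ^ (K + 1)))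
    (h11 : σ 11 = before K q B (2 ^ (K + 1 - s))) (h15 : σ 15 = x / 2 ^ s * 2 ^ s)
    (h13 : σ 13 = i) (hs0 : s0 ≤ s) (hsK : s ≤ K) (hl : IsLead K q B l)
    (hheap : heap K q B l = blockAt K s x) (hi : idx K q B l = i)
    (hC : Collected K q B x m s0 off (Freq B x m p d) o i) :
    Runs w e inspect σ o T (fun σ' o' T' => σ' 13 = i + 1 ∧
      (∀ r < 20, r ≠ 13 → r ≠ 16 → r ≠ 18 → σ' r = σ r) ∧
      Collected K q B x m s0 off (Freq B x m p d) o' (i + 1) ∧ T' ≤ T + 800 * (K + 3)) := by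
  obtain ⟨b1, b2, b3, b4, b5, b6, b7, b8⟩ := V.rep.bounds
  obtain ⟨k1, k3, k4, k5, k6, k7, k9, k17, k19⟩ := R
  have hq := V.rep.le
  have hpos := V.pos
  have hlt := V.lt
  have hsq := V.le_s0
  have hK4 := V.rep.four_le
  have hw0 : 0 < w := by have := V.rep.word; omega
  have hxlt : x < 2 ^ (K + 1) := by omega
  obtain ⟨hlev, hdiv⟩ := V.bdd.lev_eq_of_heap_blockAt hl hsK hxlt hheap
  have hbase := V.bdd.base_eq hl hlev
  have hble := V.bdd.base_add_lt hl
  rw [hi] at hbase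
  rw [hlev] at hble
  have hE0 : before K q B (2 ^ (K + 1 - s)) ≤ i := by
    rw [← hi, ← not_lt, V.bdd.idx_lt_before_iff hl, hheap, not_lt]
    exact le_blockAt hsK x
  have h2s : 0 < 2 ^ s := by positivity
  have hbsx : x / 2 ^ s * 2 ^ s ≤ x := Nat.div_mul_le_self _ _
  have hblock : x / 2 ^ s = (x + (m - 1)) / 2 ^ s := div_two_pow_mono V.block hs0
  have hxm : x + m ≤ x / 2 ^ s * 2 ^ s + 2 ^ s := by
    have h1 := Nat.lt_mul_of_div_lt (Nat.lt_succ_self ((x + (m - 1)) / 2 ^ s)) h2s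
    rw [← hblock, Nat.succ_eq_add_one, add_mul, one_mul] at h1
    omega
  obtain ⟨u, hu⟩ := Nat.exists_eq_add_of_le hbsx
  have hum : u + m ≤ 2 ^ s := by omega
  have hcount := V.bdd.count_keys_add (l := l) (u := u) (m := m) (x := x) hl (by rwa [hlev])
    (by rw [hlev, hdiv]; exact hu.symm)
  have hnth := V.bdd.nth_keys (l := l) (u := u) (m := m) (x := x) hl (by rwa [hlev])
    (by rw [hlev, hdiv]; exact hu.symm)
  have hpow : 2 ^ (K + 3 + q) = 8 * (2 ^ K * 2 ^ q) := by rw [pow_add, pow_add]; ring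
  have hZQ : 0 < 2 ^ K * 2 ^ q := by positivity
  have hcm : Nat.count (fun k => B (x + k) = B l) m ≤ m := Nat.count_le _
  have hmd : Nat.count (fun k => B (x + k) = B l) m * d ≤ 2 ^ (5 * K) := by
    calc _ ≤ 2 ^ K * 2 ^ K := Nat.mul_le_mul (hcm.trans V.m_le) V.d_le
      _ ≤ _ := by rw [← pow_add]; exact Nat.pow_le_pow_right (by norm_num) (by omega)
  have hpm : p * m ≤ 2 ^ (5 * K) := by
    calc _ ≤ 2 ^ K * 2 ^ K := Nat.mul_le_mul V.p_le V.m_le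
      _ ≤ _ := by rw [← pow_add]; exact Nat.pow_le_pow_right (by norm_num) (by omega)
  have hpl := V.p_le
  have hdl := V.d_le
  have hml := V.m_le
  have hN := b8
  have hrb : ∀ v, Nat.count (Keys K q B) v ≤ 2 ^ (5 * K) := fun v => by
    have h1 := V.bdd.count_keys_le v
    omega
  have hq1 : 0 < 2 ^ q := by positivity
  generalize hY : (i - before K q B (2 ^ (K + 1 - s))) * 2 ^ (s - q) = Y at hbase
  generalize hX : cells K q B (2 ^ (K + 1 - s) * 2 ^ (K + 1)) = X at hbase h10
  generalize hP : 2 ^ (K + 2) = P at hbase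
  generalize hE : before K q B (2 ^ (K + 1 - s)) = E at h11 hE0 hY
  generalize base K q B l = b at hbase hble hcount hnth
  have hinner := Nat.le_mul_of_pos_right (P + (X + Y)) hq1
  rw [← hbase] at hinner
  have hile : i ≤ 2 ^ (5 * K) := by
    have h1 := V.bdd.count_keys_heap (b := blockAt K s x) (by
      exact (blockAt_lt hsK hxlt).le.trans (Nat.pow_le_pow_right (by norm_num) (by omega)))
    have h2 := (V.bdd.idx_lt_before_iff (b := heap K q B l + 1) hl).mpr (Nat.lt_succ_self _)
    rw [hheap, hi, before, ← V.bdd.count_keys_heap (by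
      refine (show blockAt K s x + 1 ≤ 2 ^ (K + 2 - s) from blockAt_lt hsK hxlt).trans ?_
      exact Nat.pow_le_pow_right (by norm_num) (by omega))] at h2
    exact h2.le.trans (hrb _)
  unfold inspect
  refine Runs.block_cons (runs_assign (v := b) rfl ?_ ?_ ?_)
  · simp only [Expr.ok, Expr.val, BinOp.safe, BinOp.nat, k3, k4, h8, h10, h11, h13, one_mul,
      hY, hP, ← hbase]
    constructorm* _ ∧ _ <;> omega
  · simp only [Expr.val, BinOp.nat, k3, k4, h8, h10, h11, h13, one_mul, hY, hP, ← hbase]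
  intro σ1 v16 f1
  refine Runs.block_cons (runs_rankAt V.rep (v := b + u) rfl (by decide) (by simp [f1, k3])
    (by simp [f1, k4]) (by simp [f1, k19]) ?_ ?_ (by omega) ?_)
  · simp [Expr.ok, Expr.val, BinOp.safe, BinOp.nat, v16, f1, k1, h15]
    constructorm* _ ∧ _ <;> omega
  · simp [Expr.val, BinOp.nat, v16, f1, k1, h15]
    omega
  intro σ2 T2 f2 v21 hT2
  refine Runs.block_cons (runs_assign (v := Nat.count (Keys K q B) (b + u)) rfl ?_ v21 ?_)
  · simp only [Expr.ok, v21]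
    have := hrb (b + u)
    omega
  intro σ3 v18 f3
  refine Runs.block_cons (runs_rankAt V.rep (v := b + u + m) rfl (by decide)
    (by simp [f1, f2, f3, k3]) (by simp [f1, f2, f3, k4]) (by simp [f1, f2, f3, k19]) ?_ ?_
    (by omega) ?_)
  · simp [Expr.ok, Expr.val, BinOp.safe, BinOp.nat, v16, f1, f2, f3, k1, h15, k7]
    constructorm* _ ∧ _ <;> omega
  · simp [Expr.val, BinOp.nat, v16, f1, f2, f3, k1, h15, k7]
    omega
  intro σ4 T4 f4 v21' hT4
  have w18 : σ4 18 = Nat.count (Keys K q B) (b + u) := by simp [f4, v18]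
  have hr1 := hrb (b + u)
  have hr2 := hrb (b + u + m)
  have hdiff : Nat.count (Keys K q B) (b + u + m) - Nat.count (Keys K q B) (b + u) =
      Nat.count (fun k => B (x + k) = B l) m := by omega
  have w6 : σ4 6 = d := by simp [f1, f2, f3, f4, k6]
  have w5 : σ4 5 = p := by simp [f1, f2, f3, f4, k5]
  have w7 : σ4 7 = m := by simp [f1, f2, f3, f4, k7]
  have hval : Expr.val w e σ4 (.bin .lt (.bin .mul (.bin .sub (.var 21) (.var 18)) (.var 6))
      (.bin .mul (.var 5) (.var 7))) = 0 ↔ Freq B x m p d (B l) := by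
    simp only [Expr.val, BinOp.nat, v21', w18, w6, w5, w7, hdiff, ltNat_eq_zero, not_lt, Freq]
  have fin : ∀ σ5 o5 T5, (∀ r < 20, σ5 r = σ4 r) →
      Collected K q B x m s0 off (Freq B x m p d) o5 (i + 1) → T5 ≤ T + 700 * (K + 3) →
      Runs w e (.block [.assign 13 (.bin .add (.var 13) (.lit 1))]) σ5 o5 T5
        (fun σ' o' T' => σ' 13 = i + 1 ∧
        (∀ r < 20, r ≠ 13 → r ≠ 16 → r ≠ 18 → σ' r = σ r) ∧
        Collected K q B x m s0 off (Freq B x m p d) o' (i + 1) ∧ T' ≤ T + 800 * (K + 3)) := by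
    intro σ5 o5 T5 f5 hC5 hT5
    have w13 : σ5 13 = i := by simp [f1, f2, f3, f4, f5, h13]
    refine Runs.block_cons (runs_assign (v := i + 1) rfl ?_ ?_ ?_)
    · simp only [Expr.ok, Expr.val, BinOp.safe, w13]
      constructorm* _ ∧ _ <;> omega
    · simp only [Expr.val, BinOp.nat, w13]
    intro σ6 v13 f6
    refine Runs.block_nil ⟨v13, ?_, hC5, ?_⟩
    · intro r hr h1 h2 h3
      rw [f6 r h1, f5 r hr, f4 r hr, f3 r h3, f2 r hr, f1 r h2]
    · simp only [Expr.cost]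
      omega
  simp only [Expr.cost] at hT2 hT4
  refine Runs.block_cons (Runs.ifExpr rfl ?_ ?_ ?_)
  · simp only [Expr.ok, Expr.val, BinOp.safe, BinOp.nat, v21', w18, w6, w5, w7, hdiff]
    constructorm* _ ∧ _ <;> omega
  · intro hnz
    refine Runs.skip (fin _ _ _ (fun _ _ => rfl) ?_ ?_)
    · exact hC.skip V.bdd hl hi (fun h => hnz (hval.mpr h))
    · simp only [Expr.cost]
      omega
  · intro hz
    have hF := hval.mp hz
    -- Since `p * m > 0`, an element that passes the test does occur in the range, so the select is
    -- legitimate.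
    have hcpos : 0 < Nat.count (fun k => B (x + k) = B l) m := by
      by_contra h0
      have h1 : Nat.count (fun k => B (x + k) = B l) m = 0 := by omega
      rw [Freq, h1, zero_mul] at hF
      exact absurd (Nat.mul_pos V.p_pos V.pos) (by omega)
    obtain ⟨k, hkm, hkB, hk⟩ := hnth hcpos
    have hoff := V.off_le
    have hlast : Nat.count (Keys K q B) (b + u) < Nat.count (Keys K q B) (2 ^ (K + 3 + q)) := by
      have := Nat.count_monotone (Keys K q B) (show b + u + m ≤ 2 ^ (K + 3 + q) by omega)
      omega
    refine Runs.block_cons (runs_assign (v := Nat.count (Keys K q B) (b + u)) rfl ?_ w18 ?_)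
    · simp only [Expr.ok, w18]
      omega
    intro σ5 v20 f5
    refine Runs.block_cons (runs_select V.rep (by simp [f1, f2, f3, f4, f5, k3])
      (by simp [f1, f2, f3, f4, f5, k4]) (by simp [f1, f2, f3, f4, f5, k19]) v20 hlast ?_)
    intro σ6 T6 f6 v21s hT6
    have y15 : σ6 15 = x / 2 ^ s * 2 ^ s := by simp [f1, f2, f3, f4, f5, f6, h15]
    have y16 : σ6 16 = b := by simp [f2, f3, f4, f5, f6, v16]
    have y9 : σ6 9 = off := by simp [f1, f2, f3, f4, f5, f6, k9]
    rw [hk] at v21s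
    refine Runs.block_cons (Runs.put rfl ?_ ?_)
    · simp only [Expr.ok, Expr.val, BinOp.safe, BinOp.nat, v21s, y15, y16, y9]
      constructorm* _ ∧ _ <;> omega
    · have hv : Expr.val w e σ6 (.bin .sub (.bin .add (.bin .sub (.var 21) (.var 16)) (.var 15))
          (.var 9)) = x + k - off := by
        simp only [Expr.val, BinOp.nat, v21s, y15, y16, y9]
        omega
      rw [hv]
      refine Runs.block_nil (fin _ _ _ ?_ ?_ ?_)
      · intro r hr
        rw [f6 r (by omega), f5 r (by omega)]
      · refine hC.push V.bdd hxlt ⟨hl, by rw [hlev]; exact hheap, by rw [hlev]; exact hs0⟩ hi hF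
          (by omega) (by omega) ?_
        rw [show x + k - off + off = x + k by omega]
        exact hkB
      · simp only [Expr.cost] at hT6 ⊢
        omega

theorem runs_addCells (V : Valid w e K q B x m s0 off p d) {σ : ℕ → ℕ} {o : List ℕ}
    {T s : ℕ} (R : Regs K q x m s0 off p d (Nat.count (Keys K q B) (2 ^ (K + 3 + q))) σ)
    (h8 : σ 8 = s) (h10 : σ 10 = cells K q B (2 ^ (K + 1 - s) * 2 ^ (K + 1)))
    (h11 : σ 11 = before K q B (2 ^ (K + 1 - s))) (hqs : q ≤ s) (hsK : s ≤ K) :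
    Runs w e addCells σ o T (fun σ' o' T' => o' = o ∧ (∀ r < 20, r ≠ 10 → σ' r = σ r) ∧
      σ' 10 = cells K q B (2 ^ (K + 2 - s) * 2 ^ (K + 1)) ∧ T' ≤ T + 200 * (K + 3) + 60) := by
  obtain ⟨b1, b2, b3, b4, b5, b6, -, -⟩ := V.rep.bounds
  obtain ⟨-, k3, k4, -, -, -, -, -, k19⟩ := R
  have hq1 : 0 < 2 ^ q := by positivity
  have hppow : 2 ^ (K + 1 - s) ≤ 2 ^ (K + 2 - s) := Nat.pow_le_pow_right (by norm_num) (by omega)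
  have hpp := Nat.mul_le_mul_right (2 ^ (K + 1)) hppow
  have hcells := Bounded.cells_level (K := K) (q := q) (B := B) (s := s) (by omega)
    (2 ^ (K + 2 - s) * 2 ^ (K + 1) - 2 ^ (K + 1 - s) * 2 ^ (K + 1))
  rw [Nat.add_sub_cancel' hpp] at hcells
  replace hcells := hcells le_rfl
  change _ = _ + (before K q B _ - before K q B _) * _ at hcells
  have hcle := (V.bdd.cells_le (2 ^ (K + 2 - s) * 2 ^ (K + 1))).trans_eq (pow_succ 2 K)
  have hbm := before_mono (K := K) (q := q) (B := B) hppow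
  have hcount : Nat.count (Keys K q B) (2 ^ (K + 2 - s) * 2 ^ q) =
      before K q B (2 ^ (K + 2 - s)) := by
    rw [V.bdd.count_keys_heap (Nat.pow_le_pow_right (by norm_num) (by omega)), before]
  have hb := V.bdd.count_keys_le (2 ^ (K + 2 - s) * 2 ^ q)
  rw [hcount] at hb
  have hlt : 2 ^ (K + 2 - s) * 2 ^ q < 2 ^ (K + 3 + q) := by
    rw [← pow_add]
    exact Nat.pow_lt_pow_right (by norm_num) (by omega)
  have hle := Nat.le_mul_of_pos_right (2 ^ (K + 2 - s)) hq1
  generalize hg1 : 2 ^ (K + 2 - s) * 2 ^ q = g1 at *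
  generalize hX : cells K q B (2 ^ (K + 2 - s) * 2 ^ (K + 1)) = X at *
  generalize cells K q B (2 ^ (K + 1 - s) * 2 ^ (K + 1)) = X0 at *
  generalize hE : before K q B (2 ^ (K + 2 - s)) = E at *
  generalize before K q B (2 ^ (K + 1 - s)) = E0 at *
  have hy : 0 < 2 ^ (s - q) := by positivity
  have hle2 : E - E0 ≤ (E - E0) * 2 ^ (s - q) := Nat.le_mul_of_pos_right _ hy
  have hpE : 2 ^ (s - q) ≤ 2 ^ K := Nat.pow_le_pow_right (by norm_num) (by omega)
  generalize hY : (E - E0) * 2 ^ (s - q) = Y at *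
  generalize hP : 2 ^ (K + 2 - s) = P at *
  unfold addCells
  refine Runs.block_cons (runs_rankAt V.rep (v := g1) rfl (by decide) k3 k4 k19 ?_ ?_ hlt ?_)
  · simp only [Expr.ok, Expr.val, BinOp.safe, BinOp.nat, h8, k3, k4, one_mul, hP, hg1]
    constructorm* _ ∧ _ <;> first | trivial | omega
  · simp only [Expr.val, BinOp.nat, h8, k3, k4, one_mul, hP, hg1]
  intro σ1 T1 f1 v1 hT1
  rw [hcount] at v1
  have w10 : σ1 10 = X0 := by rw [f1 10 (by decide), h10]
  have w11 : σ1 11 = E0 := by rw [f1 11 (by decide), h11]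
  have w8 : σ1 8 = s := by rw [f1 8 (by decide), h8]
  have w4 : σ1 4 = q := by rw [f1 4 (by decide), k4]
  refine Runs.block_cons (runs_assign (v := X) rfl ?_ ?_ ?_)
  · simp only [Expr.ok, Expr.val, BinOp.safe, BinOp.nat, v1, w10, w11, w8, w4, hY]
    constructorm* _ ∧ _ <;> first | trivial | omega
  · simp only [Expr.val, BinOp.nat, v1, w10, w11, w8, w4, hY, hcells]
  intro σ2 v2 f2
  refine Runs.block_nil ⟨rfl, fun r hr h => by rw [f2 r h, f1 r hr], v2, ?_⟩
  simp only [Expr.cost] at hT1 ⊢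
  omega

/-- Apart from the loop over the leaders of one block, a level needs a constant number of ranks; the
loop is the source of the factor `2 ^ q`. -/
theorem runs_level (V : Valid w e K q B x m s0 off p d) {σ : ℕ → ℕ} {o : List ℕ}
    {T s : ℕ} (R : Regs K q x m s0 off p d (Nat.count (Keys K q B) (2 ^ (K + 3 + q))) σ)
    (h8 : σ 8 = s + 1) (h10 : σ 10 = cells K q B (2 ^ (K + 1 - s) * 2 ^ (K + 1)))
    (hs0 : s0 ≤ s) (hsK : s ≤ K)
    (hC : Collected K q B x m s0 off (Freq B x m p d) o (before K q B (2 ^ (K + 1 - s)))) :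
    Runs w e level σ o T (fun σ' o' T' =>
      Regs K q x m s0 off p d (Nat.count (Keys K q B) (2 ^ (K + 3 + q))) σ' ∧ σ' 8 = s ∧
      σ' 10 = cells K q B (2 ^ (K + 2 - s) * 2 ^ (K + 1)) ∧
      Collected K q B x m s0 off (Freq B x m p d) o' (before K q B (2 ^ (K + 2 - s))) ∧
      T' ≤ T + (2 ^ q + 2) * (1000 * (K + 3))) := by
  obtain ⟨b1, b2, b3, b4, b5, b6, b7, b8⟩ := V.rep.bounds
  obtain ⟨k1, k3, k4, k5, k6, k7, k9, k17, k19⟩ := R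
  have hq := V.rep.le
  have hpos := V.pos
  have hlt := V.lt
  have hsq := V.le_s0
  have hK4 := V.rep.four_le
  have hw0 : 0 < w := by have := V.rep.word; omega
  have hxlt : x < 2 ^ (K + 1) := by omega
  have hq1 : 0 < 2 ^ q := by positivity
  have hrb : ∀ v, Nat.count (Keys K q B) v ≤ 2 ^ (5 * K) := fun v => by
    have h1 := V.bdd.count_keys_le v
    omega
  have hpow2 : ∀ {a : ℕ}, a ≤ K + 2 → 2 ^ a ≤ 4 * 2 ^ K := fun {a} ha =>
    (Nat.pow_le_pow_right (by norm_num) ha).trans (by rw [pow_add]; omega)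
  have hpow : 2 ^ (K + 3 + q) = 8 * 2 ^ K * 2 ^ q := by rw [pow_add, pow_add]; ring
  -- the rank of the number of a block
  have hblk : ∀ a, a ≤ 4 * 2 ^ K → a * 2 ^ q < 2 ^ (K + 3 + q) ∧
      Nat.count (Keys K q B) (a * 2 ^ q) = before K q B a := by
    intro a ha
    constructor
    · rw [hpow]
      exact Nat.mul_lt_mul_of_pos_right (by omega) hq1
    · rw [V.bdd.count_keys_heap (by rw [pow_add]; omega), before]
  have hbef : ∀ a, a ≤ 4 * 2 ^ K → before K q B a ≤ 2 ^ (5 * K) := fun a ha => by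
    rw [← (hblk a ha).2]; exact hrb _
  have hle : ∀ a, a ≤ a * 2 ^ q := fun a => Nat.le_mul_of_pos_right a hq1
  have c1 := hpow2 (show K + 1 - s ≤ K + 2 by omega)
  have c2 := hpow2 (show K + 2 - s ≤ K + 2 by omega)
  have c3 := le_blockAt hsK x
  have c4 := blockAt_lt hsK hxlt
  have c5 := blockAt_mul (x := x) hsK
  have c6 : x / 2 ^ s * 2 ^ s ≤ x := Nat.div_mul_le_self _ _
  have c7 : 2 ^ (K + 1) = 2 * 2 ^ K := by rw [pow_succ, mul_comm]
  unfold level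
  refine Runs.block_cons (runs_assign (v := s) rfl ?_ ?_ ?_)
  · simp only [Expr.ok, Expr.val, BinOp.safe, h8]
    constructorm* _ ∧ _ <;> omega
  · simp [Expr.val, BinOp.nat, h8]
  intro σ1 v8 f1
  refine Runs.block_cons (runs_rankAt V.rep (v := 2 ^ (K + 1 - s) * 2 ^ q) rfl (by decide)
    (by simp [f1, k3]) (by simp [f1, k4]) (by simp [f1, k19]) ?_ ?_ (hblk _ c1).1 ?_)
  · have := (hblk _ c1).1
    have := hle (2 ^ (K + 1 - s))
    simp [Expr.ok, Expr.val, BinOp.safe, BinOp.nat, v8, f1, k3, k4]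
    constructorm* _ ∧ _ <;> omega
  · simp [Expr.val, BinOp.nat, v8, f1, k3, k4]
  intro σ2 T2 f2 v21 hT2
  rw [(hblk _ c1).2] at v21
  refine Runs.block_cons (runs_assign rfl ?_ v21 ?_)
  · have := hbef _ c1
    simp only [Expr.ok, v21]
    omega
  intro σ3 v11 f3
  refine Runs.block_cons (runs_assign (v := blockAt K s x) rfl ?_ ?_ ?_)
  · simp [Expr.ok, Expr.val, BinOp.safe, BinOp.nat, v8, f1, f2, f3, k3, k1]
    constructorm* _ ∧ _ <;> omega
  · simp [Expr.val, BinOp.nat, v8, f1, f2, f3, k3, k1, blockAt]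
  intro σ4 v12 f4
  refine Runs.block_cons (runs_assign (v := x / 2 ^ s * 2 ^ s) rfl ?_ ?_ ?_)
  · simp [Expr.ok, Expr.val, BinOp.safe, BinOp.nat, v8, v12, f1, f2, f3, f4, k3, c5]
    constructorm* _ ∧ _ <;> omega
  · simp [Expr.val, BinOp.nat, v8, v12, f1, f2, f3, f4, k3, c5]
  intro σ5 v15 f5
  refine Runs.block_cons (runs_rankAt V.rep (v := blockAt K s x * 2 ^ q) rfl (by decide)
    (by simp [f1, f2, f3, f4, f5, k3]) (by simp [f1, f2, f3, f4, f5, k4])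
    (by simp [f1, f2, f3, f4, f5, k19]) ?_ ?_ (hblk _ (by omega)).1 ?_)
  · have := (hblk (blockAt K s x) (by omega)).1
    simp [Expr.ok, Expr.val, BinOp.safe, v12, f1, f2, f3, f4, f5, k4]
    constructorm* _ ∧ _ <;> omega
  · simp [Expr.val, BinOp.nat, v12, f1, f2, f3, f4, f5, k4]
  intro σ6 T6 f6 v21b hT6
  rw [(hblk _ (by omega)).2] at v21b
  refine Runs.block_cons (runs_assign rfl ?_ v21b ?_)
  · have := hbef (blockAt K s x) (by omega)
    simp only [Expr.ok, v21b]
    omega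
  intro σ7 v13 f7
  refine Runs.block_cons (runs_rankAt V.rep (v := (blockAt K s x + 1) * 2 ^ q) rfl (by decide)
    (by simp [f1, f2, f3, f4, f5, f6, f7, k3]) (by simp [f1, f2, f3, f4, f5, f6, f7, k4])
    (by simp [f1, f2, f3, f4, f5, f6, f7, k19]) ?_ ?_ (hblk _ (by omega)).1 ?_)
  · have := (hblk (blockAt K s x + 1) (by omega)).1
    simp [Expr.ok, Expr.val, BinOp.safe, BinOp.nat, v12, f1, f2, f3, f4, f5, f6, f7, k4]
    constructorm* _ ∧ _ <;> omega
  · simp [Expr.val, BinOp.nat, v12, f1, f2, f3, f4, f5, f6, f7, k4]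
  intro σ8 T8 f8 v21c hT8
  rw [(hblk _ (by omega)).2] at v21c
  refine Runs.block_cons (runs_assign rfl ?_ v21c ?_)
  · have := hbef (blockAt K s x + 1) (by omega)
    simp only [Expr.ok, v21c]
    omega
  intro σ9 v14 f9
  simp only [Expr.cost] at hT2 hT6 hT8
  -- The counter of a block occupies `2 ^ q` numbers, so the rank grows by at most `2 ^ q` across
  -- it.
  have hiter : before K q B (blockAt K s x + 1) - before K q B (blockAt K s x) ≤ 2 ^ q := by
    have := count_sub_count_le (Keys K q B) (blockAt K s x * 2 ^ q) ((blockAt K s x + 1) * 2 ^ q)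
    rwa [(hblk _ (by omega)).2, (hblk _ (by omega)).2, ← Nat.sub_mul, Nat.add_sub_cancel_left,
      one_mul] at this
  have hmono := before_mono (K := K) (q := q) (B := B)
    (show blockAt K s x ≤ blockAt K s x + 1 by omega)
  have hE1 := hbef (blockAt K s x + 1) (by omega)
  have R9 : Regs K q x m s0 off p d (Nat.count (Keys K q B) (2 ^ (K + 3 + q))) σ9 := by
    constructor <;> simp [*]
  have u8 : σ9 8 = s := by simp [f2, f3, f4, f5, f6, f7, f8, f9, v8]
  have u10 : σ9 10 = cells K q B (2 ^ (K + 1 - s) * 2 ^ (K + 1)) := by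
    simp [f1, f2, f3, f4, f5, f6, f7, f8, f9, h10]
  have u11 : σ9 11 = before K q B (2 ^ (K + 1 - s)) := by
    simp [f4, f5, f6, f7, f8, f9, v11]
  have u15 : σ9 15 = x / 2 ^ s * 2 ^ s := by simp [f6, f7, f8, f9, v15]
  have u13 : σ9 13 = before K q B (blockAt K s x) := by simp [f8, f9, v13]
  have hT9 : T8 + ((Expr.var 21).cost + 1) ≤ T + 700 * (K + 3) := by
    simp only [Expr.cost]
    omega
  generalize T8 + ((Expr.var 21).cost + 1) = T9 at hT9
  refine Runs.block_cons (Runs.whileExpr rfl (fun k σ' o' T' =>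
    ∃ i, σ' 13 = i ∧ i + k = before K q B (blockAt K s x + 1) ∧ before K q B (blockAt K s x) ≤ i ∧
      (∀ r < 20, r ≠ 13 → r ≠ 16 → r ≠ 18 → σ' r = σ9 r) ∧
      Collected K q B x m s0 off (Freq B x m p d) o' i ∧
      T' + k * (900 * (K + 3)) ≤ T9 + 2 ^ q * (900 * (K + 3)))
    (before K q B (blockAt K s x + 1) - before K q B (blockAt K s x)) ?_ ?_)
  · rintro k σ' o' T' ⟨i, t13, hik, hbi, ft, hC', hT'⟩
    have t14 : σ' 14 = before K q B (blockAt K s x + 1) := by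
      rw [ft 14 (by decide) (by decide) (by decide) (by decide), v14]
    have R' : Regs K q x m s0 off p d (Nat.count (Keys K q B) (2 ^ (K + 3 + q))) σ' := by
      obtain ⟨g1, g3, g4, g5, g6, g7, g9, g17, g19⟩ := R9
      constructor <;> simp [*]
    refine ⟨?_, ?_, ?_⟩
    · simp only [Expr.ok, BinOp.safe, t13, t14]
      omega
    · intro h0
      simp only [Expr.val, BinOp.nat, t13, t14, ltNat_eq_zero, not_lt] at h0
      obtain rfl : k = 0 := by omega
      have hi : i = before K q B (blockAt K s x + 1) := by omega
      subst hi
      refine Runs.block_cons ((runs_addCells V R' (by simp [ft, u8]) (by simp [ft, u10])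
        (by simp [ft, u11]) (hsq.trans hs0) hsK).mono ?_)
      rintro σa oa Ta ⟨rfl, fa, va, hTa⟩
      refine Runs.block_nil ⟨?_, ?_, va, ?_, ?_⟩
      · obtain ⟨g1, g3, g4, g5, g6, g7, g9, g17, g19⟩ := R'
        constructor <;> (rw [fa _ (by decide) (by decide)]; assumption)
      · simp [fa, ft, u8]
      · exact hC'.congr (fun l hl => (V.bdd.idx_lt_level_iff hsK hxlt hl).2)
      · simp only [Expr.cost] at hTa ⊢
        clear * - hTa hT' hT9
        have := Nat.mul_le_mul_left (2 ^ q)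
          (Nat.mul_le_mul_right (K + 3) (show 900 ≤ 1000 by norm_num))
        rw [add_mul]
        linarith
    · intro h0
      simp only [Expr.val, BinOp.nat, t13, t14, ne_eq, ltNat_eq_zero, not_not] at h0
      obtain ⟨k', rfl⟩ := Nat.exists_eq_add_one.mpr (show 0 < k by clear * - hik h0; omega)
      refine ⟨k', rfl, ?_⟩
      obtain ⟨l, hl, hheap, hidx⟩ := V.bdd.exists_idx_eq hbi h0
      refine (runs_inspect V R' (by simp [ft, u8]) (by simp [ft, u10]) (by simp [ft, u11])
        (by simp [ft, u15]) t13 hs0 hsK hl hheap hidx hC').mono ?_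
      rintro σa oa Ta ⟨va, fa, hCa, hTa⟩
      refine ⟨i + 1, va, by rw [← hik]; ring, hbi.trans (Nat.le_succ i), ?_, hCa, ?_⟩
      · intro r hr h1 h2 h3
        rw [fa r hr h1 h2 h3, ft r hr h1 h2 h3]
      · simp only [Expr.cost] at hTa
        rw [add_mul] at hT'
        clear * - hTa hT'
        omega
  · refine ⟨_, u13, by omega, le_rfl, fun r _ _ _ _ => rfl, ?_, ?_⟩
    · exact hC.congr (fun l hl => (V.bdd.idx_lt_level_iff hsK hxlt hl).1)
    · exact Nat.add_le_add_left (Nat.mul_le_mul_right _ hiter) _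

end RangeMajority

/-! ### Choosing the level and the copy for a query -/

namespace RangeMajority

open WordRAM SparseDict HeavyBlocks
open scoped Classical

universe v

/-- The distance between the two copies of the array. -/
def shift (K : ℕ) : ℕ := 2 ^ K + (2 ^ K - 1) / 3

/-- Powers of `4` are `1` modulo `3`, which is why `K` is kept even. -/
theorem three_dvd (t : ℕ) : 3 * ((2 ^ (2 * t) - 1) / 3) + 1 = 2 ^ (2 * t) := by
  have h1 : 2 ^ (2 * t) % 3 = 1 := by
    rw [pow_mul, Nat.pow_mod]; simp
  generalize 2 ^ (2 * t) = z at *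
  omega

/-- An interval that crosses a block boundary does not cross one after the shift. -/
theorem shift_block {t s i m : ℕ} (hs : s ≤ 2 * t) (hm : 3 * m ≤ 2 ^ s) (hpos : 0 < m)
    (hne : i / 2 ^ s ≠ (i + (m - 1)) / 2 ^ s) :
    (i + shift (2 * t)) / 2 ^ s = (i + shift (2 * t) + (m - 1)) / 2 ^ s := by
  have h1 := three_dvd t
  rw [shift]
  obtain ⟨c, hc⟩ := Nat.exists_eq_add_of_le hs
  have h2 : 2 ^ (2 * t) = 2 ^ s * 2 ^ c := by rw [← pow_add, ← hc]
  generalize (2 ^ (2 * t) - 1) / 3 = r0 at *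
  have hP : 0 < 2 ^ s := by positivity
  rw [h2] at h1 ⊢
  generalize 2 ^ c = g at *
  generalize 2 ^ s = P at *
  -- residues modulo the block size
  have hr := Nat.div_add_mod r0 P
  have hrl := Nat.mod_lt r0 hP
  have hi := Nat.div_add_mod i P
  have hil := Nat.mod_lt i hP
  generalize r0 / P = b at *
  generalize r0 % P = r at *
  generalize hiP : i / P = a at *
  generalize i % P = y at *
  have hcross : P ≤ y + (m - 1) := by
    by_contra hlt
    apply hne
    symm
    apply Nat.div_eq_of_lt_le
    · rw [mul_comm]; omega
    · rw [add_mul, mul_comm a P]; omega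
  -- As `3 * r0 + 1` is a multiple of `P`, the displacement is about one or two thirds of `P` modulo
  -- `P`.
  have hres : 3 * r + 1 = P ∨ 3 * r + 1 = 2 * P := by
    have hd : P ∣ 3 * r + 1 := by
      have : P * g = P * (3 * b) + (3 * r + 1) := by
        rw [← h1, ← hr]; ring
      exact (Nat.dvd_add_right (Dvd.intro _ rfl)).mp (this ▸ Dvd.intro g rfl)
    obtain ⟨z, hz⟩ := hd
    have hz1 : z < 3 := by
      by_contra h
      have := Nat.mul_le_mul_left P (show 3 ≤ z by omega)
      omega
    have hz0 : z ≠ 0 := by rintro rfl; omega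
    have : z = 1 ∨ z = 2 := by omega
    rcases this with rfl | rfl
    · left; omega
    · right; omega
  -- An interval that crosses a boundary starts and ends less than `m ≤ P / 3` away from it, so both
  -- ends are moved past the boundary and stay before the next one.
  have e1 : (i + (P * g + r0)) / P = a + g + b + 1 := by
    apply Nat.div_eq_of_lt_le
    · have : (a + g + b + 1) * P = P * a + P * g + P * b + P := by ring
      omega
    · have : (a + g + b + 1 + 1) * P = P * a + P * g + P * b + P + P := by ring
      omega
  have e2 : (i + (P * g + r0) + (m - 1)) / P = a + g + b + 1 := by
    apply Nat.div_eq_of_lt_le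
    · have : (a + g + b + 1) * P = P * a + P * g + P * b + P := by ring
      omega
    · have : (a + g + b + 1 + 1) * P = P * a + P * g + P * b + P + P := by ring
      omega
  rw [e1, e2]

/-- The level at which a query starts. -/
structure StartLevel (K q m s0 : ℕ) : Prop where
  le : q ≤ s0
  le_top : s0 ≤ K
  large : 3 * m ≤ 2 ^ s0
  small : s0 = q ∨ 2 ^ s0 < 6 * m

/-- The header has fields of width `K`, so `K` must first be recomputed from `n`: trying even
numbers until `2 ^ K ≥ 12 n` gives the same value as `2 * Nat.clog 4 (12 * n)`. -/
theorem runs_prepare {w : ℕ} {e : List Bool} {n i j q p d N t : ℕ} {σ : ℕ → ℕ} {o : List ℕ}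
    (ht : t = Nat.clog 4 (12 * n)) (hw : 10 * (2 * t) ≤ w) (hq : q ≤ 2 * t) (h0 : σ 0 = n)
    (h1 : σ 1 = i) (h2 : σ 2 = j) (hij : i ≤ j) (hj : j < n)
    (e1 : readBits w e 0 (2 * t) = q) (e2 : readBits w e (2 * t) (2 * t) = p)
    (e3 : readBits w e (2 * (2 * t)) (2 * t) = d) (e4 : readBits w e (3 * (2 * t)) (2 * t) = N) :
    Runs w e prepare σ o 0 (fun σ' o' T' => o' = o ∧ T' ≤ 50 * (2 * t) + 100 ∧ ∃ s0 off,
      StartLevel (2 * t) q (j + 1 - i) s0 ∧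
      (off = 0 ∧ i / 2 ^ s0 = j / 2 ^ s0 ∨
        off = shift (2 * t) ∧ i / 2 ^ s0 ≠ j / 2 ^ s0) ∧
      Regs (2 * t) q (i + off) (j + 1 - i) s0 off p d N σ' ∧ σ' 8 = 2 * t + 1 ∧ σ' 10 = 0) := by
  have hn : 12 * n ≤ 2 ^ (2 * t) := by
    rw [pow_mul, ht]
    exact Nat.le_pow_clog (by norm_num) _
  have hKlt : 2 * t < 2 ^ (2 * t) := Nat.lt_two_pow_self
  have ht1 : 0 < t := by
    rcases Nat.eq_zero_or_pos t with rfl | h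
    · simp at hn; omega
    · exact h
  have hw0 : w ≠ 0 := by omega
  have hwK : 16 * 2 ^ (2 * t) ≤ 2 ^ w := by
    rw [show (16 : ℕ) = 2 ^ 4 by norm_num, ← pow_add]
    exact Nat.pow_le_pow_right (by norm_num) (by omega)
  unfold prepare
  refine Runs.block_cons (runs_assign (v := 0) rfl ?_ rfl ?_)
  · simp [Expr.ok]
  intro σ1 v3 f1
  refine Runs.block_cons (Runs.whileExpr rfl (fun k σ' o' T' => o' = o ∧ ∃ u, u + k = t ∧
    σ' 3 = 2 * u ∧ (∀ r < 3, σ' r = σ r) ∧ T' + 20 * k ≤ 20 * t + 2) t ?_ ?_)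
  swap
  · exact ⟨rfl, 0, by omega, v3, fun r hr => f1 r (by omega), by simp only [Expr.cost]; omega⟩
  rintro k σ2 o2 T2 ⟨rfl, u, hu, w3, f2, hT2⟩
  have w0 : σ2 0 = n := by rw [f2 0 (by decide), h0]
  have hup : 2 ^ (2 * u) ≤ 2 ^ (2 * t) := Nat.pow_le_pow_right (by norm_num) (by omega)
  have hcond : Expr.val w e σ2 (.bin .lt (.bin .shl (.lit 1) (.var 3))
      (.bin .mul (.lit 12) (.var 0))) = 0 ↔ k = 0 := by
    simp only [Expr.val, BinOp.nat, w3, w0, one_mul, ltNat_eq_zero]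
    rw [pow_mul, show 2 ^ 2 = 4 by norm_num, ← Nat.lt_clog_iff_pow_lt (by norm_num), ← ht]
    omega
  refine ⟨?_, ?_, ?_⟩
  · simp [Expr.ok, Expr.val, BinOp.safe, w3, w0]
    constructorm* _ ∧ _ <;> omega
  swap
  · intro hnz
    have hk : k ≠ 0 := fun h => hnz (hcond.mpr h)
    obtain ⟨k', rfl⟩ : ∃ k', k = k' + 1 := ⟨k - 1, by omega⟩
    refine ⟨k', rfl, runs_assign (v := 2 * (u + 1)) rfl ?_ ?_ ?_⟩
    · simp [Expr.ok, Expr.val, BinOp.safe, w3]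
      omega
    · simp only [Expr.val, BinOp.nat, w3]; ring
    · intro σ3 x3 f3
      refine ⟨rfl, u + 1, by omega, x3, fun r hr => by rw [f3 r (by omega), f2 r hr], ?_⟩
      simp only [Expr.cost]
      omega
  intro hz
  obtain rfl : k = 0 := hcond.mp hz
  obtain rfl : u = t := by omega
  clear hup hcond hz
  generalize u = t at *
  simp only [Expr.cost]
  generalize hK : 2 * t = K at *
  have w1 : σ2 1 = i := by rw [f2 1 (by decide), h1]
  have w2 : σ2 2 = j := by rw [f2 2 (by decide), h2]
  refine Runs.block_cons (runs_assign (v := q) rfl ?_ ?_ ?_)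
  · simp [Expr.ok, w3]
    omega
  · simp only [Expr.val, w3, e1]
  intro σ4 v4 f4
  refine Runs.block_cons (runs_assign (v := p) rfl ?_ ?_ ?_)
  · simp [Expr.ok, f4, w3]
    omega
  · simp [Expr.val, f4, w3, e2]
  intro σ5 v5 f5
  refine Runs.block_cons (runs_assign (v := d) rfl ?_ ?_ ?_)
  · simp [Expr.ok, Expr.val, BinOp.safe, f4, f5, w3]
    constructorm* _ ∧ _ <;> omega
  · simp [Expr.val, BinOp.nat, f4, f5, w3, e3]
  intro σ6 v6 f6
  refine Runs.block_cons (runs_assign (v := N) rfl ?_ ?_ ?_)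
  · simp [Expr.ok, Expr.val, BinOp.safe, f4, f5, f6, w3]
    constructorm* _ ∧ _ <;> omega
  · simp [Expr.val, BinOp.nat, f4, f5, f6, w3, e4]
  intro σ7 v19 f7
  refine Runs.block_cons (runs_assign (v := j + 1 - i) rfl ?_ ?_ ?_)
  · simp [Expr.ok, Expr.val, BinOp.safe, BinOp.nat, f4, f5, f6, f7, w1, w2]
    constructorm* _ ∧ _ <;> omega
  · simp [Expr.val, BinOp.nat, f4, f5, f6, f7, w1, w2]
  intro σ8 v7 f8
  generalize hm : j + 1 - i = m at *
  refine Runs.block_cons (runs_assign (v := q) rfl ?_ ?_ ?_)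
  · simp [Expr.ok, f5, f6, f7, f8, v4]
    omega
  · simp [Expr.val, f5, f6, f7, f8, v4]
  intro σ9 v17 f9
  simp only [Expr.cost]
  -- Unless the search stops immediately at `q`, the preceding failed test `2 ^ (s - 1) < 3 m` gives
  -- `2 ^ s < 6 m`. It stops by `K` because `3 m ≤ 12 n ≤ 2 ^ K`.
  refine Runs.block_cons (Runs.whileExpr rfl (fun k σ' o' T' => o' = o2 ∧ ∃ s, s + k = K ∧
    σ' 17 = s ∧ (∀ r, r ≠ 17 → σ' r = σ9 r) ∧ q ≤ s ∧ (s = q ∨ 2 ^ s < 6 * m) ∧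
    T' + 20 * k ≤ 30 * K + 60) (K - q) ?_ ?_)
  swap
  · exact ⟨rfl, q, by omega, v17, fun r _ => rfl, le_rfl, Or.inl rfl, by omega⟩
  rintro k σ10 o10 T10 ⟨rfl, s, hsk, x17, f10, hqs, hsm, hT10⟩
  have x7 : σ10 7 = m := by simp [f10, f9, v7]
  have hsp : 2 ^ s ≤ 2 ^ K := Nat.pow_le_pow_right (by norm_num) (by omega)
  have hcond : Expr.val w e σ10 (.bin .lt (.bin .shl (.lit 1) (.var 17))
      (.bin .mul (.lit 3) (.var 7))) = 0 ↔ 3 * m ≤ 2 ^ s := by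
    simp only [Expr.val, BinOp.nat, x17, x7, one_mul, ltNat_eq_zero, not_lt]
  refine ⟨?_, ?_, ?_⟩
  · simp [Expr.ok, Expr.val, BinOp.safe, x17, x7]
    constructorm* _ ∧ _ <;> omega
  swap
  · intro hnz
    have hlt : 2 ^ s < 3 * m := by
      rw [← not_le]; exact fun h => hnz (hcond.mpr h)
    have hsK : s < K := by
      rw [← Nat.pow_lt_pow_iff_right (show 1 < 2 by norm_num)]
      omega
    obtain ⟨k', rfl⟩ : ∃ k', k = k' + 1 := ⟨k - 1, by omega⟩
    refine ⟨k', rfl, runs_assign (v := s + 1) rfl ?_ ?_ ?_⟩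
    · simp [Expr.ok, Expr.val, BinOp.safe, x17, hw0]
      omega
    · simp only [Expr.val, BinOp.nat, x17]
    · intro σ11 y17 f11
      refine ⟨rfl, s + 1, by omega, y17, fun r hr => by rw [f11 r hr, f10 r hr], by omega, ?_, ?_⟩
      · right; rw [pow_succ]; omega
      · simp only [Expr.cost]
        omega
  intro hz
  have hlarge := hcond.mp hz
  simp only [Expr.cost]
  have hstart : StartLevel K q m s := ⟨hqs, by omega, hlarge, hsm⟩
  have x1 : σ10 1 = i := by simp [f4, f5, f6, f7, f8, f9, f10, w1]
  have x2 : σ10 2 = j := by simp [f4, f5, f6, f7, f8, f9, f10, w2]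
  have x3 : σ10 3 = K := by simp [f4, f5, f6, f7, f8, f9, f10, w3]
  have x4 : σ10 4 = q := by simp [f5, f6, f7, f8, f9, f10, v4]
  have x5 : σ10 5 = p := by simp [f6, f7, f8, f9, f10, v5]
  have x6 : σ10 6 = d := by simp [f7, f8, f9, f10, v6]
  have x19 : σ10 19 = N := by simp [f8, f9, f10, v19]
  have hcond2 : Expr.val w e σ10 (.bin .eq (.bin .shr (.var 1) (.var 17))
      (.bin .shr (.var 2) (.var 17))) = 0 ↔ i / 2 ^ s ≠ j / 2 ^ s := by
    simp only [Expr.val, BinOp.nat, x1, x2, x17, eqNat_eq_zero, ne_eq]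
  have fin : ∀ σ11 T11 off, (∀ r, r ≠ 1 → r ≠ 9 → σ11 r = σ10 r) → σ11 1 = i + off → σ11 9 = off →
      (off = 0 ∧ i / 2 ^ s = j / 2 ^ s ∨ off = shift K ∧ i / 2 ^ s ≠ j / 2 ^ s) →
      T11 ≤ 30 * K + 120 →
      Runs w e (.block [.assign 8 (.bin .add (.var 3) (.lit 1)), .assign 10 (.lit 0)]) σ11 o10 T11
        (fun σ' o' T' => o' = o10 ∧ T' ≤ 50 * K + 100 ∧ ∃ s0 off, StartLevel K q m s0 ∧
          (off = 0 ∧ i / 2 ^ s0 = j / 2 ^ s0 ∨ off = shift K ∧ i / 2 ^ s0 ≠ j / 2 ^ s0) ∧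
          Regs K q (i + off) m s0 off p d N σ' ∧ σ' 8 = K + 1 ∧ σ' 10 = 0) := by
    intro σ11 T11 off f11 y1 y9 hoff hT11
    have y3 : σ11 3 = K := by simp [f11, x3]
    refine Runs.block_cons (runs_assign (v := K + 1) rfl ?_ ?_ ?_)
    · simp [Expr.ok, Expr.val, BinOp.safe, y3, hw0]
      omega
    · simp only [Expr.val, BinOp.nat, y3]
    intro σ12 v8 f12
    refine Runs.block_cons (runs_assign (v := 0) rfl ?_ rfl ?_)
    · simp [Expr.ok]
    intro σ13 v10 f13
    refine Runs.block_nil ⟨rfl, ?_, s, off, hstart, hoff, ?_, ?_, v10⟩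
    · simp only [Expr.cost]
      omega
    · constructor <;> simp [*]
    · simp [f13, v8]
  refine Runs.block_cons (Runs.ifExpr rfl ?_ ?_ ?_)
  · simp only [Expr.ok, BinOp.safe, x1, x2, x17]
    constructorm* _ ∧ _ <;> first | trivial | omega
  · intro hnz
    have heq : i / 2 ^ s = j / 2 ^ s := by
      by_contra h
      exact hnz (hcond2.mpr h)
    refine runs_assign (v := 0) rfl ?_ rfl ?_
    · simp [Expr.ok]
    intro σ11 y9 f11
    refine fin σ11 _ 0 (fun r _ hr => f11 r hr) (by simp [f11, x1]) y9 (Or.inl ⟨rfl, heq⟩) ?_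
    simp only [Expr.cost]
    omega
  · intro hz2
    have hne := hcond2.mp hz2
    have hsh : shift K ≤ 2 * 2 ^ K := by rw [shift]; omega
    refine Runs.block_cons (runs_assign (v := shift K) rfl ?_ ?_ ?_)
    · simp [Expr.ok, Expr.val, BinOp.safe, BinOp.nat, x3]
      constructorm* _ ∧ _ <;> omega
    · simp [Expr.val, BinOp.nat, x3, shift]
    intro σ11 y9 f11
    refine Runs.block_cons (runs_assign (v := i + shift K) rfl ?_ ?_ ?_)
    · simp [Expr.ok, Expr.val, BinOp.safe, f11, x1, y9]
      constructorm* _ ∧ _ <;> omega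
    · simp [Expr.val, BinOp.nat, f11, x1, y9]
    intro σ12 y1 f12
    refine Runs.block_nil (fin σ12 _ (shift K) (fun r h1 h9 => by rw [f12 r h1, f11 r h9]) y1
      (by simp [f12, y9]) (Or.inr ⟨rfl, hne⟩) ?_)
    simp only [Expr.cost]
    omega

end RangeMajority

/-! ### The encoding -/

namespace SparseDict

open WordRAM

/-- The encoding of a set `S` of numbers below `2 ^ (K + 3 + q)` and of the numbers `p` and `d`. -/
noncomputable def encode (K q p d : ℕ) (S : ℕ → Prop) [DecidablePred S] : List Bool :=
  bits K q ++ (bits K p ++ (bits K d ++ (bits K (Nat.count S (2 ^ (K + 3 + q))) ++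
    (tree S q (K + 3) 0 ++ lows S q (Nat.count S (2 ^ (K + 3 + q)))))))

variable {w K q p d : ℕ} {S : ℕ → Prop} [DecidablePred S]

theorem length_encode : (encode K q p d S).length + (K + 3 + q + 2) =
    4 * K + (q + 2) * 2 ^ (K + 3) + q * Nat.count S (2 ^ (K + 3 + q)) := by
  have := length_tree S q (K + 3) 0
  simp only [encode, List.length_append, length_bits, length_lows]
  omega

theorem length_encode_lt (hK : 4 ≤ K) (hq : q ≤ K)
    (hN : Nat.count S (2 ^ (K + 3 + q)) < 2 ^ K) : (encode K q p d S).length < 2 ^ (5 * K) := by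
  have h1 := length_encode (K := K) (q := q) (p := p) (d := d) (S := S)
  have h2 : K < 2 ^ K := Nat.lt_two_pow_self
  have h3 : 2 ^ 4 ≤ 2 ^ K := Nat.pow_le_pow_right (by norm_num) hK
  have h4 : 2 ^ (5 * K) = 2 ^ K * 2 ^ K * (2 ^ K * 2 ^ K * 2 ^ K) := by
    rw [mul_comm, pow_mul]; ring
  have h5 : 2 ^ (K + 3) = 8 * 2 ^ K := by rw [pow_add]; ring
  rw [h5] at h1
  rw [h4]
  generalize Nat.count S (2 ^ (K + 3 + q)) = N at *
  generalize 2 ^ K = Z at *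
  have h6 : q * N ≤ Z * Z := Nat.mul_le_mul (by omega) hN.le
  have h7 : (q + 2) * (8 * Z) ≤ (2 * Z) * (8 * Z) := Nat.mul_le_mul_right _ (by omega)
  have h8 : 16 * Z ≤ Z * Z := Nat.mul_le_mul_right _ h3
  have h9 : Z * Z * (16 * 16 * 16) ≤ Z * Z * (Z * Z * Z) :=
    Nat.mul_le_mul_left _ (Nat.mul_le_mul (Nat.mul_le_mul h3 h3) h3)
  nlinarith

theorem represents_encode (hK : 4 ≤ K) (hq : q ≤ K) (hw : 10 * K ≤ w)
    (hN : Nat.count S (2 ^ (K + 3 + q)) < 2 ^ K) :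
    Represents w (encode K q p d S) K q S where
  eq := ⟨bits K q ++ (bits K p ++ (bits K d ++ bits K (Nat.count S (2 ^ (K + 3 + q))))),
    by simp [encode], by simp; omega⟩
  length_lt := length_encode_lt hK hq hN
  four_le := hK
  le := hq
  word := hw

theorem readBits_encode (hw : K ≤ w) (hq : q < 2 ^ K) (hp : p < 2 ^ K) (hd : d < 2 ^ K)
    (hN : Nat.count S (2 ^ (K + 3 + q)) < 2 ^ K) :
    readBits w (encode K q p d S) 0 K = q ∧ readBits w (encode K q p d S) K K = p ∧
    readBits w (encode K q p d S) (2 * K) K = d ∧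
    readBits w (encode K q p d S) (3 * K) K = Nat.count S (2 ^ (K + 3 + q)) :=
  ⟨readBits_of_eq (pre := []) hw hq (by rw [encode]; rfl) rfl,
    readBits_of_eq (pre := bits K q) hw hp (by rw [encode]) (by simp),
    readBits_of_eq (pre := bits K q ++ bits K p) hw hd (by rw [encode, List.append_assoc])
      (by simp; omega),
    readBits_of_eq (pre := bits K q ++ (bits K p ++ bits K d)) hw hN
      (by simp only [encode, List.append_assoc]; rfl) (by simp; omega)⟩

end SparseDict

/-! ### Correctness of the query program -/

namespace RangeMajority

open WordRAM SparseDict HeavyBlocks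
open scoped Classical

universe v

variable {α : Type v}

/-- The two conditions on the offset `off` of the copy in which the query is answered. -/
def Offset (K i j s0 off : ℕ) : Prop :=
  off = 0 ∧ i / 2 ^ s0 = j / 2 ^ s0 ∨ off = shift K ∧ i / 2 ^ s0 ≠ j / 2 ^ s0

/-- Codes of larger blocks come first, so going down from level `K` lets the cells of earlier levels
accumulate. At most `K + 1` levels are visited. -/
theorem runs_query {w : ℕ} {e : List Bool} {n i j q p d t : ℕ} {B : ℕ → Option α} {σ : ℕ → ℕ}
    (ht : t = Nat.clog 4 (12 * n)) (h0 : σ 0 = n)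
    (h1 : σ 1 = i) (h2 : σ 2 = j) (hij : i ≤ j) (hj : j < n)
    (hrep : Represents w e (2 * t) q (Keys (2 * t) q B))
    (e1 : readBits w e 0 (2 * t) = q) (e2 : readBits w e (2 * t) (2 * t) = p)
    (e3 : readBits w e (2 * (2 * t)) (2 * t) = d)
    (e4 : readBits w e (3 * (2 * t)) (2 * t) =
      Nat.count (Keys (2 * t) q B) (2 ^ (2 * t + 3 + q)))
    (hV : ∀ s0 off, StartLevel (2 * t) q (j + 1 - i) s0 → Offset (2 * t) i j s0 off →
      Valid w e (2 * t) q B (i + off) (j + 1 - i) s0 off p d) :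
    Runs w e query σ [] 0 (fun _ o' T' =>
      T' ≤ (2 ^ q + 2) * (2000 * ((2 * t + 3) * (2 * t + 3))) ∧ ∃ s0 off,
      StartLevel (2 * t) q (j + 1 - i) s0 ∧ Offset (2 * t) i j s0 off ∧
      Collected (2 * t) q B (i + off) (j + 1 - i) s0 off
        (Freq B (i + off) (j + 1 - i) p d) o' (before (2 * t) q B (2 ^ (2 * t + 2 - s0)))) := by
  unfold query
  refine Runs.block_cons ((runs_prepare ht hrep.word hrep.le h0 h1 h2 hij hj e1 e2 e3 e4).mono ?_)
  rintro σ1 o1 T1 ⟨rfl, hT1, s0, off, hs, hoff, R, v8, v10⟩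
  have V := hV s0 off hs hoff
  obtain ⟨b1, b2, -, -, b5, b6, -, -⟩ := V.rep.bounds
  generalize 2 * t = K at *
  have hsK := hs.le_top
  have hnw : K + 1 < 2 ^ w := by omega
  have hw0 : 0 < w := by have := V.rep.word; have := V.rep.four_le; omega
  obtain ⟨W, hW⟩ : ∃ W, W = (2 ^ q + 2) * (1000 * (K + 3)) + 10 := ⟨_, rfl⟩
  refine Runs.block_cons (Runs.whileExpr rfl (fun k σ' o' T' =>
    Regs K q (i + off) (j + 1 - i) s0 off p d (Nat.count (Keys K q B) (2 ^ (K + 3 + q))) σ' ∧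
    s0 + k ≤ K + 1 ∧ σ' 8 = s0 + k ∧
    σ' 10 = cells K q B (2 ^ (K + 2 - (s0 + k)) * 2 ^ (K + 1)) ∧
    Collected K q B (i + off) (j + 1 - i) s0 off (Freq B (i + off) (j + 1 - i) p d) o'
      (before K q B (2 ^ (K + 2 - (s0 + k)))) ∧
    T' + k * W ≤ 50 * K + 100 + (K + 1) * W) (K + 1 - s0) ?_ ?_)
  · rintro k σ2 o2 T2 ⟨R2, hk, w8, w10, hC, hT2⟩
    have w17 := R2.r17
    refine ⟨?_, ?_, ?_⟩
    · simp only [Expr.ok, BinOp.safe, w17, w8]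
      clear hW hT2 hT1
      constructorm* _ ∧ _ <;> first | trivial | omega
    · intro hz
      simp only [Expr.val, BinOp.nat, w17, w8, ltNat_eq_zero, not_lt] at hz
      obtain rfl : k = 0 := by clear hW hT2 hT1; omega
      refine Runs.block_nil ⟨?_, s0, off, hs, hoff, hC⟩
      simp only [Expr.cost]
      have hq : 1 ≤ 2 ^ q := Nat.one_le_two_pow
      have h3 : (2 ^ q + 2) * (1000 * (K + 3)) * (K + 3) =
        (2 ^ q + 2) * (1000 * ((K + 3) * (K + 3))) := by ring
      have h4 : 3 * (1000 * ((K + 3) * (K + 3))) ≤ (2 ^ q + 2) * (1000 * ((K + 3) * (K + 3))) :=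
        Nat.mul_le_mul_right _ (by linarith)
      have h5 : (2 ^ q + 2) * (2000 * ((K + 3) * (K + 3))) =
        2 * ((2 ^ q + 2) * (1000 * ((K + 3) * (K + 3)))) := by ring
      have h6 : (K + 1) * W ≤ (K + 3) * W := Nat.mul_le_mul_right _ (by linarith)
      have h7 : (K + 3) * W = (2 ^ q + 2) * (1000 * (K + 3)) * (K + 3) + 10 * (K + 3) := by
        rw [hW]; ring
      rw [h5]
      nlinarith
    · intro hnz
      simp only [Expr.val, BinOp.nat, w17, w8, ne_eq, ltNat_eq_zero, not_not] at hnz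
      obtain ⟨k', rfl⟩ := Nat.exists_eq_add_one.mpr (show 0 < k by clear hW hT2 hT1; omega)
      refine ⟨k', rfl, (runs_level V (s := s0 + k') R2 (by rw [w8]; ring) ?_ (Nat.le_add_right _ _)
        (by clear hW hT2 hT1; omega) ?_).mono ?_⟩
      · rw [w10]; congr 3; clear hW hT2 hT1; omega
      · convert hC using 3; clear hW hT2 hT1; omega
      · rintro σ3 o3 T3 ⟨R3, x8, x10, hC3, hT3⟩
        refine ⟨R3, by linarith, x8, x10, hC3, ?_⟩
        simp only [Expr.cost] at hT3
        rw [add_mul, one_mul] at hT2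
        linarith
  · have hk : s0 + (K + 1 - s0) = K + 1 := by clear hW hT1; omega
    rw [hk]
    refine ⟨R, le_rfl, v8, ?_, V.bdd.collected_nil, ?_⟩
    · rw [v10, Bounded.cells_eq_zero]
      rw [show K + 2 - (K + 1) = 1 by clear hW hT1; omega, pow_one]
    · exact Nat.add_le_add hT1 (Nat.mul_le_mul_right _ (Nat.sub_le _ _))

end RangeMajority

/-! ### The two copies of the array, the rational threshold, and the reported list -/

namespace RangeMajority

open WordRAM SparseDict HeavyBlocks
open scoped Classical

universe v

variable {α : Type v} {n : ℕ}

/-- Two copies of the array. -/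
noncomputable def placed (A : Fin n → α) (K : ℕ) (l : ℕ) : Option α :=
  if h : l < n then some (A ⟨l, h⟩)
  else if h : shift K ≤ l ∧ l < shift K + n then some (A ⟨l - shift K, by omega⟩)
  else none

theorem placed_add (A : Fin n → α) {K off : ℕ} (hn : n ≤ shift K) (hoff : off = 0 ∨ off = shift K)
    (l : Fin n) : placed A K (l + off) = some (A l) := by
  rcases hoff with rfl | rfl
  · simp [placed]
  · have := l.isLt
    rw [placed, dif_neg (by omega), dif_pos (by omega)]
    simp

theorem lt_of_placed_ne_none {A : Fin n → α} {K l : ℕ} (h : placed A K l ≠ none) :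
    l < n ∨ shift K ≤ l ∧ l < shift K + n := by
  by_contra hl
  rw [not_or] at hl
  exact h (by rw [placed, dif_neg hl.1, dif_neg hl.2])

theorem shift_add_lt {K : ℕ} (hn : 12 * n ≤ 2 ^ K) (h : 0 < n) : shift K + n < 2 ^ (K + 1) := by
  rw [shift, pow_succ]
  omega

theorem le_shift {K : ℕ} (hn : 12 * n ≤ 2 ^ K) : n ≤ shift K := by
  rw [shift]
  omega

theorem bounded_placed (A : Fin n → α) {K q : ℕ} (hn : 12 * n ≤ 2 ^ K) (hq : q ≤ K) :
    Bounded K q (placed A K) where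
  lt l hl := by
    have h1 := lt_of_placed_ne_none hl
    have h2 := shift_add_lt hn (n := n)
    have h3 := le_shift hn (n := n)
    omega
  le := hq

/-- The factor is `2 * 2`: two copies, and at most two keys for each occupied position. -/
theorem count_keys_placed_le (A : Fin n → α) {K q : ℕ} (hn : 12 * n ≤ 2 ^ K) (hq : q ≤ K)
    (v : ℕ) : Nat.count (Keys K q (placed A K)) v ≤ 4 * n := by
  refine ((bounded_placed A hn hq).count_keys_le_card v).trans ?_
  have h : ((Finset.range (2 ^ (K + 1))).filter (fun l => placed A K l ≠ none)).card ≤ 2 * n := by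
    calc _ ≤ (Finset.range n ∪ Finset.Ico (shift K) (shift K + n)).card := by
          apply Finset.card_le_card
          intro l hl
          rw [Finset.mem_union, Finset.mem_range, Finset.mem_Ico]
          exact lt_of_placed_ne_none (Finset.mem_filter.mp hl).2
      _ ≤ _ := Finset.card_union_le _ _
      _ = 2 * n := by simp; ring
  omega

/-- The threshold can be replaced by a fraction with a denominator of at most `n`. -/
theorem exists_fraction {τ : ℝ} (h0 : 0 < τ) (h1 : τ ≤ 1) (hn : 0 < n) :
    ∃ p d : ℕ, 0 < p ∧ p ≤ d ∧ d ≤ n ∧ τ * d ≤ p ∧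
      ∀ m c : ℕ, 0 < m → m ≤ n → c ≤ m → (τ * m ≤ c ↔ p * m ≤ c * d) := by
  let F := (Finset.Icc 1 n ×ˢ Finset.Icc 1 n).filter
    (fun x : ℕ × ℕ => x.1 ≤ x.2 ∧ τ * x.2 ≤ x.1)
  have hF : ∀ x : ℕ × ℕ, x ∈ F ↔ ((1 ≤ x.1 ∧ x.1 ≤ n) ∧ 1 ≤ x.2 ∧ x.2 ≤ n) ∧ x.1 ≤ x.2 ∧
      τ * x.2 ≤ x.1 := fun x => by simp [F]
  -- The least fraction in `F`: an attained ratio `c / m ≥ τ` belongs to `F` and is therefore at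
  -- least `p / d`. The set contains `1 / 1` since `τ ≤ 1`.
  obtain ⟨⟨p, d⟩, hx, hmin⟩ := Finset.exists_min_image F (fun x => (x.1 : ℝ) / x.2)
    ⟨(1, 1), (hF _).mpr (by simp; exact ⟨hn, h1⟩)⟩
  obtain ⟨⟨⟨hp, -⟩, hd, hdn⟩, hpd, hτ⟩ := (hF _).mp hx
  simp only at hp hd hdn hpd hτ
  refine ⟨p, d, hp, hpd, hdn, hτ, fun m c hm hmn hcm => ?_⟩
  have hm' : (0 : ℝ) < m := by exact_mod_cast hm
  have hd' : (0 : ℝ) < d := by exact_mod_cast hd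
  constructor
  · intro h
    have hc : 0 < c := by
      have : (0 : ℝ) < c := (mul_pos h0 hm').trans_le h
      exact_mod_cast this
    have := hmin (c, m) ((hF _).mpr ⟨⟨⟨hc, hcm.trans hmn⟩, hm, hmn⟩, hcm, h⟩)
    rw [div_le_div_iff₀ hd' hm'] at this
    exact_mod_cast this
  · intro h
    have h2 : (p : ℝ) * m ≤ c * d := by exact_mod_cast h
    have h3 := mul_le_mul_of_nonneg_right hτ hm'.le
    have h4 : τ * m * d ≤ c * d := by linarith
    exact le_of_mul_le_mul_right h4 hd'

theorem freq_eq_count [DecidableEq α] (A : Fin n → α) {K off : ℕ} (hn : n ≤ shift K)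
    (hoff : off = 0 ∨ off = shift K) {i j : Fin n} (hij : i ≤ j) (a : α) :
    freq A i j a = Nat.count (fun k => placed A K (i + off + k) = some a) (j + 1 - i) := by
  rw [freq, Nat.count_eq_card_filter_range]
  refine Finset.card_bij (fun l _ => (l : ℕ) - i) ?_ ?_ ?_
  · intro l hl
    rw [Finset.mem_filter, Finset.mem_Icc, Fin.le_def, Fin.le_def] at hl
    rw [Finset.mem_filter, Finset.mem_range]
    refine ⟨by omega, ?_⟩
    rw [show (i : ℕ) + off + (l - i) = l + off by omega, placed_add A hn hoff, hl.2]
  · intro l hl l' hl' h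
    rw [Finset.mem_filter, Finset.mem_Icc, Fin.le_def, Fin.le_def] at hl hl'
    exact Fin.ext (by omega)
  · intro k hk
    rw [Finset.mem_filter, Finset.mem_range] at hk
    have hj := j.isLt
    have hi := Fin.le_def.mp hij
    refine ⟨⟨i + k, by omega⟩, ?_, by simp⟩
    rw [Finset.mem_filter, Finset.mem_Icc, Fin.le_def, Fin.le_def]
    refine ⟨⟨by simp, by simp; omega⟩, ?_⟩
    have h1 := placed_add A hn hoff ⟨i + k, by omega⟩
    rw [show (i + k : ℕ) + off = i + off + k by omega, hk.2] at h1
    exact (Option.some.inj h1).symm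

/-- The logarithm of the size of a block that starts with all its elements heavy. -/
theorem exists_granularity {p d : ℕ} (hp : 0 < p) (hpd : p ≤ d) :
    ∃ q, 6 * d ≤ 2 ^ q * p ∧ 2 ^ q * p < 12 * d := by
  have hex : ∃ q, 6 * d ≤ 2 ^ q * p :=
    ⟨6 * d, (Nat.lt_two_pow_self (n := 6 * d)).le.trans (Nat.le_mul_of_pos_right _ hp)⟩
  refine ⟨Nat.find hex, Nat.find_spec hex, ?_⟩
  rcases h : Nat.find hex with _ | q
  · omega
  · have := Nat.find_min hex (m := q) (by omega)
    rw [pow_succ]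
    have h2 : 2 ^ q * 2 * p = 2 * (2 ^ q * p) := by ring
    omega

/-- A frequent element is heavy in the block where the query starts. -/
theorem Freq.heavy {B : ℕ → Option α} {x m p d K q s0 : ℕ} {y : Option α} (h : Freq B x m p d y)
    (hs : StartLevel K q m s0) (hm : 0 < m) (hp : 0 < p) (hq : 6 * d ≤ 2 ^ q * p) :
    0 < Nat.count (fun k => B (x + k) = y) m ∧
      2 ^ s0 ≤ 2 ^ q * Nat.count (fun k => B (x + k) = y) m := by
  rw [Freq] at h
  generalize Nat.count (fun k => B (x + k) = y) m = c at *
  have hcd : 0 < c * d := (Nat.mul_pos hp hm).trans_le h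
  have hc := Nat.pos_of_mul_pos_right hcd
  have hd := Nat.pos_of_mul_pos_left hcd
  refine ⟨hc, ?_⟩
  -- On level `q` one occurrence suffices; otherwise `2 ^ s0 < 6 m`, and the choice of `q` turns
  -- frequency in the range into heaviness in the block.
  rcases hs.small with rfl | hs
  · exact Nat.le_mul_of_pos_right _ hc
  · refine hs.le.trans (Nat.le_of_mul_le_mul_right ?_ hd)
    calc 6 * m * d = 6 * d * m := by ring
      _ ≤ 2 ^ q * p * m := Nat.mul_le_mul_right _ hq
      _ = 2 ^ q * (p * m) := by ring
      _ ≤ 2 ^ q * (c * d) := Nat.mul_le_mul_left _ h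
      _ = _ := by ring

/-- Nothing wrong is listed because every candidate was tested, and `hfrac` makes that test
equivalent to being a majority. Nothing is missed because of `Freq.heavy` and `exists_around`. -/
theorem isAnswer_of_collected [DecidableEq α] {τ : ℝ} (A : Fin n → α)
    {K q p d s0 off : ℕ} (hn : 12 * n ≤ 2 ^ K) (hoff : off = 0 ∨ off = shift K) {i j : Fin n}
    (hij : i ≤ j) (hqK : q ≤ K) (hp : 0 < p) (hq : 6 * d ≤ 2 ^ q * p)
    (hfrac : ∀ m c : ℕ, 0 < m → m ≤ n → c ≤ m → (τ * m ≤ c ↔ p * m ≤ c * d))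
    (hs : StartLevel K q (j + 1 - i) s0)
    (hblock : (i + off) / 2 ^ s0 = (i + off + (j + 1 - i - 1)) / 2 ^ s0) {out : List ℕ}
    (hC : Collected K q (placed A K) (i + off) (j + 1 - i) s0 off
      (Freq (placed A K) (i + off) (j + 1 - i) p d) out
      (before K q (placed A K) (2 ^ (K + 2 - s0)))) :
    ∃ L : List (Fin n), out = L.map Fin.val ∧ IsAnswer τ A i j L := by
  have hi := Fin.le_def.mp hij
  have hj := j.isLt
  have hsh := le_shift hn
  have hb := bounded_placed A hn hqK
  obtain ⟨L, rfl⟩ : ∃ L : List (Fin n), L.map Fin.val = out := by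
    refine ⟨out.pmap Fin.mk (fun o ho => ?_), by simp [List.map_pmap]⟩
    have := hC.range o ho
    omega
  have hmap : (L.map Fin.val).map (fun o => placed A K (o + off)) = (L.map A).map some := by
    simp only [List.map_map]
    exact List.map_congr_left fun l _ => placed_add A hsh hoff l
  refine ⟨L, rfl, ?_, ?_, ?_⟩
  · intro l hl
    have := hC.range l (List.mem_map_of_mem hl)
    rw [Fin.le_def, Fin.le_def]
    omega
  · have h := hC.nodup
    rw [hmap] at h
    exact h.of_map
  · intro a
    have h := hC.mem (some a)
    rw [hmap, List.mem_map_of_injective (Option.some_injective α)] at h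
    rw [h, IsMajority, freq_eq_count A hsh hoff hij,
      show ((j : ℕ) : ℝ) - ((i : ℕ) : ℝ) + 1 = ((j + 1 - i : ℕ) : ℝ) by
        rw [Nat.cast_sub (by omega)]; push_cast; ring,
      hfrac _ _ (by omega) (by omega) (Nat.count_le _)]
    constructor
    · rintro ⟨l, -, -, -, hf⟩
      rw [Freq] at hf
      convert hf
    · intro hf
      replace hf : Freq (placed A K) (i + off) (j + 1 - i) p d (some a) := by
        rw [Freq]; convert hf
      obtain ⟨h1, h2⟩ := hf.heavy hs (by omega) hp hq
      obtain ⟨l, hl, hla⟩ := hb.exists_around (by simp) hs.le_top (by omega) hblock h1 h2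
      exact ⟨l, hl, hb.idx_lt_of_around hl, hla, hf⟩

end RangeMajority

/-! ### Choice of parameters and the bounds on space and time -/

namespace RangeMajority

open WordRAM SparseDict HeavyBlocks
open scoped Classical

universe v

variable {α : Type v} {n : ℕ}

/-- A correct run of the query program on an encoding. -/
theorem exists_exec_query [DecidableEq α] {τ : ℝ} (A : Fin n → α) {t K q p d w : ℕ}
    (ht : t = Nat.clog 4 (12 * n)) (hKt : K = 2 * t) (hn : 12 * n ≤ 2 ^ K) (hK : 4 ≤ K)
    (hqK : q ≤ K) (hp : 0 < p) (hpd : p ≤ d) (hdn : d ≤ n) (hq : 6 * d ≤ 2 ^ q * p)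
    (hfrac : ∀ m c : ℕ, 0 < m → m ≤ n → c ≤ m → (τ * m ≤ c ↔ p * m ≤ c * d))
    (hw : 10 * K ≤ w) {i j : Fin n} (hij : i ≤ j) :
    ∃ (T : ℕ) (s : State) (L : List (Fin n)),
      Exec w (encode K q p d (Keys K q (placed A K))) query (initState n i j) T s ∧
      s.out = L.map Fin.val ∧ IsAnswer τ A i j L ∧
      T ≤ (2 ^ q + 2) * (2000 * ((K + 3) * (K + 3))) := by
  have hi := Fin.le_def.mp hij
  have hj := j.isLt
  have hsh := le_shift hn
  have hsn := shift_add_lt hn (by omega : 0 < n)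
  have hb := bounded_placed A hn hqK
  have hcount : Nat.count (Keys K q (placed A K)) (2 ^ (K + 3 + q)) < 2 ^ K := by
    have := count_keys_placed_le A hn hqK (2 ^ (K + 3 + q))
    omega
  have hrep : Represents w (encode K q p d (Keys K q (placed A K))) K q (Keys K q (placed A K)) :=
    represents_encode hK hqK hw hcount
  have hKlt : K < 2 ^ K := Nat.lt_two_pow_self
  obtain ⟨e1, e2, e3, e4⟩ := readBits_encode (w := w) (p := p) (d := d) (by omega)
    (hqK.trans_lt hKlt) (by omega) (by omega) hcount
  have hblock : ∀ s0 off, StartLevel K q (j + 1 - i) s0 → Offset K i j s0 off →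
      (i + off) / 2 ^ s0 = (i + off + (j + 1 - i - 1)) / 2 ^ s0 := by
    rintro s0 off hs (⟨rfl, h⟩ | ⟨rfl, h⟩)
    · rw [add_zero, h]
      congr 1
      omega
    · rw [hKt]
      refine shift_block (hKt ▸ hs.le_top) hs.large (by omega) ?_
      rwa [show (i : ℕ) + (j + 1 - i - 1) = j by omega]
  have hoff : ∀ {s0 off}, Offset K i j s0 off → off = 0 ∨ off = shift K :=
    fun h => h.imp And.left And.left
  have hV : ∀ s0 off, StartLevel K q (j + 1 - i) s0 → Offset K i j s0 off →
      Valid w (encode K q p d (Keys K q (placed A K))) K q (placed A K) (i + off) (j + 1 - i) s0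
        off p d := by
    intro s0 off hs ho
    have : off ≤ shift K := by rcases hoff ho with rfl | rfl <;> simp
    exact
      { rep := hrep
        bdd := hb
        lt := by omega
        pos := by omega
        m_le := by omega
        le_s0 := hs.le
        s0_le := hs.le_top
        p_pos := hp
        p_le := by omega
        d_le := by omega
        off_le := Nat.le_add_left _ _
        block := hblock s0 off hs ho }
  obtain ⟨T, s, -, hex, -, hT, s0, off, hs, ho, hC⟩ :=
    runs_query (σ := (initState n i j).reg) ht rfl rfl rfl hi hj (hKt ▸ hrep) (hKt ▸ e1)
      (hKt ▸ e2) (hKt ▸ e3) (hKt ▸ e4) (hKt ▸ hV) (initState n i j) (fun _ _ => rfl) rfl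
  rw [← hKt] at hs ho hC hT hex
  obtain ⟨L, hL, hA⟩ := isAnswer_of_collected A hn (hoff ho) hij hqK hp hq hfrac hs
    (hblock s0 off hs ho) hC
  exact ⟨T, s, L, hex, hL, hA, by simpa using hT⟩

/-- Rounding `12 n` up to a power of `4` costs a factor of at most `4`. -/
theorem two_pow_clog_le (h : 0 < n) : 12 * n ≤ 2 ^ (2 * Nat.clog 4 (12 * n)) ∧
    2 ^ (2 * Nat.clog 4 (12 * n)) ≤ 48 * n ∧ 4 ≤ 2 * Nat.clog 4 (12 * n) := by
  have h1 := Nat.le_pow_clog (b := 4) (by norm_num) (12 * n)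
  have h2 := Nat.pow_pred_clog_lt_self (b := 4) (by norm_num) (x := 12 * n) (by omega)
  have h3 : 1 < Nat.clog 4 (12 * n) := by
    rw [Nat.lt_clog_iff_pow_lt (by norm_num)]
    omega
  rw [pow_mul, show 2 ^ 2 = 4 by norm_num]
  obtain ⟨c, hc⟩ : ∃ c, Nat.clog 4 (12 * n) = c + 1 := ⟨_, (Nat.sub_add_cancel h3.le).symm⟩
  rw [hc] at h1 h2 h3 ⊢
  rw [Nat.pred_succ] at h2
  rw [pow_succ] at h1 ⊢
  omega

theorem one_le_logb_inv {τ : ℝ} (h0 : 0 < τ) (h1 : τ ≤ 1 / 2) : 1 ≤ Real.logb 2 (1 / τ) := by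
  rw [Real.le_logb_iff_rpow_le (by norm_num) (by positivity), Real.rpow_one, le_div_iff₀ h0]
  linarith

/-- The length of the encoding. -/
theorem length_encode_le {τ : ℝ} (h0 : 0 < τ) (h1 : τ ≤ 1 / 2) {K q p d : ℕ} {S : ℕ → Prop}
    [DecidablePred S] (hq : (2 : ℝ) ^ q ≤ 12 / τ) (hK : 2 ^ K ≤ 48 * n)
    (hN : Nat.count S (2 ^ (K + 3 + q)) ≤ 4 * n) :
    ((encode K q p d S).length : ℝ) ≤ 10000000 * (n * Real.logb 2 (1 / τ)) := by
  have hl := one_le_logb_inv h0 h1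
  have hq5 : (q : ℝ) ≤ 5 * Real.logb 2 (1 / τ) := by
    -- From `2 ^ q ≤ 12 / τ ≤ 2 ^ 4 / τ` one gets `q ≤ 4 + lg (1 / τ)`, and `lg (1 / τ) ≥ 1` absorbs
    -- the constant.
    have h2 : Real.logb 2 ((2 : ℝ) ^ q) ≤ Real.logb 2 (2 ^ 4 * (1 / τ)) := by
      apply Real.logb_le_logb_of_le (by norm_num) (by positivity)
      refine hq.trans ?_
      rw [div_eq_mul_one_div]
      exact mul_le_mul_of_nonneg_right (by norm_num) (by positivity)
    rw [Real.logb_mul (by positivity) (by positivity), Real.logb_pow, Real.logb_pow,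
      Real.logb_self_eq_one (by norm_num)] at h2
    push_cast at h2
    linarith
  have h2 := length_encode (K := K) (q := q) (p := p) (d := d) (S := S)
  have h3 : K < 2 ^ K := Nat.lt_two_pow_self
  have h4 : 2 ^ (K + 3) = 8 * 2 ^ K := by rw [pow_add]; ring
  have h5 : (q + 2) * 2 ^ (K + 3) ≤ (q + 2) * (384 * n) := Nat.mul_le_mul_left _ (by omega)
  have h6 := Nat.mul_le_mul_left q hN
  have h7 : (encode K q p d S).length ≤ 192 * n + (q + 2) * (384 * n) + q * (4 * n) := by omega
  calc ((encode K q p d S).length : ℝ)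
      ≤ ((192 * n + (q + 2) * (384 * n) + q * (4 * n) : ℕ) : ℝ) := by exact_mod_cast h7
    _ = n * (960 + 388 * q) := by push_cast; ring
    _ ≤ n * (10000000 * Real.logb 2 (1 / τ)) :=
        mul_le_mul_of_nonneg_left (by linarith) (Nat.cast_nonneg n)
    _ = _ := by ring

/-- The logarithmic bound on the height of the tree. -/
theorem height_le {K : ℕ} (h : 0 < n) (hK : 2 ^ K ≤ 48 * n) :
    1 ≤ Real.logb 2 (n + 1) ∧ (K : ℝ) ≤ 7 * Real.logb 2 (n + 1) := by
  have hn : (1 : ℝ) ≤ n := by exact_mod_cast h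
  have h1 : 1 ≤ Real.logb 2 (n + 1) := by
    rw [Real.le_logb_iff_rpow_le (by norm_num) (by positivity), Real.rpow_one]
    linarith
  have hK' : (2 : ℝ) ^ K ≤ 48 * n := by exact_mod_cast hK
  -- From `48 n ≤ 2 ^ 6 (n + 1)` one gets `K ≤ 6 + lg (n + 1)`, and `lg (n + 1) ≥ 1` absorbs the
  -- constant.
  have h2 : Real.logb 2 ((2 : ℝ) ^ K) ≤ Real.logb 2 (2 ^ 6 * ((n : ℝ) + 1)) := by
    apply Real.logb_le_logb_of_le (by norm_num) (by positivity)
    refine hK'.trans ?_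
    norm_num
    linarith
  rw [Real.logb_mul (by positivity) (by positivity), Real.logb_pow, Real.logb_pow,
    Real.logb_self_eq_one (by norm_num)] at h2
  push_cast at h2
  exact ⟨h1, by linarith⟩

theorem time_le {τ : ℝ} (h0 : 0 < τ) (h1 : τ ≤ 1 / 2) {K q T : ℕ} (hn : 0 < n)
    (hq : (2 : ℝ) ^ q ≤ 12 / τ) (hK : 2 ^ K ≤ 48 * n)
    (hT : T ≤ (2 ^ q + 2) * (2000 * ((K + 3) * (K + 3)))) :
    (T : ℝ) ≤ 10000000 * (Real.logb 2 (n + 1) ^ 2 / τ) := by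
  obtain ⟨hl, hKl⟩ := height_le hn hK
  have hτ : 2 ≤ 1 / τ := by
    rw [le_div_iff₀ h0]
    linarith
  have hq' : (2 : ℝ) ^ q + 2 ≤ 13 * (1 / τ) := by
    rw [div_eq_mul_one_div] at hq
    linarith
  have hK3 : (K : ℝ) + 3 ≤ 10 * Real.logb 2 (n + 1) := by linarith
  calc (T : ℝ) ≤ (((2 ^ q + 2) * (2000 * ((K + 3) * (K + 3))) : ℕ) : ℝ) := by exact_mod_cast hT
    _ = ((2 : ℝ) ^ q + 2) * (2000 * (((K : ℝ) + 3) * ((K : ℝ) + 3))) := by push_cast; ring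
    _ ≤ (13 * (1 / τ)) *
        (2000 * ((10 * Real.logb 2 (n + 1)) * (10 * Real.logb 2 (n + 1)))) := by
          gcongr
    _ = 2600000 * (Real.logb 2 (n + 1) ^ 2 / τ) := by ring
    _ ≤ _ := mul_le_mul_of_nonneg_right (by norm_num) (by positivity)

/-- The encoding for a threshold and an array length. -/
theorem exists_encoding {τ : ℝ} (h0 : 0 < τ) (h1 : τ ≤ 1 / 2) (hn : 0 < n) [DecidableEq α] :
    ∃ enc : (Fin n → α) → List Bool, ∀ A : Fin n → α,
      ((enc A).length : ℝ) ≤ 10000000 * (n * Real.logb 2 (1 / τ)) ∧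
      ∀ w : ℕ, 70 * Real.logb 2 (n + 1) ≤ w → ∀ i j : Fin n, i ≤ j →
        ∃ (T : ℕ) (s : State) (L : List (Fin n)),
          Exec w (enc A) query (initState n i j) T s ∧ s.out = L.map Fin.val ∧
          IsAnswer τ A i j L ∧ (T : ℝ) ≤ 10000000 * (Real.logb 2 (n + 1) ^ 2 / τ) := by
  obtain ⟨p, d, hp, hpd, hdn, hτ, hfrac⟩ := exists_fraction h0 (h1.trans (by norm_num)) hn
  obtain ⟨q, hq1, hq2⟩ := exists_granularity hp hpd
  obtain ⟨hK1, hK2, hK4⟩ := two_pow_clog_le hn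
  obtain ⟨K, hK⟩ : ∃ K, K = 2 * Nat.clog 4 (12 * n) := ⟨_, rfl⟩
  rw [← hK] at hK1 hK2 hK4
  -- The chain is `2 ^ q ≤ 2 ^ q p < 12 d ≤ 12 n ≤ 2 ^ K`.
  have hqK : q ≤ K := by
    rw [← Nat.pow_le_pow_iff_right (show 1 < 2 by norm_num)]
    have := Nat.le_mul_of_pos_right (2 ^ q) hp
    omega
  have hqτ : (2 : ℝ) ^ q ≤ 12 / τ := by
    have hd : (0 : ℝ) < d := by exact_mod_cast hp.trans_le hpd
    rw [le_div_iff₀ h0]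
    have h2 : (2 : ℝ) ^ q * p ≤ 12 * d := by exact_mod_cast hq2.le
    have h3 := mul_le_mul_of_nonneg_left hτ (show (0 : ℝ) ≤ 2 ^ q by positivity)
    refine le_of_mul_le_mul_right ?_ hd
    linarith
  refine ⟨fun A => encode K q p d (Keys K q (placed A K)), fun A =>
    ⟨length_encode_le h0 h1 hqτ hK2 (count_keys_placed_le A hK1 hqK _), fun w hw i j hij => ?_⟩⟩
  have hw10 : 10 * K ≤ w := by
    have := (height_le hn hK2).2
    have h2 : (10 : ℝ) * K ≤ w := by linarith
    exact_mod_cast h2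
  obtain ⟨T, s, L, hex, hL, hA, hT⟩ := exists_exec_query A rfl hK hK1 hK4 hqK hp hpd hdn hq1 hfrac
    hw10 hij
  exact ⟨T, s, L, hex, hL, hA, time_le h0 h1 hn hqτ hK2 hT⟩

end RangeMajority

theorem lemma4 :
    ∃ (P : WordRAM.Cmd) (κ C : ℝ),
      ∀ (τ : ℝ), 0 < τ → τ ≤ 1 / 2 →
      ∀ (n : ℕ) (α : Type u) [DecidableEq α],
      ∃ enc : (Fin n → α) → List Bool,
      ∀ A : Fin n → α,
        ((enc A).length : ℝ) ≤ C * (n * Real.logb 2 (1 / τ)) ∧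
        ∀ (w : ℕ), κ * Real.logb 2 (n + 1) ≤ w →
        ∀ i j : Fin n, i ≤ j →
          ∃ (t : ℕ) (s : WordRAM.State) (L : List (Fin n)),
            WordRAM.Exec w (enc A) P (WordRAM.initState n i j) t s ∧
            s.out = L.map Fin.val ∧
            RangeMajority.IsAnswer τ A i j L ∧
            (t : ℝ) ≤ C * (Real.logb 2 (n + 1) ^ 2 / τ) := by
  -- The programs need `10 K` bits in a word and `K ≤ 7 lg (n + 1)`, hence `70`. The other constant
  -- is generous: `2600000` suffices for the time and `2900` for the space.
  refine ⟨RangeMajority.query, 70, 10000000, fun τ h0 h1 n α _ => ?_⟩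
  rcases Nat.eq_zero_or_pos n with rfl | hn
  · exact ⟨fun _ => [], fun A => ⟨by simp, fun _ _ i => i.elim0⟩⟩
  · exact RangeMajority.exists_encoding h0 h1 hn
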